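/- Let $n\ge 1$ and $k\ge 1$ be integers. Let $\mathfrak g=\mathfrak{osp}(1|2n)=\mathfrak g_{\bar 0}\oplus\mathfrak g_{\bar 1}$ be the complex Lie superalgebra of endomorphisms of $\mathbb C^{1|2n}$ preserving the standard nondegenerate even supersymmetric bilinear form, and let $(X|Y)=-\operatorname{Str}(XY)$; this is the nondegenerate even supersymmetric invariant form on $\mathfrak g$ whose restriction to $\mathfrak g_{\bar 0}=\mathfrak{sp}(2n)$ is the normalized one (long roots have square length $2$). Let $$\hat{\mathfrak g}=\mathfrak g\otimes\mathbb C[t,t^{-1}]\oplus\mathbb C K$$ be the affine Lie superalgebra, with $K$ central and, writing $x(m)=x\otimes t^m$, $$[x(m),y(l)]=[x,y](m+l)+m\,\delta_{m+l,0}\,(x|y)\,K .$$ Let $V^k(\mathfrak g)=U(\hat{\mathfrak g})\otimes_{U(\mathfrak g\otimes\mathbb C[t]\oplus\mathbb CK)}\mathbb C_k$ be its vacuum module of level $k$, where $\mathfrak g\otimes\mathbb C[t]$ acts on $\mathbb C_k=\mathbb C\mathbf 1$ by $0$ and $K$ acts by $k$. Let $L_{\mathfrak g}(k,0)$ be the irreducible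 quotient of $V^k(\mathfrak g)$, that is, its quotient by its maximal proper $\hat{\mathfrak g}$-submodule (which is graded by conformal weight). It carries the vertex superalgebra structure with vacuum $\mathbf 1$ determined by $Y(x(-1)\mathbf 1,z)=\sum_{m\in\mathbb Z}x(m)z^{-m-1}$ for $x\in\mathfrak g$. For a vertex superalgebra $V$ with $Y(u,z)=\sum_{m\in\mathbb Z}u_mz^{-m-1}$, put $$C_2(V)=\operatorname{span}_{\mathbb C}\{u_{-2}v : u,v\in V\},$$ and call $V$ $C_2$-cofinite if $\dim V/C_2(V)<\infty$. Then the vertex operator superalgebra $L_{\mathfrak{osp}(1|2n)}(k,0)$ is $C_2$-cofinite: $$\dim_{\mathbb C}\; L_{\mathfrak{osp}(1|2n)}(k,0)\big/C_2\big(L_{\mathfrak{osp}(1|2n)}(k,0)\big)<\infty .$$ -/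

import Mathlib

noncomputable section

namespace VSA

set_option linter.unusedSectionVars false

/-- The sign `(-1)^{pq}` attached to two parities. -/
def sgn (p q : ZMod 2) : ℂ := if p = 1 ∧ q = 1 then -1 else 1

theorem sgn_comm (p q : ZMod 2) : sgn p q = sgn q p := by
  simp only [sgn, and_comm]

theorem sgn_mul_self (p q : ZMod 2) : sgn p q * sgn p q = 1 := by
  unfold sgn; split_ifs <;> norm_num

theorem sgn_add_left (p q r : ZMod 2) : sgn (p + q) r = sgn p r * sgn q r := by
  have h : ∀ x : ZMod 2, x = 0 ∨ x = 1 := by decide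
  have h2 : (1 : ZMod 2) + 1 = 0 := by decide
  rcases h p with rfl | rfl <;> rcases h q with rfl | rfl <;> rcases h r with rfl | rfl <;>
    simp [sgn, h2]

theorem sgn_zero_left (q : ZMod 2) : sgn 0 q = 1 := by simp [sgn]

section Fields

variable {V : Type*} [AddCommGroup V] [Module ℂ V]

/-! ### Sums with finitely many nonzero terms -/

/-- All but finitely many terms of the sequence vanish. -/
def EvZero (f : ℕ → V) : Prop := ∃ N : ℕ, ∀ i, N ≤ i → f i = 0

theorem EvZero.finite {f : ℕ → V} (h : EvZero f) : (Function.support f).Finite := by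
  obtain ⟨N, hN⟩ := h
  refine (Set.finite_lt_nat N).subset fun i hi => ?_
  by_contra hc
  exact hi (hN i (by simpa using hc))

theorem EvZero.add {f g : ℕ → V} (hf : EvZero f) (hg : EvZero g) :
    EvZero fun i => f i + g i := by
  obtain ⟨N, hN⟩ := hf
  obtain ⟨M, hM⟩ := hg
  exact ⟨max N M, fun i hi => by
    simp only [hN i (le_trans (le_max_left _ _) hi), hM i (le_trans (le_max_right _ _) hi),
      add_zero]⟩

theorem EvZero.smulZ {f : ℕ → V} (hf : EvZero f) (c : ℕ → ℤ) : EvZero fun i => c i • f i := by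
  obtain ⟨N, hN⟩ := hf
  exact ⟨N, fun i hi => by simp only [hN i hi, smul_zero]⟩

theorem EvZero.of_int {f : ℤ → V} (N : ℤ) (h : ∀ n, N ≤ n → f n = 0) (n : ℤ) :
    EvZero fun i : ℕ => f (n + i) :=
  ⟨(N - n).toNat, fun i hi => h _ (by omega)⟩

theorem finsum_succ {f : ℕ → V} (h : EvZero f) : ∑ᶠ i, f i = f 0 + ∑ᶠ i, f (i + 1) := by
  obtain ⟨N, hN⟩ := h
  have h1 : ∑ᶠ i, f i = ∑ i ∈ Finset.range (N + 1), f i := by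
    apply finsum_eq_sum_of_support_subset
    intro i hi
    by_contra hc
    simp only [Finset.coe_range, Set.mem_Iio, not_lt] at hc
    exact hi (hN i (by omega))
  have h2 : ∑ᶠ i, f (i + 1) = ∑ i ∈ Finset.range N, f (i + 1) := by
    apply finsum_eq_sum_of_support_subset
    intro i hi
    by_contra hc
    simp only [Finset.coe_range, Set.mem_Iio, not_lt] at hc
    exact hi (hN (i + 1) (by omega))
  rw [h1, h2, Finset.sum_range_succ']
  abel

theorem map_finsum_evZero {W : Type*} [AddCommGroup W] [Module ℂ W] (φ : V →ₗ[ℂ] W) {f : ℕ → V}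
    (h : EvZero f) : φ (∑ᶠ i, f i) = ∑ᶠ i, φ (f i) :=
  φ.toAddMonoidHom.map_finsum h.finite

/-! ### The expansion of `(z - w)^l` applied to a doubly indexed family -/

/-- `Trunc2 f`: the family `f m n` vanishes for `n` large, uniformly in `m`. -/
def Trunc2 (f : ℤ → ℤ → V) : Prop := ∃ N : ℤ, ∀ n, N ≤ n → ∀ m, f m n = 0

/-- The `(m, n)` coefficient of `(z - w)^l ∑ f m n z^{-m-1} w^{-n-1}`, expanded in `|z| > |w|`. -/
def half (l : ℤ) (f : ℤ → ℤ → V) (m n : ℤ) : V :=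
  ∑ᶠ i : ℕ, ((-1) ^ i * Ring.choose l i : ℤ) • f (m + l - i) (n + i)

theorem Trunc2.ev {f : ℤ → ℤ → V} (hf : Trunc2 f) (a : ℕ → ℤ) (n : ℤ) :
    EvZero fun i : ℕ => f (a i) (n + i) := by
  obtain ⟨N, hN⟩ := hf
  exact ⟨(N - n).toNat, fun i hi => hN _ (by omega) _⟩

theorem half_zero (f : ℤ → ℤ → V) (m n : ℤ) : half 0 f m n = f m n := by
  unfold half
  rw [finsum_eq_single _ 0]
  · simp
  · intro i hi
    rw [Ring.choose_zero_pos ℤ (Nat.pos_of_ne_zero hi)]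
    simp

theorem half_succ {f : ℤ → ℤ → V} (hf : Trunc2 f) (l m n : ℤ) :
    half (l + 1) f m n = half l f (m + 1) n - half l f m (n + 1) := by
  unfold half
  have e0 : EvZero fun i : ℕ => ((-1) ^ i * Ring.choose (l + 1) i : ℤ) •
      f (m + (l + 1) - i) (n + i) := (hf.ev _ n).smulZ _
  have e1 : EvZero fun i : ℕ => ((-1) ^ i * Ring.choose l i : ℤ) •
      f (m + 1 + l - i) (n + i) := (hf.ev _ n).smulZ _
  have e2 : EvZero fun i : ℕ => ((-1) ^ i * Ring.choose l i : ℤ) •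
      f (m + l - i) (n + 1 + i) := (hf.ev _ (n + 1)).smulZ _
  rw [finsum_succ e0, finsum_succ e1]
  have e1' : EvZero fun i : ℕ => ((-1) ^ (i + 1) * Ring.choose l (i + 1) : ℤ) •
      f (m + 1 + l - (i + 1 : ℕ)) (n + (i + 1 : ℕ)) := by
    obtain ⟨N, hN⟩ := e1
    exact ⟨N, fun i hi => hN (i + 1) (by omega)⟩
  rw [add_sub_assoc (_ • _), ← finsum_sub_distrib e1'.finite e2.finite]
  congr 1
  · simp; congr 1; ring
  · refine finsum_congr fun i => ?_
    rw [Ring.choose_succ_succ]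
    have a1 : m + 1 + l - ((i + 1 : ℕ) : ℤ) = m + l - i := by push_cast; ring
    have a2 : m + (l + 1) - ((i + 1 : ℕ) : ℤ) = m + l - i := by push_cast; ring
    have a3 : n + 1 + (i : ℤ) = n + ((i + 1 : ℕ) : ℤ) := by push_cast; ring
    rw [a1, a2, a3, ← sub_smul]
    congr 1
    ring

theorem half_sub {f g : ℤ → ℤ → V} (hf : Trunc2 f) (hg : Trunc2 g) (l m n : ℤ) :
    half l (fun a b => f a b - g a b) m n = half l f m n - half l g m n := by
  unfold half
  rw [← finsum_sub_distrib ((hf.ev _ n).smulZ _).finite ((hg.ev _ n).smulZ _).finite]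
  simp only [smul_sub]

theorem half_add {f g : ℤ → ℤ → V} (hf : Trunc2 f) (hg : Trunc2 g) (l m n : ℤ) :
    half l (fun a b => f a b + g a b) m n = half l f m n + half l g m n := by
  unfold half
  rw [← finsum_add_distrib ((hf.ev _ n).smulZ _).finite ((hg.ev _ n).smulZ _).finite]
  simp only [smul_add]

theorem map_half {W : Type*} [AddCommGroup W] [Module ℂ W] (φ : V →ₗ[ℂ] W) {f : ℤ → ℤ → V}
    (hf : Trunc2 f) (l m n : ℤ) : φ (half l f m n) = half l (fun a b => φ (f a b)) m n := by
  unfold half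
  rw [map_finsum_evZero φ ((hf.ev _ n).smulZ _)]
  simp only [map_zsmul]

theorem half_smul (c : ℂ) {f : ℤ → ℤ → V} (hf : Trunc2 f) (l m n : ℤ) :
    half l (fun a b => c • f a b) m n = c • half l f m n :=
  (map_half (c • LinearMap.id) hf l m n).symm

theorem succ_mul_choose (l : ℤ) (i : ℕ) :
    ((i : ℤ) + 1) * Ring.choose l (i + 1) = (l - i) * Ring.choose l i := by
  have h := Ring.descPochhammer_eq_factorial_smul_choose l (i + 1)
  have h' := Ring.descPochhammer_eq_factorial_smul_choose l i
  rw [descPochhammer_succ_right, Polynomial.smeval_mul, h', Nat.factorial_succ] at h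
  simp only [Polynomial.smeval_sub, Polynomial.smeval_X, Polynomial.smeval_natCast, nsmul_eq_mul,
    pow_one, pow_zero] at h
  have hp : ((i.factorial : ℕ) : ℤ) ≠ 0 := by exact_mod_cast i.factorial_ne_zero
  apply mul_left_cancel₀ hp
  push_cast at h
  linear_combination -h

end Fields

section Fields

variable {V : Type*} [AddCommGroup V] [Module ℂ V]
/-- The swapped family. -/
def swp (g : ℤ → ℤ → V) : ℤ → ℤ → V := fun n m => g m n

/-- The coefficient of `(z - w)^l (f - s g)`, with `f` expanded in `|z| > |w|` and `g` expanded
in `|w| > |z|`. -/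
def bor (s : ℂ) (l : ℤ) (f g : ℤ → ℤ → V) (m n : ℤ) : V :=
  half l f m n - (s * (-1) ^ l) • half l (swp g) n m

theorem bor_zero (s : ℂ) (f g : ℤ → ℤ → V) (m n : ℤ) : bor s 0 f g m n = f m n - s • g m n := by
  simp [bor, half_zero, swp]

theorem bor_succ (s : ℂ) {f g : ℤ → ℤ → V} (hf : Trunc2 f) (hg : Trunc2 (swp g)) (l m n : ℤ) :
    bor s (l + 1) f g m n = bor s l f g (m + 1) n - bor s l f g m (n + 1) := by
  unfold bor
  rw [half_succ hf, half_succ hg, zpow_add₀ (by norm_num), zpow_one]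
  module

theorem map_bor {W : Type*} [AddCommGroup W] [Module ℂ W] (φ : V →ₗ[ℂ] W) (s : ℂ)
    {f g : ℤ → ℤ → V} (hf : Trunc2 f) (hg : Trunc2 (swp g)) (l m n : ℤ) :
    φ (bor s l f g m n) = bor s l (fun a b => φ (f a b)) (fun a b => φ (g a b)) m n := by
  unfold bor
  rw [map_sub, map_smul, map_half φ hf, map_half φ hg]
  rfl

/-- The operator `F m n ↦ F (m + 1) n - F m (n + 1)`, multiplication by `z - w`. -/
def dif : Module.End ℂ (ℤ → ℤ → V) where
  toFun F m n := F (m + 1) n - F m (n + 1)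
  map_add' F G := by funext m n; simp only [Pi.add_apply]; abel
  map_smul' c F := by funext m n; simp only [Pi.smul_apply, RingHom.id_apply, smul_sub]

theorem dif_apply (F : ℤ → ℤ → V) (m n : ℤ) : dif F m n = F (m + 1) n - F m (n + 1) := rfl

theorem bor_nat (s : ℂ) {f g : ℤ → ℤ → V} (hf : Trunc2 f) (hg : Trunc2 (swp g)) (N : ℕ) :
    bor s N f g = (dif ^ N) fun m n => f m n - s • g m n := by
  induction N with
  | zero =>
    funext m n
    simpa using bor_zero s f g m n
  | succ N ih =>
    funext m n
    rw [pow_succ', Module.End.mul_apply, ← ih, dif_apply]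
    push_cast
    exact bor_succ s hf hg N m n

theorem map_dif_pow {W : Type*} [AddCommGroup W] [Module ℂ W] (φ : V →ₗ[ℂ] W) (N : ℕ)
    (F : ℤ → ℤ → V) (m n : ℤ) : (dif ^ N) (fun a b => φ (F a b)) m n = φ ((dif ^ N) F m n) := by
  induction N generalizing m n with
  | zero => rfl
  | succ N ih => simp only [pow_succ', Module.End.mul_apply, dif_apply, ih, map_sub]

/-- The sequence of modes `a n` defines a field: `a n w = 0` for `n` large, for each `w`. -/
def IsFld (a : ℤ → Module.End ℂ V) : Prop := ∀ w, ∃ N : ℤ, ∀ n, N ≤ n → a n w = 0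

theorem IsFld.trunc2 {a b : ℤ → Module.End ℂ V} (hb : IsFld b) (w : V) :
    Trunc2 fun m n => a m (b n w) := by
  obtain ⟨N, hN⟩ := hb w
  exact ⟨N, fun n hn m => by simp only [hN n hn, map_zero]⟩

theorem IsFld.trunc2' {a b : ℤ → Module.End ℂ V} (ha : IsFld a) (w : V) :
    Trunc2 (swp fun m n => b n (a m w)) := by
  obtain ⟨N, hN⟩ := ha w
  exact ⟨N, fun n hn m => by simp only [swp, hN n hn, map_zero]⟩

/-- Mutual locality of two fields whose sign of exchange is `s`: `(z - w)^N` annihilates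
`a(z) b(w) - s b(w) a(z)` for some `N`. -/
def Loc (s : ℂ) (a b : ℤ → Module.End ℂ V) : Prop :=
  ∃ N : ℕ, ∀ w, (dif ^ N) (fun m n => a m (b n w) - s • b n (a m w)) = 0

/-- The coefficients of `(z - w)^l (a(z) b(w) - s b(w) a(z))`, suitably expanded. -/
def borAB (s : ℂ) (l : ℤ) (a b : ℤ → Module.End ℂ V) (m n : ℤ) (w : V) : V :=
  bor s l (fun i j => a i (b j w)) (fun i j => b j (a i w)) m n

theorem Loc.bor_eq_zero {s : ℂ} {a b : ℤ → Module.End ℂ V} (ha : IsFld a) (hb : IsFld b)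
    (h : Loc s a b) : ∃ N : ℤ, ∀ l, N ≤ l → ∀ m n w, borAB s l a b m n w = 0 := by
  obtain ⟨N, hN⟩ := h
  refine ⟨N, fun l hl m n w => ?_⟩
  obtain ⟨M, rfl⟩ : ∃ M : ℕ, l = ((M + N : ℕ) : ℤ) := ⟨(l - N).toNat, by omega⟩
  unfold borAB
  rw [bor_nat s (hb.trunc2 w) (ha.trunc2' w), pow_add, Module.End.mul_apply, hN w, map_zero]
  rfl

theorem borAB_swap {s : ℂ} (hs : s * s = 1) (l : ℤ) (a b : ℤ → Module.End ℂ V) (m n : ℤ) (w : V) :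
    borAB s l a b m n w = -(s * (-1) ^ l) • borAB s l b a n m w := by
  unfold borAB bor swp
  have h : (s * (-1 : ℂ) ^ l) * (s * (-1) ^ l) = 1 := by
    rw [mul_mul_mul_comm, hs, ← mul_zpow]; simp
  rw [smul_sub, smul_smul, neg_mul, h]
  module

theorem Loc.symm {s : ℂ} (hs : s * s = 1) {a b : ℤ → Module.End ℂ V} (ha : IsFld a) (hb : IsFld b)
    (h : Loc s a b) : Loc s b a := by
  obtain ⟨N, hN⟩ := h.bor_eq_zero ha hb
  refine ⟨N.toNat, fun w => ?_⟩
  rw [← bor_nat s (ha.trunc2 w) (hb.trunc2' w)]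
  funext m n
  change borAB s _ b a m n w = 0
  rw [borAB_swap hs, hN _ (by omega), smul_zero]

/-! ### The `l`-th product of two fields -/

/-- The `l`-th product `a_(l) b` of two fields. -/
def nprod (s : ℂ) {a b : ℤ → Module.End ℂ V} (ha : IsFld a) (hb : IsFld b) (l : ℤ) (n : ℤ) :
    Module.End ℂ V where
  toFun w := borAB s l a b 0 n w
  map_add' v w := by
    unfold borAB bor
    simp only [map_add]
    refine Eq.trans (congrArg₂ (fun x y => x - (s * (-1) ^ l) • y)
      (half_add (hb.trunc2 (a := a) v) (hb.trunc2 w) l 0 n)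
      (half_add (ha.trunc2' (b := b) v) (ha.trunc2' w) l n 0)) ?_
    module
  map_smul' c w := by
    unfold borAB bor
    simp only [map_smul]
    refine Eq.trans (congrArg₂ (fun x y => x - (s * (-1) ^ l) • y)
      (half_smul c (hb.trunc2 (a := a) w) l 0 n)
      (half_smul c (ha.trunc2' (b := b) w) l n 0)) ?_
    simp only [RingHom.id_apply]
    module

theorem nprod_apply (s : ℂ) {a b : ℤ → Module.End ℂ V} (ha : IsFld a) (hb : IsFld b) (l n : ℤ)
    (w : V) : nprod s ha hb l n w = borAB s l a b 0 n w := rfl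

theorem half_eq_zero {l m n : ℤ} {f : ℤ → ℤ → V} (h : ∀ i : ℕ, f (m + l - i) (n + i) = 0) :
    half l f m n = 0 := by
  unfold half
  simp only [h, smul_zero, finsum_zero]

theorem IsFld.nprod (s : ℂ) {a b : ℤ → Module.End ℂ V} (ha : IsFld a) (hb : IsFld b) (l : ℤ) :
    IsFld (nprod s ha hb l) := by
  intro w
  obtain ⟨A, hA⟩ := ha w
  obtain ⟨B, hB⟩ := hb w
  choose C hC using fun i : ℕ => hb (a i w)
  obtain ⟨M, hM⟩ : ∃ M : ℤ, ∀ i ∈ Finset.range A.toNat, C i ≤ M := by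
    obtain ⟨M, hM⟩ := (Finset.image C (Finset.range A.toNat)).exists_le
    exact ⟨M, fun i hi => hM _ (Finset.mem_image_of_mem C hi)⟩
  refine ⟨max B (M + A.toNat - l), fun n hn => ?_⟩
  have hn1 : B ≤ n := le_trans (le_max_left _ _) hn
  have hn2 : M + A.toNat - l ≤ n := le_trans (le_max_right _ _) hn
  rw [nprod_apply, borAB, bor, half_eq_zero, half_eq_zero, smul_zero, sub_zero]
  · intro i
    by_cases hi : i < A.toNat
    · have := hM i (Finset.mem_range.2 hi)
      simp only [swp, zero_add]
      exact hC i _ (by omega)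
    · simp only [swp, zero_add]
      rw [hA _ (by omega), map_zero]
  · intro i
    rw [hB _ (by omega), map_zero]

/-! ### Locality of the product -/

/-- Multiplication by `x - z` on triply indexed families. -/
def dXZ : Module.End ℂ (ℤ → ℤ → ℤ → V) where
  toFun F m n k := F (m + 1) n k - F m n (k + 1)
  map_add' F G := by funext m n k; simp only [Pi.add_apply]; abel
  map_smul' c F := by funext m n k; simp only [Pi.smul_apply, RingHom.id_apply, smul_sub]

/-- Multiplication by `y - z` on triply indexed families. -/
def dYZ : Module.End ℂ (ℤ → ℤ → ℤ → V) where
  toFun F m n k := F m (n + 1) k - F m n (k + 1)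
  map_add' F G := by funext m n k; simp only [Pi.add_apply]; abel
  map_smul' c F := by funext m n k; simp only [Pi.smul_apply, RingHom.id_apply, smul_sub]

/-- Multiplication by `y - x` on triply indexed families. -/
def dYX : Module.End ℂ (ℤ → ℤ → ℤ → V) where
  toFun F m n k := F m (n + 1) k - F (m + 1) n k
  map_add' F G := by funext m n k; simp only [Pi.add_apply]; abel
  map_smul' c F := by funext m n k; simp only [Pi.smul_apply, RingHom.id_apply, smul_sub]

theorem dXZ_apply (F : ℤ → ℤ → ℤ → V) (m n k : ℤ) :
    dXZ F m n k = F (m + 1) n k - F m n (k + 1) := rfl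

theorem dYZ_apply (F : ℤ → ℤ → ℤ → V) (m n k : ℤ) :
    dYZ F m n k = F m (n + 1) k - F m n (k + 1) := rfl

theorem dYX_apply (F : ℤ → ℤ → ℤ → V) (m n k : ℤ) :
    dYX F m n k = F m (n + 1) k - F (m + 1) n k := rfl

theorem dYZ_eq : (dYZ : Module.End ℂ (ℤ → ℤ → ℤ → V)) = dYX + dXZ := by
  refine LinearMap.ext fun F => ?_
  funext m n k
  simp only [LinearMap.add_apply, Pi.add_apply, dYZ_apply, dYX_apply, dXZ_apply]
  abel

theorem comm_XZ_YZ : Commute (dXZ : Module.End ℂ (ℤ → ℤ → ℤ → V)) dYZ := by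
  refine LinearMap.ext fun F => ?_
  funext m n k
  simp only [Module.End.mul_apply, dYZ_apply, dXZ_apply]
  abel

theorem comm_YX_XZ : Commute (dYX : Module.End ℂ (ℤ → ℤ → ℤ → V)) dXZ := by
  refine LinearMap.ext fun F => ?_
  funext m n k
  simp only [Module.End.mul_apply, dYX_apply, dXZ_apply]
  abel

theorem comm_YX_YZ : Commute (dYX : Module.End ℂ (ℤ → ℤ → ℤ → V)) dYZ := by
  refine LinearMap.ext fun F => ?_
  funext m n k
  simp only [Module.End.mul_apply, dYX_apply, dYZ_apply]
  abel

theorem XZ_pow (N : ℕ) (F : ℤ → ℤ → ℤ → V) (m n k : ℤ) :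
    (dXZ ^ N) F m n k = (dif ^ N) (fun a b => F a n b) m k := by
  induction N generalizing m n k with
  | zero => rfl
  | succ N ih =>
    rw [pow_succ', pow_succ', Module.End.mul_apply, Module.End.mul_apply, dif_apply, ← ih, ← ih]
    rfl

theorem YZ_pow (N : ℕ) (F : ℤ → ℤ → ℤ → V) (m n k : ℤ) :
    (dYZ ^ N) F m n k = (dif ^ N) (fun a b => F m a b) n k := by
  induction N generalizing m n k with
  | zero => rfl
  | succ N ih =>
    rw [pow_succ', pow_succ', Module.End.mul_apply, Module.End.mul_apply, dif_apply, ← ih, ← ih]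
    rfl

/-- Truncation in the second index. -/
def Trunc3 (F : ℤ → ℤ → ℤ → V) : Prop := ∀ k, Trunc2 fun m n => F m n k

/-- Truncation in the first index. -/
def Trunc3' (F : ℤ → ℤ → ℤ → V) : Prop := ∀ k, Trunc2 (swp fun m n => F m n k)

/-- `bor` in the first two indices. -/
def bor3 (s : ℂ) (l : ℤ) (F G : ℤ → ℤ → ℤ → V) : ℤ → ℤ → ℤ → V :=
  fun m n k => bor s l (fun a b => F a b k) (fun a b => G a b k) m n

theorem Trunc2.sub {f g : ℤ → ℤ → V} (hf : Trunc2 f) (hg : Trunc2 g) :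
    Trunc2 fun a b => f a b - g a b := by
  obtain ⟨N, hN⟩ := hf
  obtain ⟨M, hM⟩ := hg
  exact ⟨max N M, fun n hn m => by
    simp only [hN n (le_trans (le_max_left _ _) hn), hM n (le_trans (le_max_right _ _) hn),
      sub_zero]⟩

theorem bor3_XZ (s : ℂ) (l : ℤ) {F G : ℤ → ℤ → ℤ → V} (hF : Trunc3 F) (hG : Trunc3' G) :
    bor3 s l (dXZ F) (dXZ G) = dXZ (bor3 s l F G) ∧
      Trunc3 (dXZ F) ∧ Trunc3' (dXZ G) := by
  have tF : ∀ k, Trunc2 fun m n => F (m + 1) n k := fun k => by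
    obtain ⟨N, hN⟩ := hF k
    exact ⟨N, fun n hn m => hN n hn (m + 1)⟩
  have tG : ∀ k, Trunc2 (swp fun m n => G (m + 1) n k) := fun k => by
    obtain ⟨N, hN⟩ := hG k
    exact ⟨N, fun n hn m => hN (n + 1) (by omega) m⟩
  refine ⟨?_, fun k => (tF k).sub (hF (k + 1)), fun k => (tG k).sub (hG (k + 1))⟩
  funext m n k
  have e1 := half_sub (tF k) (hF (k + 1)) l m n
  have e2 := half_sub (tG k) (hG (k + 1)) l n m
  have e3 : half l (fun m n => F (m + 1) n k) m n = half l (fun m n => F m n k) (m + 1) n := by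
    unfold half
    refine finsum_congr fun i => ?_
    rw [show m + 1 + l - (i : ℤ) = m + l - i + 1 by ring]
  have e4 : half l (swp fun m n => G (m + 1) n k) n m =
      half l (swp fun m n => G m n k) n (m + 1) := by
    unfold half swp
    refine finsum_congr fun i => ?_
    rw [show m + 1 + (i : ℤ) = m + i + 1 by ring]
  have e : half l (fun a b => (dXZ F) a b k) m n -
      (s * (-1) ^ l) • half l (swp fun a b => (dXZ G) a b k) n m =
      (half l (fun m n => F m n k) (m + 1) n -
        (s * (-1) ^ l) • half l (swp fun m n => G m n k) n (m + 1)) -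
      (half l (fun m n => F m n (k + 1)) m n -
        (s * (-1) ^ l) • half l (swp fun m n => G m n (k + 1)) n m) := by
    rw [← e3, ← e4]
    refine Eq.trans (congrArg₂ (fun x y => x - (s * (-1) ^ l) • y) e1 e2) ?_
    module
  exact e

theorem bor3_YZ (s : ℂ) (l : ℤ) {F G : ℤ → ℤ → ℤ → V} (hF : Trunc3 F) (hG : Trunc3' G) :
    bor3 s l (dYZ F) (dYZ G) = dYZ (bor3 s l F G) ∧
      Trunc3 (dYZ F) ∧ Trunc3' (dYZ G) := by
  have tF : ∀ k, Trunc2 fun m n => F m (n + 1) k := fun k => by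
    obtain ⟨N, hN⟩ := hF k
    exact ⟨N, fun n hn m => hN (n + 1) (by omega) m⟩
  have tG : ∀ k, Trunc2 (swp fun m n => G m (n + 1) k) := fun k => by
    obtain ⟨N, hN⟩ := hG k
    exact ⟨N, fun n hn m => hN n hn (m + 1)⟩
  refine ⟨?_, fun k => (tF k).sub (hF (k + 1)), fun k => (tG k).sub (hG (k + 1))⟩
  funext m n k
  have e1 := half_sub (tF k) (hF (k + 1)) l m n
  have e2 := half_sub (tG k) (hG (k + 1)) l n m
  have e3 : half l (fun m n => F m (n + 1) k) m n = half l (fun m n => F m n k) m (n + 1) := by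
    unfold half
    refine finsum_congr fun i => ?_
    rw [show n + 1 + (i : ℤ) = n + i + 1 by ring]
  have e4 : half l (swp fun m n => G m (n + 1) k) n m =
      half l (swp fun m n => G m n k) (n + 1) m := by
    unfold half swp
    refine finsum_congr fun i => ?_
    rw [show n + 1 + l - (i : ℤ) = n + l - i + 1 by ring]
  have e : half l (fun a b => (dYZ F) a b k) m n -
      (s * (-1) ^ l) • half l (swp fun a b => (dYZ G) a b k) n m =
      (half l (fun m n => F m n k) m (n + 1) -
        (s * (-1) ^ l) • half l (swp fun m n => G m n k) (n + 1) m) -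
      (half l (fun m n => F m n (k + 1)) m n -
        (s * (-1) ^ l) • half l (swp fun m n => G m n (k + 1)) n m) := by
    rw [← e3, ← e4]
    refine Eq.trans (congrArg₂ (fun x y => x - (s * (-1) ^ l) • y) e1 e2) ?_
    module
  exact e

theorem bor3_pow (s : ℂ) (l : ℤ) {F G : ℤ → ℤ → ℤ → V} (hF : Trunc3 F) (hG : Trunc3' G)
    (N M : ℕ) :
    bor3 s l (((dXZ ^ N) ((dYZ ^ M) F))) (((dXZ ^ N) ((dYZ ^ M) G))) =
      ((dXZ ^ N) ((dYZ ^ M) (bor3 s l F G))) := by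
  have h1 : ∀ M : ℕ, bor3 s l ((dYZ ^ M) F) ((dYZ ^ M) G) =
      (dYZ ^ M) (bor3 s l F G) ∧ Trunc3 ((dYZ ^ M) F) ∧
        Trunc3' ((dYZ ^ M) G) := by
    intro M
    induction M with
    | zero => exact ⟨rfl, hF, hG⟩
    | succ M ih =>
      simp only [pow_succ', Module.End.mul_apply]
      rw [← ih.1]
      exact bor3_YZ s l ih.2.1 ih.2.2
  have h2 : ∀ N : ℕ, bor3 s l (((dXZ ^ N) ((dYZ ^ M) F)))
      (((dXZ ^ N) ((dYZ ^ M) G))) =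
      ((dXZ ^ N) ((dYZ ^ M) (bor3 s l F G))) ∧
        Trunc3 (((dXZ ^ N) ((dYZ ^ M) F))) ∧
        Trunc3' (((dXZ ^ N) ((dYZ ^ M) G))) := by
    intro N
    induction N with
    | zero => simpa using h1 M
    | succ N ih =>
      simp only [pow_succ', Module.End.mul_apply]
      rw [← ih.1]
      exact bor3_XZ s l ih.2.1 ih.2.2
  exact (h2 N).1

theorem dif_pow_zero_of_le {N M : ℕ} (h : N ≤ M) {F : ℤ → ℤ → V} (hF : (dif ^ N) F = 0) :
    (dif ^ M) F = 0 := by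
  obtain ⟨K, rfl⟩ := Nat.exists_eq_add_of_le' h
  rw [pow_add, Module.End.mul_apply, hF, map_zero]

/-- Dong's lemma. -/
theorem Loc.nprod {s t u : ℂ} {a b c : ℤ → Module.End ℂ V} (ha : IsFld a) (hb : IsFld b)
    (hab : Loc s a b) (hac : Loc t a c) (hbc : Loc u b c) (l : ℤ) :
    Loc (t * u) (nprod s ha hb l) c := by
  obtain ⟨L, hL⟩ := hab.bor_eq_zero ha hb
  obtain ⟨N1, hN1⟩ := hac
  obtain ⟨N2, hN2⟩ := hbc
  obtain ⟨N, hN1', hN2'⟩ : ∃ N, N1 ≤ N ∧ N2 ≤ N := ⟨max N1 N2, le_max_left _ _, le_max_right _ _⟩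
  replace hN1 := fun w => dif_pow_zero_of_le hN1' (hN1 w)
  replace hN2 := fun w => dif_pow_zero_of_le hN2' (hN2 w)
  refine ⟨(N + (L - l).toNat) + N, fun w => ?_⟩
  -- the two triple families
  let F : ℤ → ℤ → ℤ → V := fun m n k => a m (b n (c k w)) - (t * u) • c k (a m (b n w))
  let G : ℤ → ℤ → ℤ → V := fun m n k => b n (a m (c k w)) - (t * u) • c k (b n (a m w))
  have tF1 : ∀ k, Trunc2 fun m n => a m (b n (c k w)) := fun k => hb.trunc2 _
  have tF2 : ∀ k, Trunc2 fun m n => ((t * u) • c k) (a m (b n w)) := fun k => by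
    obtain ⟨M, hM⟩ := hb.trunc2 (a := a) w
    exact ⟨M, fun n hn m => by simp only [hM n hn m, map_zero]⟩
  have tG1 : ∀ k, Trunc2 (swp fun m n => b n (a m (c k w))) := fun k => ha.trunc2' _
  have tG2 : ∀ k, Trunc2 (swp fun m n => ((t * u) • c k) (b n (a m w))) := fun k => by
    obtain ⟨M, hM⟩ := ha.trunc2' (b := b) w
    exact ⟨M, fun n hn m => by
      have := hM n hn m
      simp only [swp] at this ⊢
      simp only [this, map_zero]⟩
  have tF : Trunc3 F := fun k => (tF1 k).sub (tF2 k)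
  have tG : Trunc3' G := fun k => (tG1 k).sub (tG2 k)
  have key : ∀ l m n k, bor3 s l F G m n k =
      borAB s l a b m n (c k w) - (t * u) • c k (borAB s l a b m n w) := by
    intro l m n k
    have e := map_bor ((t * u) • c k) s (hb.trunc2 (a := a) w) (ha.trunc2' (b := b) w) l m n
    have e' : (t * u) • c k (borAB s l a b m n w) =
      bor s l (fun i j => ((t * u) • c k) (a i (b j w)))
        (fun i j => ((t * u) • c k) (b j (a i w))) m n := e
    rw [e']
    have e1 := half_sub (tF1 k) (tF2 k) l m n
    have e2 := half_sub (tG1 k) (tG2 k) l n m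
    unfold borAB bor
    refine Eq.trans (congrArg₂ (fun x y => x - (s * (-1) ^ l) • y) e1 e2) ?_
    module
  have hbig : ∀ l, L ≤ l → bor3 s l F G = 0 := by
    intro l hl
    funext m n k
    rw [key, hL l hl, hL l hl, map_zero, smul_zero, sub_zero]
    rfl
  have hXY : ∀ r : ℕ, (dYX ^ r) (bor3 s l F G) = (-1 : ℂ) ^ r • bor3 s (l + r) F G := by
    intro r
    induction r with
    | zero => simp
    | succ r ih =>
      rw [pow_succ', Module.End.mul_apply, ih]
      funext m n k
      have e := bor_succ s (tF k) (tG k) (l + r) m n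
      have e' : bor3 s (l + ((r + 1 : ℕ) : ℤ)) F G m n k =
          bor3 s (l + r) F G (m + 1) n k - bor3 s (l + r) F G m (n + 1) k := by
        push_cast
        rw [← add_assoc]
        exact e
      simp only [Pi.smul_apply]
      rw [e', pow_succ]
      change (-1 : ℂ) ^ r • bor3 s (l + r) F G m (n + 1) k -
        (-1 : ℂ) ^ r • bor3 s (l + r) F G (m + 1) n k = _
      module
  have hYZ : ∀ H H' : ℤ → ℤ → ℤ → V, (dYZ ^ N) H = 0 → (dXZ ^ N) H' = 0 →
      ((dXZ ^ N) ((dYZ ^ N) (H + H'))) = 0 := by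
    intro H H' h h'
    have e : (dXZ ^ N) ((dYZ ^ N) H') = (dYZ ^ N) ((dXZ ^ N) H') :=
      LinearMap.congr_fun (comm_XZ_YZ.pow_pow N N).eq H'
    rw [map_add, map_add, h, e, h', map_zero, map_zero, add_zero]
  have hF0 : ((dXZ ^ N) ((dYZ ^ N) F)) = 0 := by
    have : F = (fun m n k => a m (b n (c k w) - u • c k (b n w))) +
        (fun m n k => u • (a m (c k (b n w)) - t • c k (a m (b n w)))) := by
      funext m n k
      simp only [F, Pi.add_apply, map_sub, map_smul]
      module
    rw [this]
    refine hYZ _ _ ?_ ?_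
    · funext m n k
      rw [YZ_pow, map_dif_pow (a m), hN2]
      exact map_zero _
    · funext m n k
      rw [XZ_pow]
      have := map_dif_pow (u • (LinearMap.id : V →ₗ[ℂ] V)) N
        (fun m k => a m (c k (b n w)) - t • c k (a m (b n w))) m k
      rw [hN1] at this
      exact this.trans (map_zero _)
  have hG0 : ((dXZ ^ N) ((dYZ ^ N) G)) = 0 := by
    have : G = (fun m n k => t • (b n (c k (a m w)) - u • c k (b n (a m w)))) +
        (fun m n k => b n (a m (c k w) - t • c k (a m w))) := by
      funext m n k
      simp only [G, Pi.add_apply, map_sub, map_smul]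
      module
    rw [this]
    refine hYZ _ _ ?_ ?_
    · funext m n k
      rw [YZ_pow]
      have := map_dif_pow (t • (LinearMap.id : V →ₗ[ℂ] V)) N
        (fun n k => b n (c k (a m w)) - u • c k (b n (a m w))) n k
      rw [hN2] at this
      exact this.trans (map_zero _)
    · funext m n k
      rw [XZ_pow, map_dif_pow (b n), hN1]
      exact map_zero _
  have hPsi : ((dXZ ^ N) ((dYZ ^ N) (bor3 s l F G))) = 0 := by
    rw [← bor3_pow s l tF tG, hF0, hG0]
    funext m n k
    simp only [bor3, bor, Pi.zero_apply]
    rw [half_eq_zero (by intro i; rfl), half_eq_zero (by intro i; rfl), smul_zero, sub_zero]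
  have hfin : (dYZ ^ ((N + (L - l).toNat) + N)) (bor3 s l F G) = 0 := by
    rw [pow_add, Module.End.mul_apply]
    nth_rewrite 1 [dYZ_eq]
    rw [comm_YX_XZ.add_pow, LinearMap.sum_apply]
    refine Finset.sum_eq_zero fun r _ => ?_
    rw [Module.End.mul_apply, Module.End.mul_apply, Module.End.natCast_apply, map_nsmul, map_nsmul]
    refine (congrArg _ ?_).trans (smul_zero _)
    by_cases hr : (L - l).toNat ≤ r
    · have h0 : (dYX ^ r) (bor3 s l F G) = 0 := by
        rw [hXY, hbig _ (by omega), smul_zero]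
      have e1 : ∀ H : ℤ → ℤ → ℤ → V, ∀ q : ℕ, (dYX ^ r) ((dXZ ^ q) H) = (dXZ ^ q) ((dYX ^ r) H) :=
        fun H q => LinearMap.congr_fun (comm_YX_XZ.pow_pow r q).eq H
      have e2 : ∀ H : ℤ → ℤ → ℤ → V, ∀ q : ℕ, (dYX ^ r) ((dYZ ^ q) H) = (dYZ ^ q) ((dYX ^ r) H) :=
        fun H q => LinearMap.congr_fun (comm_YX_YZ.pow_pow r q).eq H
      rw [e1, e2, h0, map_zero, map_zero]
    · obtain ⟨q, hq⟩ : ∃ q, N + (L - l).toNat - r = q + N := ⟨(L - l).toNat - r, by omega⟩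
      rw [hq, pow_add, Module.End.mul_apply, hPsi, map_zero, map_zero]
  funext n k
  have h := congrFun (congrFun (congrFun hfin 0) n) k
  rw [YZ_pow] at h
  have hfun : (fun n k => VSA.nprod s ha hb l n (c k w) -
      (t * u) • c k (VSA.nprod s ha hb l n w)) = fun n k => bor3 s l F G 0 n k := by
    funext n k
    rw [key, nprod_apply, nprod_apply]
  rw [hfun]
  exact h
end Fields

/-! ### Vertex superalgebras -/

/-- A vertex superalgebra structure on a complex vector space `V`. `Y u n` is the mode `u_n`, so
that `Y(u, z) = ∑ u_n z^{-n-1}`. The field `jacobi` is the Jacobi identity, written out for the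
coefficients of the three formal variables. All sums in it have finitely many nonzero terms. -/
structure VertexSuperalgebra (V : Type*) [AddCommGroup V] [Module ℂ V] where
  /-- The even part `part 0` and the odd part `part 1`. -/
  part : ZMod 2 → Submodule ℂ V
  /-- The state-field correspondence. -/
  Y : V →ₗ[ℂ] ℤ → Module.End ℂ V
  /-- The vacuum vector. -/
  vac : V
  /-- The translation operator. -/
  D : Module.End ℂ V
  isCompl_part : IsCompl (part 0) (part 1)
  vac_mem : vac ∈ part 0
  Y_mem : ∀ (p q : ZMod 2) (u v : V) (n : ℤ), u ∈ part p → v ∈ part q → Y u n v ∈ part (p + q)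
  truncation : ∀ u v : V, ∃ N : ℤ, ∀ n, N ≤ n → Y u n v = 0
  Y_vac : ∀ n : ℤ, Y vac n = if n = -1 then LinearMap.id else 0
  creation : ∀ v : V, Y v (-1) vac = v
  creation_nonneg : ∀ (v : V) (n : ℤ), 0 ≤ n → Y v n vac = 0
  D_comm : ∀ (v w : V) (n : ℤ), D (Y v n w) - Y v n (D w) = Y (D v) n w
  D_deriv : ∀ (v : V) (n : ℤ), Y (D v) n = (-n : ℂ) • Y v (n - 1)
  jacobi : ∀ (p q : ZMod 2) (u v w : V), u ∈ part p → v ∈ part q → ∀ l m n : ℤ,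
    ∑ᶠ i : ℕ, Ring.choose m i • Y (Y u (l + i) v) (m + n - i) w =
      ∑ᶠ i : ℕ, ((-1) ^ i * Ring.choose l i : ℤ) •
        (Y u (m + l - i) (Y v (n + i) w) -
          (sgn p q * (-1) ^ l) • Y v (n + l - i) (Y u (m + i) w))

/-- `C_2(V)`, the span of all `u_{-2} v`. -/
def VertexSuperalgebra.C2 {V : Type*} [AddCommGroup V] [Module ℂ V] (A : VertexSuperalgebra V) :
    Submodule ℂ V :=
  Submodule.span ℂ {x | ∃ u v : V, x = A.Y u (-2) v}

/-- `V` is `C_2`-cofinite if `V / C_2(V)` is finite-dimensional. -/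
def VertexSuperalgebra.IsC2Cofinite {V : Type*} [AddCommGroup V] [Module ℂ V]
    (A : VertexSuperalgebra V) : Prop :=
  FiniteDimensional ℂ (V ⧸ A.C2)

section Fields2

variable {V : Type*} [AddCommGroup V] [Module ℂ V]

theorem zmod2_cases (p : ZMod 2) : p = 0 ∨ p = 1 := by revert p; decide

theorem choose_neg_two (i : ℕ) : (-1) ^ i * Ring.choose (-2 : ℤ) i = i + 1 := by
  induction i with
  | zero => simp
  | succ i ih =>
    have h := succ_mul_choose (-2) i
    have hp : ((i : ℤ) + 1) ≠ 0 := by positivity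
    apply mul_left_cancel₀ hp
    rw [pow_succ]
    push_cast
    linear_combination (-(-1) ^ i) * h + ((i : ℤ) + 2) * ih

/-! ### The Borcherds identity for mutually local fields -/

theorem borcherds {s : ℂ} {a b : ℤ → Module.End ℂ V} (ha : IsFld a) (hb : IsFld b)
    (h : Loc s a b) (l m n : ℤ) (w : V) :
    ∑ᶠ i : ℕ, Ring.choose m i • nprod s ha hb (l + i) (m + n - i) w = borAB s l a b m n w := by
  obtain ⟨N, hN⟩ := h.bor_eq_zero ha hb
  let S : ℤ → ℤ → ℤ → V := fun m l n =>
    ∑ᶠ i : ℕ, Ring.choose m i • nprod s ha hb (l + i) (m + n - i) w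
  have ev : ∀ (c : ℕ → ℤ) (d : ℕ → ℤ) (l : ℤ),
      EvZero fun i : ℕ => c i • nprod s ha hb (l + i) (d i) w := fun c d l =>
    ⟨(N - l).toNat, fun i hi => by
      simp only [nprod_apply, hN (l + i) (by omega), smul_zero]⟩
  have Szero : ∀ l n, S 0 l n = borAB s l a b 0 n w := by
    intro l n
    change ∑ᶠ i : ℕ, _ = _
    rw [finsum_eq_single _ 0]
    · simp [nprod_apply]
    · intro i hi
      rw [Ring.choose_zero_pos ℤ (Nat.pos_of_ne_zero hi), zero_smul]
  have Sbig : ∀ m l n, N ≤ l → S m l n = borAB s l a b m n w := by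
    intro m l n hl
    rw [hN l hl]
    change ∑ᶠ i : ℕ, _ = _
    simp only [nprod_apply]
    have : ∀ i : ℕ, borAB s (l + i) a b 0 (m + n - i) w = 0 := fun i => hN _ (by omega) _ _ _
    simp only [this, smul_zero, finsum_zero]
  have Srec : ∀ m l n, S (m + 1) l n = S m l (n + 1) + S m (l + 1) n := by
    intro m l n
    change ∑ᶠ i : ℕ, _ = ∑ᶠ i : ℕ, _ + ∑ᶠ i : ℕ, _
    have e1 := ev (fun i => Ring.choose m (i + 1)) (fun i => m + 1 + n - ((i + 1 : ℕ) : ℤ)) (l + 1)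
    have e2 := ev (fun i => Ring.choose m i) (fun i => m + n - i) (l + 1)
    rw [finsum_succ (ev (fun i => Ring.choose (m + 1) i) (fun i => m + 1 + n - i) l),
      finsum_succ (ev (fun i => Ring.choose m i) (fun i => m + (n + 1) - i) l)]
    have e3 : ∀ i : ℕ, Ring.choose m (i + 1) •
        nprod s ha hb (l + ((i + 1 : ℕ) : ℤ)) (m + (n + 1) - ((i + 1 : ℕ) : ℤ)) w =
        Ring.choose m (i + 1) • nprod s ha hb (l + 1 + i) (m + 1 + n - ((i + 1 : ℕ) : ℤ)) w := by
      intro i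
      rw [show l + ((i + 1 : ℕ) : ℤ) = l + 1 + i by push_cast; ring,
        show m + (n + 1) = m + 1 + n by ring]
    rw [add_assoc (_ • _)]
    rw [finsum_congr e3, ← finsum_add_distrib e1.finite e2.finite]
    congr 1
    · rw [Ring.choose_zero_right, Ring.choose_zero_right,
        show m + 1 + n - ((0 : ℕ) : ℤ) = m + (n + 1) - ((0 : ℕ) : ℤ) by ring]
    · refine finsum_congr fun i => ?_
      rw [Ring.choose_succ_succ, show l + ((i + 1 : ℕ) : ℤ) = l + 1 + i by push_cast; ring,
        show m + 1 + n - ((i + 1 : ℕ) : ℤ) = m + n - i by push_cast; ring, ← add_smul, add_comm]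
  have Rrec : ∀ m l n, borAB s l a b (m + 1) n w =
      borAB s l a b m (n + 1) w + borAB s (l + 1) a b m n w := by
    intro m l n
    have := bor_succ s (hb.trunc2 (a := a) w) (ha.trunc2' (b := b) w) l m n
    unfold borAB
    rw [this]
    abel
  have pos : ∀ m : ℕ, ∀ l n, S m l n = borAB s l a b m n w := by
    intro m
    induction m with
    | zero => exact Szero
    | succ m ih =>
      intro l n
      push_cast
      rw [Srec, Rrec, ih, ih]
  have neg : ∀ m : ℕ, ∀ l n, S (-m) l n = borAB s l a b (-m) n w := by
    intro m
    induction m with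
    | zero => simpa using Szero
    | succ m ih =>
      have aux : ∀ r : ℕ, ∀ n, S (-((m + 1 : ℕ) : ℤ)) (N - r) n =
          borAB s (N - r) a b (-((m + 1 : ℕ) : ℤ)) n w := by
        intro r
        induction r with
        | zero => exact fun n => Sbig _ _ _ (by simp)
        | succ r ihr =>
          intro n
          have h1 := Srec (-((m + 1 : ℕ) : ℤ)) (N - ((r + 1 : ℕ) : ℤ)) (n - 1)
          have h2 := Rrec (-((m + 1 : ℕ) : ℤ)) (N - ((r + 1 : ℕ) : ℤ)) (n - 1)
          rw [show -((m + 1 : ℕ) : ℤ) + 1 = -(m : ℤ) by push_cast; ring,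
            show N - ((r + 1 : ℕ) : ℤ) + 1 = N - r by push_cast; ring,
            sub_add_cancel] at h1 h2
          rw [ih, ihr, h2] at h1
          exact (add_right_cancel h1).symm
      intro l n
      by_cases hl : N ≤ l
      · exact Sbig _ _ _ hl
      · have := aux (N - l).toNat n
        rwa [show N - ((N - l).toNat : ℤ) = l by omega] at this
  change S m l n = _
  rcases Int.eq_nat_or_neg m with ⟨k, rfl | rfl⟩
  · exact pos k l n
  · exact neg k l n

/-! ### Translation covariance -/

/-- `[D, a(z)] = ∂ a(z)`. -/
def Cov (D : Module.End ℂ V) (a : ℤ → Module.End ℂ V) : Prop :=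
  ∀ n w, D (a n w) = a n (D w) - (n : ℂ) • a (n - 1) w

theorem half_cov {f : ℤ → ℤ → V} (hf : Trunc2 f) (l m n : ℤ) :
    half l (fun a b => (a : ℂ) • f (a - 1) b + (b : ℂ) • f a (b - 1)) m n =
      (m : ℂ) • half l f (m - 1) n + (n : ℂ) • half l f m (n - 1) := by
  have ev : ∀ (c : ℕ → ℤ) (d : ℕ → ℤ) (n : ℤ) (z : ℕ → ℂ),
      EvZero fun i : ℕ => c i • z i • f (d i) (n + i) := by
    intro c d n z
    obtain ⟨N, hN⟩ := hf.ev d n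
    exact ⟨N, fun i hi => by simp only [hN i hi, smul_zero]⟩
  let c : ℕ → ℤ := fun i => (-1) ^ i * Ring.choose l i
  let t : ℕ → V := fun i => c i • ((l - i : ℤ) : ℂ) • f (m + l - i - 1) (n + i)
  let u : ℕ → V := fun i => c i • ((i : ℤ) : ℂ) • f (m + l - i) (n - 1 + i)
  have et : EvZero t := ev _ _ _ _
  have eu : EvZero u := ev _ _ _ _
  have hc : ∀ i : ℕ, c (i + 1) * ((i + 1 : ℕ) : ℤ) = -(c i * (l - i)) := by
    intro i
    have := succ_mul_choose l i
    simp only [c, pow_succ]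
    push_cast
    linear_combination (-(-1) ^ i) * this
  have htu : ∑ᶠ i, u i = -∑ᶠ i, t i := by
    rw [finsum_succ eu]
    have h0 : u 0 = 0 := by simp [u]
    rw [h0, zero_add, ← finsum_neg_distrib]
    refine finsum_congr fun i => ?_
    simp only [u, t]
    rw [show m + l - ((i + 1 : ℕ) : ℤ) = m + l - i - 1 by push_cast; ring,
      show n - 1 + ((i + 1 : ℕ) : ℤ) = n + i by push_cast; ring,
      ← Int.cast_smul_eq_zsmul ℂ (c (i + 1)), ← Int.cast_smul_eq_zsmul ℂ (c i), smul_smul, smul_smul,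
      ← Int.cast_mul, ← Int.cast_mul, hc, Int.cast_neg, neg_smul]
  let P : ℕ → V := fun i => c i • (m : ℂ) • f (m + l - i - 1) (n + i)
  let Q : ℕ → V := fun i => c i • (n : ℂ) • f (m + l - i) (n - 1 + i)
  have eP : EvZero P := ev _ _ _ _
  have eQ : EvZero Q := ev _ _ _ _
  have hP : (m : ℂ) • half l f (m - 1) n = ∑ᶠ i, P i := by
    unfold half
    rw [smul_finsum]
    refine finsum_congr fun i => ?_
    simp only [P, c]
    rw [smul_comm, show m - 1 + l - (i : ℤ) = m + l - i - 1 by ring]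
  have hQ : (n : ℂ) • half l f m (n - 1) = ∑ᶠ i, Q i := by
    unfold half
    rw [smul_finsum]
    refine finsum_congr fun i => ?_
    simp only [Q, c]
    rw [smul_comm]
  have hL : half l (fun a b => (a : ℂ) • f (a - 1) b + (b : ℂ) • f a (b - 1)) m n =
      ∑ᶠ i, ((P i + t i) + (Q i + u i)) := by
    unfold half
    refine finsum_congr fun i => ?_
    simp only [P, Q, t, u, c]
    rw [show n + (i : ℤ) - 1 = n - 1 + i by ring]
    push_cast
    module
  rw [hL, hP, hQ, finsum_add_distrib (eP.add et).finite (eQ.add eu).finite,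
    finsum_add_distrib eP.finite et.finite, finsum_add_distrib eQ.finite eu.finite, htu]
  abel

theorem Trunc2.deriv {f : ℤ → ℤ → V} (hf : Trunc2 f) :
    Trunc2 fun a b => (a : ℂ) • f (a - 1) b + (b : ℂ) • f a (b - 1) := by
  obtain ⟨N, hN⟩ := hf
  exact ⟨N + 1, fun n hn m => by
    simp only [hN n (by omega), hN (n - 1) (by omega), smul_zero, add_zero]⟩

theorem Cov.nprod {D : Module.End ℂ V} {s : ℂ} {a b : ℤ → Module.End ℂ V} (ha : IsFld a)
    (hb : IsFld b) (ca : Cov D a) (cb : Cov D b) (l : ℤ) : Cov D (nprod s ha hb l) := by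
  intro n w
  simp only [nprod_apply]
  have e := map_bor D s (hb.trunc2 (a := a) w) (ha.trunc2' (b := b) w) l 0 n
  unfold borAB
  rw [e]
  have h1 : (fun i j => D (a i (b j w))) = fun i j => a i (b j (D w)) -
      ((i : ℂ) • a (i - 1) (b j w) + (j : ℂ) • a i (b (j - 1) w)) := by
    funext i j
    rw [ca, cb, map_sub, map_smul]
    abel
  have h2 : (fun i j => D (b j (a i w))) = fun i j => b j (a i (D w)) -
      ((j : ℂ) • b (j - 1) (a i w) + (i : ℂ) • b j (a (i - 1) w)) := by
    funext i j
    rw [cb, ca, map_sub, map_smul]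
    abel
  rw [h1, h2]
  have e1 := half_sub (hb.trunc2 (a := a) (D w)) (hb.trunc2 (a := a) w).deriv l 0 n
  have e2 := half_sub (ha.trunc2' (b := b) (D w)) (ha.trunc2' (b := b) w).deriv l n 0
  unfold bor
  refine Eq.trans (congrArg₂ (fun x y => x - (s * (-1) ^ l) • y) e1 e2) ?_
  have d1 := half_cov (hb.trunc2 (a := a) w) l 0 n
  have d2 := half_cov (ha.trunc2' (b := b) w) l n 0
  rw [d1, d2]
  simp only [Int.cast_zero, zero_smul, zero_add, add_zero]
  module

/-! ### Construction of a vertex superalgebra from generating fields -/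

/-- A vacuum vector, a translation operator and a family of mutually local, translation covariant
fields whose modes generate `V` from the vacuum. -/
structure GeneratingFields (V : Type*) [AddCommGroup V] [Module ℂ V] (ι : Type*) where
  part : ZMod 2 → Submodule ℂ V
  isCompl_part : IsCompl (part 0) (part 1)
  vac : V
  D : Module.End ℂ V
  par : ι → ZMod 2
  X : ι → ℤ → Module.End ℂ V
  vac_mem : vac ∈ part 0
  X_mem : ∀ (i : ι) (q : ZMod 2) (v : V) (n : ℤ), v ∈ part q → X i n v ∈ part (par i + q)
  fld : ∀ i, IsFld (X i)
  loc : ∀ i j, Loc (sgn (par i) (par j)) (X i) (X j)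
  cov : ∀ i, Cov D (X i)
  D_vac : D vac = 0
  X_vac : ∀ (i : ι) (n : ℤ), 0 ≤ n → X i n vac = 0
  gen : ∀ S : Submodule ℂ V, vac ∈ S → (∀ i n v, v ∈ S → X i n v ∈ S) → S = ⊤

theorem IsFld.add {a b : ℤ → Module.End ℂ V} (ha : IsFld a) (hb : IsFld b) : IsFld (a + b) := by
  intro w
  obtain ⟨N, hN⟩ := ha w
  obtain ⟨M, hM⟩ := hb w
  exact ⟨max N M, fun n hn => by
    simp only [Pi.add_apply, LinearMap.add_apply, hN n (le_trans (le_max_left _ _) hn),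
      hM n (le_trans (le_max_right _ _) hn), add_zero]⟩

theorem Loc.add {s : ℂ} {a b c : ℤ → Module.End ℂ V} (ha : Loc s a c) (hb : Loc s b c) :
    Loc s (a + b) c := by
  obtain ⟨N, hN⟩ := ha
  obtain ⟨M, hM⟩ := hb
  refine ⟨max N M, fun w => ?_⟩
  have e : (fun m n => (a + b) m (c n w) - s • c n ((a + b) m w)) =
      (fun m n => a m (c n w) - s • c n (a m w)) + fun m n => b m (c n w) - s • c n (b m w) := by
    funext m n
    simp only [Pi.add_apply, LinearMap.add_apply, map_add]
    module
  rw [e, map_add, dif_pow_zero_of_le (le_max_left _ _) (hN w),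
    dif_pow_zero_of_le (le_max_right _ _) (hM w), add_zero]

theorem Loc.smul {s : ℂ} {a c : ℤ → Module.End ℂ V} (z : ℂ) (ha : Loc s a c) :
    Loc s (z • a) c := by
  obtain ⟨N, hN⟩ := ha
  refine ⟨N, fun w => ?_⟩
  have e : (fun m n => (z • a) m (c n w) - s • c n ((z • a) m w)) =
      z • fun m n => a m (c n w) - s • c n (a m w) := by
    funext m n
    simp only [Pi.smul_apply, LinearMap.smul_apply, map_smul]
    module
  rw [e, map_smul, hN, smul_zero]

theorem Loc.zero (s : ℂ) (c : ℤ → Module.End ℂ V) : Loc s 0 c :=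
  ⟨0, fun w => by funext m n; simp⟩

theorem eq_zero_of_dif_pow {N : ℕ} {F : ℤ → ℤ → V} (hF : Trunc2 F) (h : (dif ^ N) F = 0) :
    F = 0 := by
  induction N generalizing F with
  | zero => exact h
  | succ N ih =>
    rw [pow_succ, Module.End.mul_apply] at h
    obtain ⟨M, hM⟩ := hF
    have hd : dif F = 0 := ih ⟨M, fun n hn m => by
      rw [dif_apply, hM n hn, hM (n + 1) (by omega), sub_zero]⟩ h
    have step : ∀ m n, F m n = F (m - 1) (n + 1) := by
      intro m n
      have := congrFun (congrFun hd (m - 1)) n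
      rw [dif_apply, sub_add_cancel] at this
      exact sub_eq_zero.1 this
    have many : ∀ r : ℕ, ∀ m n, F m n = F (m - r) (n + r) := by
      intro r
      induction r with
      | zero => simp
      | succ r ihr =>
        intro m n
        rw [ihr m n, step]
        congr 1 <;> push_cast <;> ring
    funext m n
    rw [many (M - n).toNat m n, hM _ (by omega)]
    rfl

namespace GeneratingFields

variable {ι : Type*} (G : GeneratingFields V ι)

/-- Fields of parity `p` that behave like the vertex operators to be constructed. -/
def good (p : ZMod 2) : Submodule ℂ (ℤ → Module.End ℂ V) where
  carrier := {a | IsFld a ∧ (∀ q v n, v ∈ G.part q → a n v ∈ G.part (p + q)) ∧ Cov G.D a ∧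
    (∀ i, Loc (sgn p (G.par i)) a (G.X i)) ∧ ∀ n : ℤ, 0 ≤ n → a n G.vac = 0}
  add_mem' := by
    rintro a b ⟨a1, a2, a3, a4, a5⟩ ⟨b1, b2, b3, b4, b5⟩
    refine ⟨a1.add b1, fun q v n hv => add_mem (a2 q v n hv) (b2 q v n hv), fun n w => ?_,
      fun i => (a4 i).add (b4 i), fun n hn => ?_⟩
    · simp only [Pi.add_apply, LinearMap.add_apply, map_add, a3 n w, b3 n w]
      module
    · simp only [Pi.add_apply, LinearMap.add_apply, a5 n hn, b5 n hn, add_zero]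
  zero_mem' := ⟨fun w => ⟨0, fun n _ => rfl⟩, fun q v n _ => zero_mem _, fun n w => by simp,
    fun i => Loc.zero _ _, fun n _ => rfl⟩
  smul_mem' := by
    rintro z a ⟨a1, a2, a3, a4, a5⟩
    refine ⟨fun w => ?_, fun q v n hv => Submodule.smul_mem _ _ (a2 q v n hv), fun n w => ?_,
      fun i => (a4 i).smul z, fun n hn => ?_⟩
    · obtain ⟨N, hN⟩ := a1 w
      exact ⟨N, fun n hn => by simp only [Pi.smul_apply, LinearMap.smul_apply, hN n hn, smul_zero]⟩
    · simp only [Pi.smul_apply, LinearMap.smul_apply, map_smul, a3 n w]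
      module
    · simp only [Pi.smul_apply, LinearMap.smul_apply, a5 n hn, smul_zero]

theorem X_good (i : ι) : G.X i ∈ G.good (G.par i) :=
  ⟨G.fld i, fun q v n hv => G.X_mem i q v n hv, G.cov i, fun j => G.loc i j, G.X_vac i⟩

theorem good_fld {p : ZMod 2} {a : ℤ → Module.End ℂ V} (h : a ∈ G.good p) : IsFld a := h.1

theorem nprod_good {p q : ZMod 2} {a b : ℤ → Module.End ℂ V} (ha : a ∈ G.good p)
    (hb : b ∈ G.good q) (hab : Loc (sgn p q) a b) (l : ℤ) :
    nprod (sgn p q) ha.1 hb.1 l ∈ G.good (p + q) := by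
  refine ⟨IsFld.nprod _ _ _ _, fun r v n hv => ?_, Cov.nprod _ _ ha.2.2.1 hb.2.2.1 l,
    fun i => ?_, fun n hn => ?_⟩
  · rw [nprod_apply]
    unfold borAB bor half
    have h1 : ∀ m n, a m (b n v) ∈ G.part (p + q + r) := fun m n => by
      rw [add_assoc]
      exact ha.2.1 _ _ _ (hb.2.1 _ _ _ hv)
    have h2 : ∀ m n, b n (a m v) ∈ G.part (p + q + r) := fun m n => by
      rw [add_comm p q, add_assoc]
      exact hb.2.1 _ _ _ (ha.2.1 _ _ _ hv)
    refine sub_mem ?_ (Submodule.smul_mem _ _ ?_)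
    · exact finsum_induction (· ∈ G.part (p + q + r)) (zero_mem _) (fun _ _ => add_mem)
        fun i => zsmul_mem (h1 _ _) _
    · exact finsum_induction (· ∈ G.part (p + q + r)) (zero_mem _) (fun _ _ => add_mem)
        fun i => zsmul_mem (h2 _ _) _
  · rw [sgn_add_left]
    exact Loc.nprod _ _ hab (ha.2.2.2.1 i) (hb.2.2.2.1 i) l
  · rw [nprod_apply, borAB, bor, half_eq_zero, half_eq_zero, smul_zero, sub_zero]
    · intro i
      simp only [swp, zero_add]
      rw [ha.2.2.2.2 _ (by omega), map_zero]
    · intro i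
      rw [hb.2.2.2.2 _ (by omega), map_zero]

theorem nprod_vac {p q : ZMod 2} {a b : ℤ → Module.End ℂ V} (ha : a ∈ G.good p)
    (hb : b ∈ G.good q) (l : ℤ) :
    nprod (sgn p q) ha.1 hb.1 l (-1) G.vac = a l (b (-1) G.vac) := by
  rw [nprod_apply, borAB, bor, half_eq_zero (m := -1), smul_zero, sub_zero]
  · unfold half
    rw [finsum_eq_single _ 0]
    · simp
    · intro i hi
      have h0 : b (-1 + i) G.vac = 0 := hb.2.2.2.2 _ (by omega)
      simp only [h0, map_zero, smul_zero]
  · intro i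
    simp only [swp, zero_add]
    rw [ha.2.2.2.2 _ (by omega), map_zero]

theorem good_injective {p : ZMod 2} {a : ℤ → Module.End ℂ V} (ha : a ∈ G.good p)
    (h : a (-1) G.vac = 0) : a = 0 := by
  have h1 : ∀ n : ℕ, a (-n - 1) G.vac = 0 := by
    intro n
    induction n with
    | zero => simpa using h
    | succ n ih =>
      have := ha.2.2.1 (-n - 1) G.vac
      rw [ih, G.D_vac, map_zero, map_zero, zero_sub, zero_eq_neg] at this
      rcases smul_eq_zero.1 this with h0 | h0
      · exfalso
        have : (-(n : ℤ) - 1 : ℤ) = 0 := by exact_mod_cast h0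
        omega
      · rw [← h0]
        congr 2
        push_cast
        ring
  have h2 : ∀ n : ℤ, a n G.vac = 0 := by
    intro n
    by_cases hn : 0 ≤ n
    · exact ha.2.2.2.2 n hn
    · have := h1 (-n - 1).toNat
      rwa [show -((-n - 1).toNat : ℤ) - 1 = n by omega] at this
  let S : Submodule ℂ V :=
    { carrier := {v | ∀ n, a n v = 0}
      add_mem' := fun {v w} hv hw n => by rw [map_add, hv n, hw n, add_zero]
      zero_mem' := fun n => map_zero _
      smul_mem' := fun c v hv n => by rw [map_smul, hv n, smul_zero] }
  have hS : S = ⊤ := by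
    refine G.gen S h2 fun i n v hv => ?_
    obtain ⟨N, hN⟩ := ha.2.2.2.1 i
    have hz : (fun m n => a m (G.X i n v) - sgn p (G.par i) • G.X i n (a m v)) =
        fun m n => a m (G.X i n v) := by
      funext m n
      rw [hv m, map_zero, smul_zero, sub_zero]
    have := hN v
    rw [hz] at this
    intro m
    exact congrFun (congrFun (eq_zero_of_dif_pow ((G.fld i).trunc2 v) this) m) n
  funext n
  refine LinearMap.ext fun v => ?_
  have : v ∈ S := hS ▸ Submodule.mem_top
  exact this n

/-- The identity field. -/
def one : ℤ → Module.End ℂ V := fun n => if n = -1 then LinearMap.id else 0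

theorem one_loc (a : ℤ → Module.End ℂ V) : Loc 1 one a := by
  refine ⟨0, fun w => ?_⟩
  funext m n
  by_cases h : m = -1 <;> simp [one, h]

theorem one_good : one ∈ G.good 0 := by
  refine ⟨fun w => ⟨0, fun n hn => ?_⟩, fun q v n hv => ?_, fun n w => ?_, fun i => ?_,
    fun n hn => ?_⟩
  · rw [one, if_neg (by omega), LinearMap.zero_apply]
  · rw [zero_add]
    unfold one
    split_ifs
    · exact hv
    · exact zero_mem _
  · by_cases h : n = -1
    · simp [one, h]
    · by_cases h0 : n = 0
      · simp [one, h0]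
      · have : n - 1 ≠ -1 := by omega
        simp [one, h, this]
  · rw [sgn_zero_left]
    exact one_loc _
  · rw [one, if_neg (by omega), LinearMap.zero_apply]

/-- Good fields that are local with respect to all good fields. -/
def vgood (p : ZMod 2) : Submodule ℂ (ℤ → Module.End ℂ V) where
  carrier := {a | a ∈ G.good p ∧ ∀ q, ∀ b ∈ G.good q, Loc (sgn p q) a b}
  add_mem' := fun ha hb => ⟨add_mem ha.1 hb.1, fun q c hc => (ha.2 q c hc).add (hb.2 q c hc)⟩
  zero_mem' := ⟨zero_mem _, fun _ _ _ => Loc.zero _ _⟩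
  smul_mem' := fun z _ ha => ⟨Submodule.smul_mem _ _ ha.1, fun q c hc => (ha.2 q c hc).smul z⟩

theorem X_vgood (i : ι) : G.X i ∈ G.vgood (G.par i) := by
  refine ⟨G.X_good i, fun q b hb => ?_⟩
  rw [sgn_comm]
  exact (hb.2.2.2.1 i).symm (sgn_mul_self _ _) hb.1 (G.fld i)

theorem nprod_vgood {p q : ZMod 2} {a b : ℤ → Module.End ℂ V} (ha : a ∈ G.vgood p)
    (hb : b ∈ G.vgood q) (l : ℤ) : nprod (sgn p q) ha.1.1 hb.1.1 l ∈ G.vgood (p + q) := by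
  refine ⟨G.nprod_good ha.1 hb.1 (ha.2 q b hb.1) l, fun r c hc => ?_⟩
  rw [sgn_add_left]
  exact Loc.nprod _ _ (ha.2 q b hb.1) (ha.2 r c hc) (hb.2 r c hc) l

/-- Evaluation at the vacuum. -/
def ev : (ℤ → Module.End ℂ V) →ₗ[ℂ] V where
  toFun a := a (-1) G.vac
  map_add' _ _ := rfl
  map_smul' _ _ := rfl

theorem ev_vgood_top : ((G.vgood 0).map G.ev) ⊔ ((G.vgood 1).map G.ev) = ⊤ := by
  have hle : ∀ p, (G.vgood p).map G.ev ≤ ((G.vgood 0).map G.ev) ⊔ ((G.vgood 1).map G.ev) := by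
    intro p
    have h := zmod2_cases p
    rcases h with rfl | rfl
    · exact le_sup_left
    · exact le_sup_right
  refine G.gen _ ?_ fun i n v hv => ?_
  · refine hle 0 ⟨one, ⟨G.one_good, fun q b hb => ?_⟩, ?_⟩
    · rw [sgn_zero_left]
      exact one_loc _
    · simp [ev, one]
  · have aux : ∀ p, ∀ a ∈ G.vgood p,
        G.X i n (G.ev a) ∈ ((G.vgood 0).map G.ev) ⊔ ((G.vgood 1).map G.ev) := by
      intro p a ha
      refine hle (G.par i + p) ⟨_, G.nprod_vgood (G.X_vgood i) ha n, ?_⟩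
      exact G.nprod_vac (G.X_vgood i).1 ha.1 n
    obtain ⟨x, ⟨a, ha, rfl⟩, y, ⟨b, hb, rfl⟩, rfl⟩ := Submodule.mem_sup.1 hv
    rw [map_add]
    exact add_mem (aux 0 a ha) (aux 1 b hb)

theorem ev_mem {p : ZMod 2} {a : ℤ → Module.End ℂ V} (ha : a ∈ G.good p) : G.ev a ∈ G.part p := by
  have := ha.2.1 0 G.vac (-1) G.vac_mem
  rwa [add_zero] at this

theorem sum_eq_zero {x y : V} (hx : x ∈ G.part 0) (hy : y ∈ G.part 1) (h : x + y = 0) :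
    x = 0 ∧ y = 0 := by
  have h1 : x = -y := eq_neg_of_add_eq_zero_left h
  have h2 : x = 0 := by
    have := G.isCompl_part.disjoint
    exact Submodule.disjoint_def.1 this x hx (h1 ▸ neg_mem hy)
  exact ⟨h2, by simpa [h2] using h⟩

theorem exists_vgood {p : ZMod 2} {v : V} (hv : v ∈ G.part p) : ∃ a ∈ G.vgood p, G.ev a = v := by
  have hv' : v ∈ ((G.vgood 0).map G.ev) ⊔ ((G.vgood 1).map G.ev) := by
    rw [G.ev_vgood_top]
    exact Submodule.mem_top
  obtain ⟨x, ⟨a, ha, rfl⟩, y, ⟨b, hb, rfl⟩, rfl⟩ := Submodule.mem_sup.1 hv'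
  have ha' := G.ev_mem ha.1
  have hb' := G.ev_mem hb.1
  have h := zmod2_cases p
  rcases h with rfl | rfl
  · refine ⟨a, ha, ?_⟩
    have h1 : G.ev b ∈ G.part 0 := by simpa using sub_mem hv ha'
    have := Submodule.disjoint_def.1 G.isCompl_part.disjoint _ h1 hb'
    rw [this, add_zero]
  · refine ⟨b, hb, ?_⟩
    have h1 : G.ev a ∈ G.part 1 := by simpa using sub_mem hv hb'
    have := Submodule.disjoint_def.1 G.isCompl_part.disjoint _ ha' h1
    rw [this, zero_add]

theorem good_eq_vgood {p : ZMod 2} {a : ℤ → Module.End ℂ V} (ha : a ∈ G.good p) :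
    a ∈ G.vgood p := by
  obtain ⟨b, hb, hab⟩ := G.exists_vgood (G.ev_mem ha)
  have : a - b = 0 := G.good_injective (sub_mem ha hb.1) (by
    have : G.ev (a - b) = 0 := by rw [map_sub, hab, sub_self]
    exact this)
  rw [sub_eq_zero.1 this]
  exact hb

/-- All vertex operators. -/
def fields : Submodule ℂ (ℤ → Module.End ℂ V) := G.good 0 ⊔ G.good 1

theorem ev_bijective : Function.Bijective (G.ev.domRestrict G.fields) := by
  constructor
  · rw [← LinearMap.ker_eq_bot, LinearMap.ker_eq_bot']
    rintro ⟨c, hc⟩ h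
    obtain ⟨a, ha, b, hb, rfl⟩ := Submodule.mem_sup.1 hc
    have h' : G.ev a + G.ev b = 0 := by simpa using h
    obtain ⟨h1, h2⟩ := G.sum_eq_zero (G.ev_mem ha) (G.ev_mem hb) h'
    have e1 := G.good_injective ha h1
    have e2 := G.good_injective hb h2
    subst e1 e2
    exact Subtype.ext (add_zero 0)
  · intro v
    have hv : v ∈ G.part 0 ⊔ G.part 1 := by
      rw [G.isCompl_part.sup_eq_top]
      exact Submodule.mem_top
    obtain ⟨x, hx, y, hy, rfl⟩ := Submodule.mem_sup.1 hv
    obtain ⟨a, ha, rfl⟩ := G.exists_vgood hx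
    obtain ⟨b, hb, rfl⟩ := G.exists_vgood hy
    exact ⟨⟨a + b, add_mem (Submodule.mem_sup_left ha.1) (Submodule.mem_sup_right hb.1)⟩,
      map_add G.ev a b⟩

/-- The state-field correspondence: `Y v` is the unique vertex operator with `v_{-1} 1 = v`. -/
def Y : V →ₗ[ℂ] ℤ → Module.End ℂ V :=
  G.fields.subtype ∘ₗ (LinearEquiv.ofBijective _ G.ev_bijective).symm.toLinearMap

theorem ev_Y (v : V) : G.ev (G.Y v) = v :=
  (LinearEquiv.ofBijective _ G.ev_bijective).apply_symm_apply v

theorem Y_eq {p : ZMod 2} {a : ℤ → Module.End ℂ V} (ha : a ∈ G.good p) : G.Y (G.ev a) = a := by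
  have ha' : a ∈ G.fields := by
    have h := zmod2_cases p
    rcases h with rfl | rfl
    · exact Submodule.mem_sup_left ha
    · exact Submodule.mem_sup_right ha
  exact congrArg Subtype.val
    ((LinearEquiv.ofBijective _ G.ev_bijective).symm_apply_apply ⟨a, ha'⟩)

theorem Y_good {p : ZMod 2} {v : V} (hv : v ∈ G.part p) : G.Y v ∈ G.vgood p := by
  obtain ⟨a, ha, rfl⟩ := G.exists_vgood hv
  rw [G.Y_eq ha.1]
  exact ha

theorem Y_nprod {p q : ZMod 2} {u v : V} (hu : u ∈ G.part p) (hv : v ∈ G.part q) (l : ℤ) :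
    G.Y (G.Y u l v) = nprod (sgn p q) (G.Y_good hu).1.1 (G.Y_good hv).1.1 l := by
  have h := G.nprod_good (G.Y_good hu).1 (G.Y_good hv).1 ((G.Y_good hu).2 q _ (G.Y_good hv).1) l
  rw [← G.Y_eq h]
  congr 1
  have e := G.nprod_vac (G.Y_good hu).1 (G.Y_good hv).1 l
  have e' : G.Y v (-1) G.vac = v := G.ev_Y v
  rw [e'] at e
  exact e.symm

theorem induction_part {P : V → Prop} (h : ∀ p, ∀ v ∈ G.part p, P v)
    (hadd : ∀ v w, P v → P w → P (v + w)) (v : V) : P v := by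
  have hv : v ∈ G.part 0 ⊔ G.part 1 := by
    rw [G.isCompl_part.sup_eq_top]
    exact Submodule.mem_top
  obtain ⟨x, hx, y, hy, rfl⟩ := Submodule.mem_sup.1 hv
  exact hadd _ _ (h 0 x hx) (h 1 y hy)

theorem Y_cov (v : V) : Cov G.D (G.Y v) := by
  refine G.induction_part (fun p v hv => (G.Y_good hv).1.2.2.1) (fun v w hv hw n x => ?_) v
  simp only [map_add, Pi.add_apply, LinearMap.add_apply, hv n x, hw n x]
  module

theorem Y_vac_nonneg (v : V) (n : ℤ) (hn : 0 ≤ n) : G.Y v n G.vac = 0 := by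
  refine G.induction_part (P := fun v => G.Y v n G.vac = 0)
    (fun p v hv => (G.Y_good hv).1.2.2.2.2 n hn) (fun v w hv hw => ?_) v
  simp only [map_add, Pi.add_apply, LinearMap.add_apply, hv, hw, add_zero]

theorem D_eq (v : V) : G.D v = G.Y v (-2) G.vac := by
  have h := G.Y_cov v (-1) G.vac
  have e' : G.Y v (-1) G.vac = v := G.ev_Y v
  rw [e', G.D_vac, map_zero] at h
  rw [h]
  norm_num

theorem vac_Y : G.Y G.vac = one := by
  have h := G.Y_eq G.one_good
  have e : G.ev one = G.vac := by simp [ev, one]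
  rwa [e] at h

theorem Y_deriv (v : V) (n : ℤ) : G.Y (G.D v) n = (-n : ℂ) • G.Y v (n - 1) := by
  refine G.induction_part (P := fun v => G.Y (G.D v) n = (-n : ℂ) • G.Y v (n - 1))
    (fun p v hv => ?_) (fun v w hv hw => ?_) v
  · have hb := (G.Y_good hv).1
    have hloc := (G.Y_good hv).2 0 _ G.one_good
    have h1 : nprod (sgn p 0) hb.1 G.one_good.1 (-2) ∈ G.good (p + 0) :=
      G.nprod_good hb G.one_good hloc (-2)
    have h2 : G.ev (nprod (sgn p 0) hb.1 G.one_good.1 (-2)) = G.D v := by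
      have := G.nprod_vac hb G.one_good (-2)
      rw [G.D_eq]
      refine this.trans ?_
      simp [one]
    rw [← h2, G.Y_eq h1]
    refine LinearMap.ext fun w => ?_
    have hs : sgn p 0 = 1 := by rw [sgn_comm, sgn_zero_left]
    have z1 : ∀ k : ℤ, k ≠ -1 → ∀ x : V, one k x = 0 := fun k hk x => by
      rw [one, if_neg hk, LinearMap.zero_apply]
    have z2 : ∀ k : ℤ, k = -1 → ∀ x : V, one k x = x := fun k hk x => by
      rw [one, if_pos hk, LinearMap.id_apply]
    rw [nprod_apply, borAB, bor, hs]
    have e0 : (1 * (-1 : ℂ) ^ (-2 : ℤ)) = 1 := by norm_num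
    rw [e0, one_smul, LinearMap.smul_apply]
    unfold half
    simp only [choose_neg_two, swp, zero_add]
    rcases lt_trichotomy n 0 with hn | rfl | hn
    · rw [finsum_eq_single _ (-1 - n).toNat, finsum_eq_zero_of_forall_eq_zero, sub_zero]
      · rw [z2 _ (by omega), ← Int.cast_smul_eq_zsmul ℂ,
          show (-2 - ((-1 - n).toNat : ℤ)) = n - 1 by omega,
          show (((-1 - n).toNat : ℤ) + 1) = -n by omega, Int.cast_neg]
      · intro i
        rw [z1 _ (by omega), smul_zero]
      · intro i hi
        rw [z1 _ (by omega), map_zero, smul_zero]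
    · rw [finsum_eq_zero_of_forall_eq_zero, finsum_eq_zero_of_forall_eq_zero]
      · simp
      · intro i
        rw [z1 _ (by omega), smul_zero]
      · intro i
        rw [z1 _ (by omega), map_zero, smul_zero]
    · rw [finsum_eq_zero_of_forall_eq_zero, finsum_eq_single _ (n - 1).toNat]
      · rw [z2 _ (by omega), ← Int.cast_smul_eq_zsmul ℂ,
          show ((n - 1).toNat : ℤ) = n - 1 by omega, sub_add_cancel, zero_sub, neg_smul]
      · intro i hi
        rw [z1 _ (by omega), smul_zero]
      · intro i
        rw [z1 _ (by omega), map_zero, smul_zero]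
  · simp only [map_add, Pi.add_apply, hv, hw, smul_add]

/-- The vertex superalgebra generated by mutually local fields. -/
def vertexSuperalgebra : VertexSuperalgebra V where
  part := G.part
  Y := G.Y
  vac := G.vac
  D := G.D
  isCompl_part := G.isCompl_part
  vac_mem := G.vac_mem
  Y_mem p q u v n hu hv := (G.Y_good hu).1.2.1 q v n hv
  truncation u v := by
    refine G.induction_part (P := fun u => ∃ N : ℤ, ∀ n, N ≤ n → G.Y u n v = 0)
      (fun p u hu => (G.Y_good hu).1.1 v) (fun a b ha hb => ?_) u
    obtain ⟨N, hN⟩ := ha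
    obtain ⟨M, hM⟩ := hb
    exact ⟨max N M, fun n hn => by
      simp only [map_add, Pi.add_apply, LinearMap.add_apply, hN n (le_trans (le_max_left _ _) hn),
        hM n (le_trans (le_max_right _ _) hn), add_zero]⟩
  Y_vac n := by rw [G.vac_Y, one]
  creation v := G.ev_Y v
  creation_nonneg v n hn := G.Y_vac_nonneg v n hn
  D_comm v w n := by
    rw [G.Y_cov v n w, G.Y_deriv, LinearMap.smul_apply]
    module
  D_deriv := G.Y_deriv
  jacobi p q u v w hu hv l m n := by
    have ha := (G.Y_good hu).1.1
    have hb := (G.Y_good hv).1.1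
    have h := borcherds ha hb ((G.Y_good hu).2 q _ (G.Y_good hv).1) l m n w
    simp only [G.Y_nprod hu hv]
    rw [h, borAB, bor]
    unfold half
    have e1 := ((hb.trunc2 (a := G.Y u) w).ev (fun i => m + l - i) n).smulZ
      fun i => (-1) ^ i * Ring.choose l i
    have e2 := ((ha.trunc2' (b := G.Y v) w).ev (fun i => n + l - i) m).smulZ
      fun i => (-1) ^ i * Ring.choose l i
    rw [smul_finsum, ← finsum_sub_distrib e1.finite]
    · refine finsum_congr fun i => ?_
      rw [smul_sub, smul_comm (sgn p q * (-1) ^ l)]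
      rfl
    · obtain ⟨N, hN⟩ := e2
      exact EvZero.finite ⟨N, fun i hi => (congrArg _ (hN i hi)).trans (smul_zero _)⟩

theorem Y_gen (i : ι) (v : V) (h : G.X i (-1) G.vac = v) : G.vertexSuperalgebra.Y v = G.X i := by
  subst h
  exact G.Y_eq (G.X_good i)

end GeneratingFields

end Fields2

/-! ### Lie superalgebras -/

/-- A complex Lie superalgebra structure on `g`. -/
structure LieSuperalgebra (g : Type*) [AddCommGroup g] [Module ℂ g] where
  /-- The even part `part 0` and the odd part `part 1`. -/
  part : ZMod 2 → Submodule ℂ g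
  bracket : g →ₗ[ℂ] g →ₗ[ℂ] g
  isCompl_part : IsCompl (part 0) (part 1)
  bracket_mem : ∀ (p q : ZMod 2) (x y : g), x ∈ part p → y ∈ part q → bracket x y ∈ part (p + q)
  skew : ∀ (p q : ZMod 2) (x y : g), x ∈ part p → y ∈ part q →
    bracket x y = -(sgn p q • bracket y x)
  jacobi : ∀ (p q r : ZMod 2) (x y z : g), x ∈ part p → y ∈ part q → z ∈ part r →
    bracket x (bracket y z) = bracket (bracket x y) z + sgn p q • bracket y (bracket x z)

/-- An even supersymmetric invariant bilinear form on a Lie superalgebra. -/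
structure LieSuperalgebra.InvariantForm {g : Type*} [AddCommGroup g] [Module ℂ g]
    (S : LieSuperalgebra g) where
  form : g →ₗ[ℂ] g →ₗ[ℂ] ℂ
  even : ∀ (p q : ZMod 2) (x y : g), x ∈ S.part p → y ∈ S.part q → p ≠ q → form x y = 0
  supersymm : ∀ (p q : ZMod 2) (x y : g), x ∈ S.part p → y ∈ S.part q →
    form x y = sgn p q * form y x
  invariant : ∀ (p q r : ZMod 2) (x y z : g), x ∈ S.part p → y ∈ S.part q → z ∈ S.part r →
    form (S.bracket x y) z = form x (S.bracket y z)

/-! ### Affine Lie superalgebras and their vacuum modules -/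

/-- The spanning set of the affine Lie superalgebra: the elements `x ⊗ t^n` and the central
element `K`. -/
inductive AffGen (g : Type*)
  | mode (x : g) (n : ℤ)
  | central

section Affine

variable {g : Type} [AddCommGroup g] [Module ℂ g] {S : LieSuperalgebra g}

/-- The defining relations of the universal enveloping algebra of the affine Lie superalgebra
`g ⊗ ℂ[t, t⁻¹] ⊕ ℂ K`: linearity in `x` of `x(n) = x ⊗ t^n`, centrality of `K`, and, for homogeneous
`x` and `y`, `x(m) y(n) - (-1)^{|x||y|} y(n) x(m) = [x, y](m + n) + (x|y) m δ_{m+n,0} K`. -/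
inductive AffRel (κ : S.InvariantForm) :
    FreeAlgebra ℂ (AffGen g) → FreeAlgebra ℂ (AffGen g) → Prop
  | add (x y : g) (n : ℤ) : AffRel κ (FreeAlgebra.ι ℂ (.mode (x + y) n))
      (FreeAlgebra.ι ℂ (.mode x n) + FreeAlgebra.ι ℂ (.mode y n))
  | smul (c : ℂ) (x : g) (n : ℤ) : AffRel κ (FreeAlgebra.ι ℂ (.mode (c • x) n))
      (c • FreeAlgebra.ι ℂ (.mode x n))
  | central (x : g) (n : ℤ) : AffRel κ (FreeAlgebra.ι ℂ .central * FreeAlgebra.ι ℂ (.mode x n))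
      (FreeAlgebra.ι ℂ (.mode x n) * FreeAlgebra.ι ℂ .central)
  | bracket (p q : ZMod 2) (x y : g) (hx : x ∈ S.part p) (hy : y ∈ S.part q) (m n : ℤ) :
      AffRel κ (FreeAlgebra.ι ℂ (.mode x m) * FreeAlgebra.ι ℂ (.mode y n))
        (sgn p q • (FreeAlgebra.ι ℂ (.mode y n) * FreeAlgebra.ι ℂ (.mode x m)) +
          FreeAlgebra.ι ℂ (.mode (S.bracket x y) (m + n)) +
          (if m + n = 0 then (m : ℂ) * κ.form x y else 0) • FreeAlgebra.ι ℂ .central)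

/-- The universal enveloping algebra of the affine Lie superalgebra. -/
def AffU (κ : S.InvariantForm) : Type := RingQuot (AffRel κ)

instance (κ : S.InvariantForm) : Ring (AffU κ) := inferInstanceAs (Ring (RingQuot (AffRel κ)))

instance (κ : S.InvariantForm) : Algebra ℂ (AffU κ) :=
  inferInstanceAs (Algebra ℂ (RingQuot (AffRel κ)))

/-- The quotient map onto the enveloping algebra. -/
def mkU (κ : S.InvariantForm) : FreeAlgebra ℂ (AffGen g) →ₐ[ℂ] AffU κ :=
  RingQuot.mkAlgHom ℂ (AffRel κ)

theorem mkU_rel (κ : S.InvariantForm) {a b : FreeAlgebra ℂ (AffGen g)} (h : AffRel κ a b) :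
    mkU κ a = mkU κ b := RingQuot.mkAlgHom_rel ℂ h

/-- The element `x(n) = x ⊗ t^n`. -/
def md (κ : S.InvariantForm) (x : g) (n : ℤ) : AffU κ :=
  mkU κ (FreeAlgebra.ι ℂ (.mode x n))

/-- The central element `K`. -/
def cK (κ : S.InvariantForm) : AffU κ :=
  mkU κ (FreeAlgebra.ι ℂ .central)

variable (κ : S.InvariantForm)

theorem md_add (x y : g) (n : ℤ) : md κ (x + y) n = md κ x n + md κ y n := by
  unfold md
  rw [mkU_rel κ (AffRel.add x y n), map_add]

theorem md_smul (c : ℂ) (x : g) (n : ℤ) : md κ (c • x) n = c • md κ x n := by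
  unfold md
  rw [mkU_rel κ (AffRel.smul c x n), map_smul]

theorem cK_comm (x : g) (n : ℤ) : cK κ * md κ x n = md κ x n * cK κ := by
  unfold md cK
  rw [← map_mul, mkU_rel κ (AffRel.central x n), map_mul]

theorem md_mul (p q : ZMod 2) (x y : g) (hx : x ∈ S.part p) (hy : y ∈ S.part q) (m n : ℤ) :
    md κ x m * md κ y n = sgn p q • (md κ y n * md κ x m) + md κ (S.bracket x y) (m + n) +
      (if m + n = 0 then (m : ℂ) * κ.form x y else 0) • cK κ := by
  unfold md cK
  rw [← map_mul, mkU_rel κ (AffRel.bracket p q x y hx hy m n), map_add, map_add,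
    map_smul, map_smul, map_mul]

/-- The universal property of `AffU`. -/
def affLift {A : Type*} [Ring A] [Algebra ℂ A] (φ : g → ℤ → A) (c : A)
    (h1 : ∀ x y n, φ (x + y) n = φ x n + φ y n) (h2 : ∀ (z : ℂ) x n, φ (z • x) n = z • φ x n)
    (h3 : ∀ x n, c * φ x n = φ x n * c)
    (h4 : ∀ p q x y, x ∈ S.part p → y ∈ S.part q → ∀ m n : ℤ, φ x m * φ y n =
      sgn p q • (φ y n * φ x m) + φ (S.bracket x y) (m + n) +
        (if m + n = 0 then (m : ℂ) * κ.form x y else 0) • c) : AffU κ →ₐ[ℂ] A :=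
  RingQuot.liftAlgHom ℂ
    ⟨FreeAlgebra.lift ℂ fun a => match a with
      | .mode x n => φ x n
      | .central => c, by
      intro a b hab
      cases hab with
      | add x y n => simpa using h1 x y n
      | smul z x n => simpa using h2 z x n
      | central x n => simpa using h3 x n
      | bracket p q x y hx hy m n =>
        simp only [map_mul, map_add, map_smul, FreeAlgebra.lift_ι_apply]
        exact h4 p q x y hx hy m n⟩

section lift

variable {A : Type*} [Ring A] [Algebra ℂ A] (φ : g → ℤ → A) (c : A)
    (h1 : ∀ x y n, φ (x + y) n = φ x n + φ y n) (h2 : ∀ (z : ℂ) x n, φ (z • x) n = z • φ x n)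
    (h3 : ∀ x n, c * φ x n = φ x n * c)
    (h4 : ∀ p q x y, x ∈ S.part p → y ∈ S.part q → ∀ m n : ℤ, φ x m * φ y n =
      sgn p q • (φ y n * φ x m) + φ (S.bracket x y) (m + n) +
        (if m + n = 0 then (m : ℂ) * κ.form x y else 0) • c)

theorem affLift_md (x : g) (n : ℤ) : affLift κ φ c h1 h2 h3 h4 (md κ x n) = φ x n := by
  refine (RingQuot.liftAlgHom_mkAlgHom_apply ℂ _ _ _).trans ?_
  rw [FreeAlgebra.lift_ι_apply]

theorem affLift_cK : affLift κ φ c h1 h2 h3 h4 (cK κ) = c := by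
  refine (RingQuot.liftAlgHom_mkAlgHom_apply ℂ _ _ _).trans ?_
  rw [FreeAlgebra.lift_ι_apply]

end lift

theorem affU_induction {P : AffU κ → Prop} (h0 : ∀ c : ℂ, P (algebraMap ℂ _ c))
    (h1 : ∀ x n, P (md κ x n)) (h2 : P (cK κ)) (ha : ∀ a b, P a → P b → P (a + b))
    (hm : ∀ a b, P a → P b → P (a * b)) (u : AffU κ) : P u := by
  obtain ⟨a, rfl⟩ : ∃ a, mkU κ a = u := RingQuot.mkAlgHom_surjective ℂ (AffRel κ) u
  induction a using FreeAlgebra.induction with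
  | grade0 r => rw [AlgHom.commutes]; exact h0 r
  | grade1 x =>
    cases x with
    | mode x n => exact h1 x n
    | central => exact h2
  | mul a b iha ihb => rw [map_mul]; exact hm _ _ iha ihb
  | add a b iha ihb => rw [map_add]; exact ha _ _ iha ihb

theorem affU_hom_ext {A : Type*} [Ring A] [Algebra ℂ A] {f h : AffU κ →ₐ[ℂ] A}
    (h1 : ∀ x n, f (md κ x n) = h (md κ x n)) (h2 : f (cK κ) = h (cK κ)) : f = h := by
  refine AlgHom.ext fun u => ?_
  induction u using affU_induction with
  | h0 c => simp
  | h1 x n => exact h1 x n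
  | h2 => exact h2
  | ha a b iha ihb => rw [map_add, map_add, iha, ihb]
  | hm a b iha ihb => rw [map_mul, map_mul, iha, ihb]

theorem cK_central (u : AffU κ) : cK κ * u = u * cK κ := by
  induction u using affU_induction with
  | h0 c => exact (Algebra.commutes c _).symm
  | h1 x n => exact cK_comm κ x n
  | h2 => rfl
  | ha a b iha ihb => rw [mul_add, add_mul, iha, ihb]
  | hm a b iha ihb => rw [← mul_assoc, iha, mul_assoc, ihb, mul_assoc]

/-! #### The derivation `-d/dt` and the parity automorphism -/

/-- The homomorphism `u ↦ u + ε T(u)`, where `T` is the derivation `x(n) ↦ -n x(n - 1)`. -/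
def derHom : AffU κ →ₐ[ℂ] TrivSqZeroExt (AffU κ) (AffU κ) :=
  affLift κ
    (fun x n => TrivSqZeroExt.inl (md κ x n) + TrivSqZeroExt.inr ((-n : ℂ) • md κ x (n - 1)))
    (TrivSqZeroExt.inl (cK κ))
    (by
      intro x y n
      ext
      · simp [md_add]
      · simp only [md_add, TrivSqZeroExt.snd_add, TrivSqZeroExt.snd_inl, TrivSqZeroExt.snd_inr,
          zero_add, smul_add])
    (by
      intro z x n
      ext
      · simp [md_smul]
      · simp only [md_smul, TrivSqZeroExt.snd_add, TrivSqZeroExt.snd_inl, TrivSqZeroExt.snd_inr,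
          TrivSqZeroExt.snd_smul, zero_add]
        rw [smul_comm])
    (by
      intro x n
      ext
      · simp [cK_comm]
      · simp [cK_comm])
    (by
      intro p q x y hx hy m n
      ext
      · simp only [TrivSqZeroExt.fst_mul, TrivSqZeroExt.fst_add, TrivSqZeroExt.fst_inl,
          TrivSqZeroExt.fst_inr, add_zero, TrivSqZeroExt.fst_smul]
        exact md_mul κ p q x y hx hy m n
      · have e1 := md_mul κ p q x y hx hy m (n - 1)
        have e2 := md_mul κ p q x y hx hy (m - 1) n
        simp only [TrivSqZeroExt.snd_mul, TrivSqZeroExt.fst_add, TrivSqZeroExt.fst_inl,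
          TrivSqZeroExt.fst_inr, add_zero, TrivSqZeroExt.snd_add, TrivSqZeroExt.snd_inl,
          TrivSqZeroExt.snd_inr, zero_add, smul_eq_mul, MulOpposite.smul_eq_mul_unop,
          MulOpposite.unop_op, TrivSqZeroExt.snd_smul, smul_zero,
          mul_smul_comm, smul_mul_assoc]
        rw [e1, e2, show m - 1 + n = m + n - 1 by ring, show m + (n - 1) = m + n - 1 by ring]
        by_cases h : m + n - 1 = 0
        · rw [if_pos h, if_pos h]
          have h' : (n : ℂ) = 1 - m := by
            have : n = 1 - m := by omega
            rw [this]; push_cast; ring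
          push_cast
          rw [h']
          module
        · rw [if_neg h, if_neg h]
          push_cast
          module)

theorem derHom_fst (u : AffU κ) : (derHom κ u).fst = u := by
  have : (TrivSqZeroExt.fstHom ℂ (AffU κ) (AffU κ)).comp (derHom κ) = AlgHom.id ℂ _ := by
    refine affU_hom_ext κ (fun x n => ?_) ?_
    · simp [derHom, affLift_md]
    · simp [derHom, affLift_cK]
  exact AlgHom.congr_fun this u

/-- The derivation `x(n) ↦ -n x(n - 1)`, `K ↦ 0`. -/
def der : AffU κ →ₗ[ℂ] AffU κ :=
  (TrivSqZeroExt.sndHom (AffU κ) (AffU κ)).restrictScalars ℂ ∘ₗ (derHom κ).toLinearMap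

theorem der_apply (u : AffU κ) : der κ u = (derHom κ u).snd := rfl

theorem der_mul (u v : AffU κ) : der κ (u * v) = u * der κ v + der κ u * v := by
  simp [der_apply, TrivSqZeroExt.snd_mul, derHom_fst]

theorem der_md (x : g) (n : ℤ) : der κ (md κ x n) = (-n : ℂ) • md κ x (n - 1) := by
  simp [der_apply, derHom, affLift_md]

theorem der_cK : der κ (cK κ) = 0 := by
  simp [der_apply, derHom, affLift_cK]

theorem der_algebraMap (c : ℂ) : der κ (algebraMap ℂ _ c) = 0 := by
  rw [der_apply, AlgHom.commutes]
  rfl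

/-- The parity involution of `g`. -/
def parG (S : LieSuperalgebra g) : g →ₗ[ℂ] g :=
  LinearMap.ofIsCompl S.isCompl_part (S.part 0).subtype (-(S.part 1).subtype)

theorem parG_apply {p : ZMod 2} {x : g} (hx : x ∈ S.part p) : parG S x = sgn p 1 • x := by
  rcases zmod2_cases p with rfl | rfl
  · have h : parG S x = x := LinearMap.ofIsCompl_apply_left S.isCompl_part
      (φ := (S.part 0).subtype) (ψ := -(S.part 1).subtype) ⟨x, hx⟩
    rw [h, sgn_zero_left, one_smul]
  · have h : parG S x = -x := LinearMap.ofIsCompl_apply_right S.isCompl_part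
      (φ := (S.part 0).subtype) (ψ := -(S.part 1).subtype) ⟨x, hx⟩
    rw [h, sgn, if_pos ⟨rfl, rfl⟩, neg_one_smul]

theorem exists_part (S : LieSuperalgebra g) (x : g) :
    ∃ a ∈ S.part 0, ∃ b ∈ S.part 1, a + b = x := by
  have : x ∈ S.part 0 ⊔ S.part 1 := by
    rw [S.isCompl_part.sup_eq_top]
    exact Submodule.mem_top
  exact Submodule.mem_sup.1 this

theorem parG_parG (x : g) : parG S (parG S x) = x := by
  obtain ⟨a, ha, b, hb, rfl⟩ := exists_part S x
  rw [map_add, parG_apply ha, parG_apply hb, map_add, map_smul, map_smul, parG_apply ha,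
    parG_apply hb, smul_smul, smul_smul, sgn_mul_self, sgn_mul_self, one_smul, one_smul]

/-- The parity automorphism of the enveloping algebra. -/
def parU : AffU κ →ₐ[ℂ] AffU κ :=
  affLift κ (fun x n => md κ (parG S x) n) (cK κ)
    (fun x y n => by rw [map_add, md_add])
    (fun z x n => by rw [map_smul, md_smul])
    (fun x n => cK_comm κ _ n)
    (by
      intro p q x y hx hy m n
      rw [parG_apply hx, parG_apply hy, parG_apply (S.bracket_mem p q x y hx hy), md_smul, md_smul,
        md_smul, smul_mul_smul_comm, md_mul κ p q x y hx hy m n, smul_mul_smul_comm, sgn_add_left]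
      have hk : (sgn p 1 * sgn q 1) • (if m + n = 0 then (m : ℂ) * κ.form x y else 0) =
          (if m + n = 0 then (m : ℂ) * κ.form x y else 0) := by
        by_cases hpq : p = q
        · subst hpq
          rw [sgn_mul_self, one_smul]
        · rw [κ.even p q x y hx hy hpq]
          simp
      rw [smul_add, smul_add, smul_comm (sgn p q), mul_comm (sgn q 1), smul_smul _ _ (cK κ),
        ← smul_eq_mul (sgn p 1 * sgn q 1) (ite _ _ _), hk])

theorem parU_md (x : g) (n : ℤ) : parU κ (md κ x n) = md κ (parG S x) n := by
  simp [parU, affLift_md]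

theorem parU_cK : parU κ (cK κ) = cK κ := by
  simp [parU, affLift_cK]

theorem parU_parU (u : AffU κ) : parU κ (parU κ u) = u := by
  have : (parU κ).comp (parU κ) = AlgHom.id ℂ _ := by
    refine affU_hom_ext κ (fun x n => ?_) ?_
    · simp [parU_md, parG_parG]
    · simp [parU_cK]
  exact AlgHom.congr_fun this u

/-! #### The vacuum module -/

/-- The left ideal generated by `g ⊗ ℂ[t]` and `K - k`. -/
def vacIdeal (k : ℂ) : Submodule (AffU κ) (AffU κ) :=
  Submodule.span (AffU κ)
    ({u | ∃ (x : g) (n : ℤ), 0 ≤ n ∧ u = md κ x n} ∪ {cK κ - algebraMap ℂ (AffU κ) k})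

/-- The vacuum module `V^k(g)`, induced from the one-dimensional module of
`g ⊗ ℂ[t] ⊕ ℂ K` on which `g ⊗ ℂ[t]` acts by `0` and `K` by `k`. -/
def VacMod (k : ℂ) : Type := AffU κ ⧸ vacIdeal κ k

instance (k : ℂ) : AddCommGroup (VacMod κ k) := inferInstanceAs (AddCommGroup (AffU κ ⧸ _))

instance (k : ℂ) : Module (AffU κ) (VacMod κ k) := inferInstanceAs (Module (AffU κ) (AffU κ ⧸ _))

instance (k : ℂ) : Module ℂ (VacMod κ k) := inferInstanceAs (Module ℂ (AffU κ ⧸ _))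

instance (k : ℂ) : IsScalarTower ℂ (AffU κ) (VacMod κ k) :=
  inferInstanceAs (IsScalarTower ℂ (AffU κ) (AffU κ ⧸ vacIdeal κ k))

/-- The quotient map onto the vacuum module. -/
def mkV (k : ℂ) : AffU κ →ₗ[AffU κ] VacMod κ k := (vacIdeal κ k).mkQ

theorem mkV_surjective (k : ℂ) : Function.Surjective (mkV κ k) := Submodule.mkQ_surjective _

theorem mkV_eq_zero (k : ℂ) {u : AffU κ} (h : u ∈ vacIdeal κ k) : mkV κ k u = 0 :=
  (Submodule.Quotient.mk_eq_zero _).2 h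

/-- The subspace of `V^k(g)` spanned by the vectors `x(-n) v` with `n ≥ 1`: the sum of the
homogeneous components of positive conformal weight. -/
def posPart (k : ℂ) : Submodule ℂ (VacMod κ k) :=
  Submodule.span ℂ {w | ∃ (x : g) (n : ℤ) (v : VacMod κ k), n < 0 ∧ w = md κ x n • v}

/-- The maximal proper graded submodule of `V^k(g)`, i.e. the largest submodule contained in the
sum of the homogeneous components of positive conformal weight. (The component of weight `0` is
spanned by the vacuum, which generates `V^k(g)`. If `k` is not the critical level, then the
conformal weight operator `L(0)` preserves every submodule, so that every proper submodule is graded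
and the one defined here contains all of them.) -/
def maxSub (k : ℂ) : Submodule (AffU κ) (VacMod κ k) where
  carrier := {v | ∀ u : AffU κ, u • v ∈ posPart κ k}
  add_mem' hv hw u := by
    rw [smul_add]
    exact add_mem (hv u) (hw u)
  zero_mem' u := by
    rw [smul_zero]
    exact zero_mem _
  smul_mem' a v hv u := by
    rw [smul_smul]
    exact hv (u * a)

/-- The irreducible quotient `L_g(k, 0)` of the vacuum module `V^k(g)`. -/
def SimpleQuot (k : ℂ) : Type := VacMod κ k ⧸ maxSub κ k

instance (k : ℂ) : AddCommGroup (SimpleQuot κ k) := inferInstanceAs (AddCommGroup (VacMod κ k ⧸ _))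

instance (k : ℂ) : Module (AffU κ) (SimpleQuot κ k) :=
  inferInstanceAs (Module (AffU κ) (VacMod κ k ⧸ maxSub κ k))

instance (k : ℂ) : Module ℂ (SimpleQuot κ k) :=
  inferInstanceAs (Module ℂ (VacMod κ k ⧸ maxSub κ k))

instance (k : ℂ) : IsScalarTower ℂ (AffU κ) (SimpleQuot κ k) :=
  inferInstanceAs (IsScalarTower ℂ (AffU κ) (VacMod κ k ⧸ maxSub κ k))

/-- The quotient map from the vacuum module onto its irreducible quotient. -/
def mkL (k : ℂ) : VacMod κ k →ₗ[AffU κ] SimpleQuot κ k := (maxSub κ k).mkQ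

theorem mkL_surjective (k : ℂ) : Function.Surjective (mkL κ k) := Submodule.mkQ_surjective _

/-- The vacuum vector of `V^k(g)`. -/
def vacV (k : ℂ) : VacMod κ k := mkV κ k 1

/-- The vacuum vector of `L_g(k, 0)`. -/
def vacL (k : ℂ) : SimpleQuot κ k := mkL κ k (vacV κ k)

/-- A linear map preserving a submodule descends to the quotient. -/
def descend {R M : Type*} [Ring R] [Algebra ℂ R] [AddCommGroup M] [Module ℂ M] [Module R M]
    [IsScalarTower ℂ R M] (W : Submodule R M) (f : M →ₗ[ℂ] M) (h : ∀ w ∈ W, f w ∈ W) :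
    (M ⧸ W) →ₗ[ℂ] M ⧸ W :=
  (Submodule.Quotient.restrictScalarsEquiv ℂ W).toLinearMap ∘ₗ
    (Submodule.mapQ (W.restrictScalars ℂ) (W.restrictScalars ℂ) f h) ∘ₗ
    (Submodule.Quotient.restrictScalarsEquiv ℂ W).symm.toLinearMap

variable (k : ℂ)

theorem der_vacIdeal : ∀ w ∈ vacIdeal κ k, der κ w ∈ vacIdeal κ k := by
  intro w hw
  induction hw using Submodule.span_induction with
  | mem w hw =>
    rcases hw with ⟨x, n, hn, rfl⟩ | hw
    · rw [der_md]
      rcases hn.eq_or_lt with rfl | hn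
      · simp
      · rw [← algebraMap_smul (AffU κ) (-n : ℂ)]
        exact Submodule.smul_mem _ _ (Submodule.subset_span (Or.inl ⟨x, n - 1, by omega, rfl⟩))
    · rw [Set.mem_singleton_iff.1 hw, map_sub, der_cK, der_algebraMap, sub_zero]
      exact zero_mem _
  | zero => rw [map_zero]; exact zero_mem _
  | add a b _ _ ha hb => rw [map_add]; exact add_mem ha hb
  | smul u a h ha =>
    rw [smul_eq_mul, der_mul]
    exact add_mem (Submodule.smul_mem _ u ha) (Submodule.smul_mem _ (der κ u) h)

theorem parU_vacIdeal : ∀ w ∈ vacIdeal κ k, parU κ w ∈ vacIdeal κ k := by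
  intro w hw
  induction hw using Submodule.span_induction with
  | mem w hw =>
    rcases hw with ⟨x, n, hn, rfl⟩ | hw
    · rw [parU_md]
      exact Submodule.subset_span (Or.inl ⟨_, n, hn, rfl⟩)
    · rw [Set.mem_singleton_iff.1 hw, map_sub, parU_cK, AlgHom.commutes]
      exact Submodule.subset_span (Or.inr rfl)
  | zero => rw [map_zero]; exact zero_mem _
  | add a b _ _ ha hb => rw [map_add]; exact add_mem ha hb
  | smul u a h ha =>
    rw [smul_eq_mul, map_mul]
    exact Submodule.smul_mem _ _ ha

/-- The translation operator on `V^k(g)`. -/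
def derV : VacMod κ k →ₗ[ℂ] VacMod κ k := descend (vacIdeal κ k) (der κ) (der_vacIdeal κ k)

/-- The parity involution of `V^k(g)`. -/
def parV : VacMod κ k →ₗ[ℂ] VacMod κ k :=
  descend (vacIdeal κ k) (parU κ).toLinearMap (parU_vacIdeal κ k)

theorem derV_mk (u : AffU κ) : derV κ k (mkV κ k u) = mkV κ k (der κ u) := rfl

theorem parV_mk (u : AffU κ) : parV κ k (mkV κ k u) = mkV κ k (parU κ u) := rfl

theorem derV_smul (u : AffU κ) (v : VacMod κ k) :
    derV κ k (u • v) = u • derV κ k v + der κ u • v := by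
  obtain ⟨a, rfl⟩ := mkV_surjective κ k v
  rw [← map_smul, derV_mk, derV_mk, smul_eq_mul, der_mul, map_add]
  rfl

theorem parV_smul (u : AffU κ) (v : VacMod κ k) :
    parV κ k (u • v) = parU κ u • parV κ k v := by
  obtain ⟨a, rfl⟩ := mkV_surjective κ k v
  rw [← map_smul, parV_mk, parV_mk, ← map_smul, smul_eq_mul, map_mul]
  rfl

theorem derV_vac : derV κ k (vacV κ k) = 0 := by
  have h : der κ 1 = 0 := by
    have := der_algebraMap κ 1
    rwa [map_one] at this
  rw [vacV, derV_mk, h, map_zero]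

theorem parV_vac : parV κ k (vacV κ k) = vacV κ k := by
  rw [vacV, parV_mk, map_one]

theorem parV_parV (v : VacMod κ k) : parV κ k (parV κ k v) = v := by
  obtain ⟨a, rfl⟩ := mkV_surjective κ k v
  rw [parV_mk, parV_mk, parU_parU]

theorem smul_vac (u : AffU κ) : u • vacV κ k = mkV κ k u := by
  rw [vacV, ← map_smul, smul_eq_mul, mul_one]

theorem md_vac (x : g) (n : ℤ) (hn : 0 ≤ n) : md κ x n • vacV κ k = 0 := by
  rw [smul_vac]
  exact mkV_eq_zero κ k (Submodule.subset_span (Or.inl ⟨x, n, hn, rfl⟩))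

theorem cK_smul (v : VacMod κ k) : cK κ • v = k • v := by
  obtain ⟨a, rfl⟩ := mkV_surjective κ k v
  have h : cK κ • vacV κ k = k • vacV κ k := by
    rw [← sub_eq_zero, ← algebraMap_smul (AffU κ) k, ← sub_smul, smul_vac]
    exact mkV_eq_zero κ k (Submodule.subset_span (Or.inr rfl))
  rw [← smul_vac, smul_smul, cK_central, ← smul_smul, h, smul_comm]

/-- `V^k(g)` is spanned by the vacuum under negative modes. -/
theorem neg_gen (T : Submodule ℂ (VacMod κ k)) (h0 : vacV κ k ∈ T)
    (h1 : ∀ (x : g) (n : ℤ) (v : VacMod κ k), n < 0 → v ∈ T → md κ x n • v ∈ T) : T = ⊤ := by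
  let T0 : Submodule ℂ (VacMod κ k) := sInf {T | vacV κ k ∈ T ∧
    ∀ (x : g) (n : ℤ) (v : VacMod κ k), n < 0 → v ∈ T → md κ x n • v ∈ T}
  have hT0 : T0 ≤ T := sInf_le ⟨h0, h1⟩
  have hv : vacV κ k ∈ T0 := by
    refine Submodule.mem_sInf.2 fun T hT => hT.1
  have hneg : ∀ (x : g) (n : ℤ) (v : VacMod κ k), n < 0 → v ∈ T0 → md κ x n • v ∈ T0 := by
    intro x n v hn hv
    exact Submodule.mem_sInf.2 fun T hT => hT.2 x n v hn (Submodule.mem_sInf.1 hv T hT)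
  let P : Submodule ℂ (VacMod κ k) :=
    { carrier := {v | v ∈ T0 ∧ ∀ (x : g) (n : ℤ), 0 ≤ n → md κ x n • v ∈ T0}
      add_mem' := fun ha hb => ⟨add_mem ha.1 hb.1, fun x n hn => by
        rw [smul_add]; exact add_mem (ha.2 x n hn) (hb.2 x n hn)⟩
      zero_mem' := ⟨zero_mem _, fun x n _ => by rw [smul_zero]; exact zero_mem _⟩
      smul_mem' := fun c v hv => ⟨Submodule.smul_mem _ _ hv.1, fun x n hn => by
        rw [smul_comm]; exact Submodule.smul_mem _ _ (hv.2 x n hn)⟩ }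
  have hP : T0 ≤ P := by
    refine sInf_le ⟨⟨hv, fun x n hn => ?_⟩, fun y m v hm hvP => ⟨hneg y m v hm hvP.1,
      fun x n hn => ?_⟩⟩
    · rw [md_vac κ k x n hn]
      exact zero_mem _
    · have hom : ∀ p, ∀ a ∈ S.part p, ∀ q, ∀ b ∈ S.part q, md κ a n • md κ b m • v ∈ T0 := by
        intro p a ha q b hb
        rw [smul_smul, md_mul κ p q a b ha hb, add_smul, add_smul, smul_assoc, mul_smul,
          smul_assoc, cK_smul]
        refine add_mem (add_mem (Submodule.smul_mem _ _ (hneg b m _ hm (hvP.2 a n hn))) ?_)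
          (Submodule.smul_mem _ _ (Submodule.smul_mem _ _ hvP.1))
        by_cases h : 0 ≤ n + m
        · exact hvP.2 _ _ h
        · exact hneg _ _ _ (by omega) hvP.1
      obtain ⟨a, ha, b, hb, rfl⟩ := exists_part S x
      obtain ⟨c, hc, d, hd, rfl⟩ := exists_part S y
      simp only [md_add, add_smul, smul_add]
      exact add_mem (add_mem (hom 0 a ha 0 c hc) (hom 1 b hb 0 c hc))
        (add_mem (hom 0 a ha 1 d hd) (hom 1 b hb 1 d hd))
  have hall : ∀ u : AffU κ, ∀ v ∈ T0, u • v ∈ T0 := by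
    intro u
    induction u using affU_induction with
    | h0 c => intro v hv; rw [algebraMap_smul]; exact Submodule.smul_mem _ _ hv
    | h1 x n =>
      intro v hv
      by_cases hn : 0 ≤ n
      · exact (hP hv).2 x n hn
      · exact hneg x n v (by omega) hv
    | h2 => intro v hv; rw [cK_smul]; exact Submodule.smul_mem _ _ hv
    | ha a b iha ihb => intro v hv; rw [add_smul]; exact add_mem (iha v hv) (ihb v hv)
    | hm a b iha ihb => intro v hv; rw [mul_smul]; exact iha _ (ihb v hv)
  refine top_unique fun v _ => ?_
  obtain ⟨a, rfl⟩ := mkV_surjective κ k v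
  rw [← smul_vac]
  exact hT0 (hall a _ hv)

theorem derV_mem (v : VacMod κ k) : derV κ k v ∈ posPart κ k := by
  have h : (posPart κ k).comap (derV κ k) = ⊤ := by
    refine neg_gen κ k _ ?_ fun x n v hn hv => ?_
    · rw [Submodule.mem_comap, derV_vac]
      exact zero_mem _
    · rw [Submodule.mem_comap, derV_smul, der_md, smul_assoc]
      exact add_mem (Submodule.subset_span ⟨x, n, _, hn, rfl⟩)
        (Submodule.smul_mem _ _ (Submodule.subset_span ⟨x, n - 1, v, by omega, rfl⟩))
  have : v ∈ (posPart κ k).comap (derV κ k) := h ▸ Submodule.mem_top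
  exact this

theorem derV_maxSub : ∀ v ∈ maxSub κ k, derV κ k v ∈ maxSub κ k := by
  intro v hv u
  have h := derV_smul κ k u v
  rw [eq_sub_of_add_eq h.symm]
  exact sub_mem (derV_mem κ k _) (hv _)

theorem parV_posPart : ∀ v ∈ posPart κ k, parV κ k v ∈ posPart κ k := by
  intro v hv
  induction hv using Submodule.span_induction with
  | mem w hw =>
    obtain ⟨x, n, v, hn, rfl⟩ := hw
    rw [parV_smul, parU_md]
    exact Submodule.subset_span ⟨_, n, _, hn, rfl⟩
  | zero => rw [map_zero]; exact zero_mem _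
  | add a b _ _ ha hb => rw [map_add]; exact add_mem ha hb
  | smul c a _ ha => rw [map_smul]; exact Submodule.smul_mem _ _ ha

theorem parV_maxSub : ∀ v ∈ maxSub κ k, parV κ k v ∈ maxSub κ k := by
  intro v hv u
  have h := parV_smul κ k (parU κ u) v
  rw [parU_parU] at h
  rw [← h]
  exact parV_posPart κ k _ (hv _)

/-! #### The vertex superalgebra structure of `L_g(k, 0)` -/

/-- The translation operator on `L_g(k, 0)`. -/
def derL : SimpleQuot κ k →ₗ[ℂ] SimpleQuot κ k :=
  descend (maxSub κ k) (derV κ k) (derV_maxSub κ k)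

/-- The parity involution of `L_g(k, 0)`. -/
def parL : SimpleQuot κ k →ₗ[ℂ] SimpleQuot κ k :=
  descend (maxSub κ k) (parV κ k) (parV_maxSub κ k)

theorem derL_mk (v : VacMod κ k) : derL κ k (mkL κ k v) = mkL κ k (derV κ k v) := rfl

theorem parL_mk (v : VacMod κ k) : parL κ k (mkL κ k v) = mkL κ k (parV κ k v) := rfl

theorem derL_smul (u : AffU κ) (v : SimpleQuot κ k) :
    derL κ k (u • v) = u • derL κ k v + der κ u • v := by
  obtain ⟨a, rfl⟩ := mkL_surjective κ k v
  rw [← map_smul, derL_mk, derL_mk, derV_smul, map_add, map_smul, map_smul]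

theorem parL_smul (u : AffU κ) (v : SimpleQuot κ k) :
    parL κ k (u • v) = parU κ u • parL κ k v := by
  obtain ⟨a, rfl⟩ := mkL_surjective κ k v
  rw [← map_smul, parL_mk, parL_mk, ← map_smul, parV_smul]

theorem parL_parL (v : SimpleQuot κ k) : parL κ k (parL κ k v) = v := by
  obtain ⟨a, rfl⟩ := mkL_surjective κ k v
  rw [parL_mk, parL_mk, parV_parV]

theorem cK_smulL (v : SimpleQuot κ k) : cK κ • v = k • v := by
  obtain ⟨a, rfl⟩ := mkL_surjective κ k v
  rw [← map_smul, cK_smul, ← algebraMap_smul (AffU κ) k a, map_smul, algebraMap_smul]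

theorem md_vacL (x : g) (n : ℤ) (hn : 0 ≤ n) : md κ x n • vacL κ k = 0 := by
  rw [vacL, ← map_smul, md_vac κ k x n hn, map_zero]

/-- The even and odd parts of `L_g(k, 0)`. -/
def partL (p : ZMod 2) : Submodule ℂ (SimpleQuot κ k) where
  carrier := {v | parL κ k v = sgn p 1 • v}
  add_mem' {a b} ha hb := by
    change parL κ k (a + b) = _
    rw [map_add, ha, hb, smul_add]
  zero_mem' := by
    change parL κ k 0 = _
    rw [map_zero, smul_zero]
  smul_mem' c v hv := by
    change parL κ k (c • v) = _
    rw [map_smul, hv, smul_comm]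

theorem mem_partL {p : ZMod 2} {v : SimpleQuot κ k} :
    v ∈ partL κ k p ↔ parL κ k v = sgn p 1 • v := Iff.rfl

/-- The modes of `x(z) = ∑ x(n) z^{-n-1}` acting on `L_g(k, 0)`. -/
def modeL (x : g) (n : ℤ) : Module.End ℂ (SimpleQuot κ k) :=
  Algebra.lsmul ℂ ℂ (SimpleQuot κ k) (md κ x n)

theorem modeL_apply (x : g) (n : ℤ) (v : SimpleQuot κ k) : modeL κ k x n v = md κ x n • v := rfl

theorem modeL_comm (p q : ZMod 2) (x y : g) (hx : x ∈ S.part p) (hy : y ∈ S.part q) (m n : ℤ)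
    (v : SimpleQuot κ k) :
    modeL κ k x m (modeL κ k y n v) = sgn p q • modeL κ k y n (modeL κ k x m v) +
      modeL κ k (S.bracket x y) (m + n) v +
        (if m + n = 0 then (m : ℂ) * κ.form x y else 0) • k • v := by
  simp only [modeL_apply]
  rw [smul_smul, md_mul κ p q x y hx hy, add_smul, add_smul, smul_assoc, mul_smul, smul_assoc,
    cK_smulL]

theorem modeL_gen (T : Submodule ℂ (SimpleQuot κ k)) (h0 : vacL κ k ∈ T)
    (h1 : ∀ (p : ZMod 2) (x : g), x ∈ S.part p → ∀ (n : ℤ) (v : SimpleQuot κ k), v ∈ T →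
      modeL κ k x n v ∈ T) : T = ⊤ := by
  have hall : ∀ u : AffU κ, ∀ v ∈ T, u • v ∈ T := by
    intro u
    induction u using affU_induction with
    | h0 c => intro v hv; rw [algebraMap_smul]; exact Submodule.smul_mem _ _ hv
    | h1 x n =>
      intro v hv
      obtain ⟨a, ha, b, hb, rfl⟩ := exists_part S x
      rw [md_add, add_smul]
      exact add_mem (h1 0 a ha n v hv) (h1 1 b hb n v hv)
    | h2 => intro v hv; rw [cK_smulL]; exact Submodule.smul_mem _ _ hv
    | ha a b iha ihb => intro v hv; rw [add_smul]; exact add_mem (iha v hv) (ihb v hv)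
    | hm a b iha ihb => intro v hv; rw [mul_smul]; exact iha _ (ihb v hv)
  refine top_unique fun v _ => ?_
  obtain ⟨a, rfl⟩ := mkL_surjective κ k v
  obtain ⟨b, rfl⟩ := mkV_surjective κ k a
  rw [← smul_vac, map_smul]
  exact hall b _ h0

theorem modeL_fld (p : ZMod 2) (x : g) (hx : x ∈ S.part p) : IsFld (modeL κ k x) := by
  let T : Submodule ℂ (SimpleQuot κ k) :=
    { carrier := {v | ∀ q, ∀ y ∈ S.part q, ∃ N : ℤ, ∀ n, N ≤ n → modeL κ k y n v = 0}
      add_mem' := by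
        intro a b ha hb q y hy
        obtain ⟨N, hN⟩ := ha q y hy
        obtain ⟨M, hM⟩ := hb q y hy
        exact ⟨max N M, fun n hn => by
          rw [map_add, hN n (le_trans (le_max_left _ _) hn), hM n (le_trans (le_max_right _ _) hn),
            add_zero]⟩
      zero_mem' := fun q y _ => ⟨0, fun n _ => map_zero _⟩
      smul_mem' := by
        intro c v hv q y hy
        obtain ⟨N, hN⟩ := hv q y hy
        exact ⟨N, fun n hn => by rw [map_smul, hN n hn, smul_zero]⟩ }
  have hT : T = ⊤ := by
    refine modeL_gen κ k T (fun q y hy => ⟨0, fun n hn => ?_⟩) fun q y hy m v hv r z hz => ?_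
    · rw [modeL_apply, md_vacL κ k y n hn]
    · obtain ⟨N, hN⟩ := hv r z hz
      obtain ⟨M, hM⟩ := hv (r + q) _ (S.bracket_mem r q z y hz hy)
      refine ⟨max N (max (M - m) (1 - m)), fun n hn => ?_⟩
      have a1 : N ≤ n := le_trans (le_max_left _ _) hn
      have a2 : M - m ≤ n := le_trans (le_trans (le_max_left _ _) (le_max_right _ _)) hn
      have a3 : 1 - m ≤ n := le_trans (le_trans (le_max_right _ _) (le_max_right _ _)) hn
      rw [modeL_comm κ k r q z y hz hy, hN n a1, hM _ (by omega), if_neg (by omega), map_zero,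
        smul_zero, zero_smul, add_zero, add_zero]
  intro v
  have : v ∈ T := hT ▸ Submodule.mem_top
  exact this p x hx

theorem modeL_loc (p q : ZMod 2) (x y : g) (hx : x ∈ S.part p) (hy : y ∈ S.part q) :
    Loc (sgn p q) (modeL κ k x) (modeL κ k y) := by
  refine ⟨2, fun w => ?_⟩
  have e : (fun m n => modeL κ k x m (modeL κ k y n w) -
      sgn p q • modeL κ k y n (modeL κ k x m w)) = fun m n =>
      modeL κ k (S.bracket x y) (m + n) w +
        (if m + n = 0 then (m : ℂ) * κ.form x y else 0) • k • w := by
    funext m n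
    rw [modeL_comm κ k p q x y hx hy]
    abel
  rw [e]
  funext m n
  rw [pow_two, Module.End.mul_apply]
  simp only [dif_apply, Pi.zero_apply]
  rw [show m + 1 + 1 + n = m + n + 2 by ring, show m + 1 + (n + 1) = m + n + 2 by ring,
    show m + (n + 1 + 1) = m + n + 2 by ring]
  push_cast
  by_cases h : m + n + 2 = 0
  · simp only [if_pos h]
    module
  · simp only [if_neg h]
    module

/-- The generating fields `x(z)`, for homogeneous `x`, on `L_g(k, 0)`. -/
def affineFields : GeneratingFields (SimpleQuot κ k) (Σ p : ZMod 2, S.part p) where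
  part := partL κ k
  isCompl_part := by
    constructor
    · rw [Submodule.disjoint_def]
      intro v h0 h1
      rw [mem_partL] at h0 h1
      rw [h0] at h1
      rw [sgn_zero_left, one_smul, sgn, if_pos ⟨rfl, rfl⟩, neg_one_smul] at h1
      have h2 : (2 : ℂ) • v = 0 := by
        rw [two_smul]
        nth_rewrite 1 [h1]
        exact neg_add_cancel v
      exact (smul_eq_zero.1 h2).resolve_left two_ne_zero
    · rw [codisjoint_iff]
      refine top_unique fun v _ => Submodule.mem_sup.2
        ⟨(1 / 2 : ℂ) • (v + parL κ k v), ?_, (1 / 2 : ℂ) • (v - parL κ k v), ?_, ?_⟩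
      · rw [mem_partL, map_smul, map_add, parL_parL]
        rw [sgn_zero_left, one_smul, add_comm]
      · rw [mem_partL, map_smul, map_sub, parL_parL]
        simp only [sgn, and_self, if_true]
        module
      · module
  vac := vacL κ k
  D := derL κ k
  par i := i.1
  X i := modeL κ k i.2.1
  vac_mem := by
    rw [mem_partL, sgn_zero_left, one_smul, vacL, parL_mk, parV_vac]
  X_mem i q v n hv := by
    rw [mem_partL] at hv ⊢
    rw [modeL_apply, parL_smul, hv, parU_md, parG_apply i.2.2, md_smul, sgn_add_left,
      smul_assoc, smul_comm (md κ _ n), smul_smul]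
  fld i := modeL_fld κ k i.1 _ i.2.2
  loc i j := modeL_loc κ k i.1 j.1 _ _ i.2.2 j.2.2
  cov i n w := by
    simp only [modeL_apply]
    rw [derL_smul, der_md, smul_assoc, neg_smul]
    exact (sub_eq_add_neg _ _).symm
  D_vac := by
    rw [vacL, derL_mk, derV_vac, map_zero]
  X_vac i n hn := md_vacL κ k _ n hn
  gen T h0 h1 := modeL_gen κ k T h0 fun p x hx n v hv => h1 ⟨p, ⟨x, hx⟩⟩ n v hv

/-- The vertex superalgebra `L_g(k, 0)`: the simple quotient of `V^k(g)`, with vacuum vector `1` and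
with `Y(x(-1) 1, z) = x(z) = ∑ x(n) z^{-n-1}` for all `x` in `g`. -/
def simpleAffine : VertexSuperalgebra (SimpleQuot κ k) := (affineFields κ k).vertexSuperalgebra

theorem simpleAffine_vac : (simpleAffine κ k).vac = vacL κ k := rfl

theorem simpleAffine_Y (x : g) :
    (simpleAffine κ k).Y (md κ x (-1) • vacL κ k) = modeL κ k x := by
  have h : ∀ p, ∀ a ∈ S.part p,
      (simpleAffine κ k).Y (md κ a (-1) • vacL κ k) = modeL κ k a := fun p a ha =>
    (affineFields κ k).Y_gen ⟨p, ⟨a, ha⟩⟩ _ rfl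
  obtain ⟨a, ha, b, hb, rfl⟩ := exists_part S x
  rw [md_add, add_smul, map_add, h 0 a ha, h 1 b hb]
  funext n
  refine LinearMap.ext fun v => ?_
  simp only [Pi.add_apply, LinearMap.add_apply, modeL_apply, md_add, add_smul]

end Affine

/-! ### The Lie superalgebra `osp(1|2n)` -/

section Matrices

variable {ι : Type} [Fintype ι] [DecidableEq ι] (π : ι → ZMod 2)

/-- The component of parity `p` of a matrix whose indices have the parities `π`. -/
def mcomp (p : ZMod 2) : Matrix ι ι ℂ →ₗ[ℂ] Matrix ι ι ℂ where
  toFun X := Matrix.of fun i j => if π i + π j = p then X i j else 0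
  map_add' X Y := by
    ext i j
    simp only [Matrix.add_apply, Matrix.of_apply]
    split_ifs <;> simp
  map_smul' c X := by
    ext i j
    simp only [Matrix.smul_apply, Matrix.of_apply, RingHom.id_apply]
    split_ifs <;> simp

/-- The matrices of parity `p`. -/
def mpart (p : ZMod 2) : Submodule ℂ (Matrix ι ι ℂ) where
  carrier := {X | ∀ i j, π i + π j ≠ p → X i j = 0}
  add_mem' hX hY i j h := by rw [Matrix.add_apply, hX i j h, hY i j h, add_zero]
  zero_mem' _ _ _ := rfl
  smul_mem' c X hX i j h := by rw [Matrix.smul_apply, hX i j h, smul_zero]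

/-- The superbracket of matrices, `[X, Y] = X Y - (-1)^{|X||Y|} Y X` for homogeneous `X`, `Y`. -/
def mbr : Matrix ι ι ℂ →ₗ[ℂ] Matrix ι ι ℂ →ₗ[ℂ] Matrix ι ι ℂ :=
  LinearMap.mul ℂ (Matrix ι ι ℂ) - ∑ p : ZMod 2, ∑ q : ZMod 2,
    sgn p q • ((LinearMap.mul ℂ (Matrix ι ι ℂ)).flip.compl₁₂ (mcomp π p) (mcomp π q))

/-- The form `(X|Y) = -Str(X Y)`, where `Str Z = ∑ (-1)^{|i|} Z i i`. -/
def mform : Matrix ι ι ℂ →ₗ[ℂ] Matrix ι ι ℂ →ₗ[ℂ] ℂ :=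
  LinearMap.mk₂ ℂ (fun X Y => -∑ i, sgn (π i) (π i) * (X * Y) i i)
    (fun X X' Y => by
      simp only [add_mul, Matrix.add_apply, mul_add, Finset.sum_add_distrib, neg_add])
    (fun c X Y => by
      simp only [smul_mul_assoc, Matrix.smul_apply, smul_eq_mul, mul_neg, Finset.mul_sum]
      congr 1
      exact Finset.sum_congr rfl fun i _ => by ring)
    (fun X Y Y' => by
      simp only [mul_add, Matrix.add_apply, Finset.sum_add_distrib, neg_add])
    (fun c X Y => by
      simp only [mul_smul_comm, Matrix.smul_apply, smul_eq_mul, mul_neg, Finset.mul_sum]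
      congr 1
      exact Finset.sum_congr rfl fun i _ => by ring)

variable {π}

theorem mcomp_mem (p : ZMod 2) (X : Matrix ι ι ℂ) : mcomp π p X ∈ mpart π p :=
  fun _ _ h => if_neg h

theorem mcomp_of_mem {p : ZMod 2} {X : Matrix ι ι ℂ} (h : X ∈ mpart π p) (q : ZMod 2) :
    mcomp π q X = if q = p then X else 0 := by
  ext i j
  change (if π i + π j = q then X i j else 0) = _
  by_cases hp : π i + π j = p
  · rw [hp]
    by_cases hq : p = q
    · rw [if_pos hq, if_pos hq.symm]
    · rw [if_neg hq, if_neg (Ne.symm hq), Matrix.zero_apply]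
  · rw [h i j hp, ite_self]
    split_ifs
    · exact (h i j hp).symm
    · rfl

theorem mbr_apply {p q : ZMod 2} {X Y : Matrix ι ι ℂ} (hX : X ∈ mpart π p) (hY : Y ∈ mpart π q) :
    mbr π X Y = X * Y - sgn p q • (Y * X) := by
  simp only [mbr, LinearMap.sub_apply, LinearMap.mul_apply', LinearMap.sum_apply,
    LinearMap.smul_apply, LinearMap.compl₁₂_apply, LinearMap.flip_apply]
  rw [Finset.sum_eq_single p, Finset.sum_eq_single q]
  · rw [mcomp_of_mem hX, mcomp_of_mem hY, if_pos rfl, if_pos rfl]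
  · intro r _ hr
    rw [mcomp_of_mem hY, if_neg hr, zero_mul, smul_zero]
  · simp
  · intro r _ hr
    refine Finset.sum_eq_zero fun s _ => ?_
    rw [mcomp_of_mem hX, if_neg hr, mul_zero, smul_zero]
  · simp

theorem mul_mem_mpart {p q : ZMod 2} {X Y : Matrix ι ι ℂ} (hX : X ∈ mpart π p)
    (hY : Y ∈ mpart π q) : X * Y ∈ mpart π (p + q) := by
  intro i j h
  rw [Matrix.mul_apply]
  refine Finset.sum_eq_zero fun r _ => ?_
  by_cases h1 : π i + π r = p
  · have h2 : π r + π j ≠ q := by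
      intro h2
      apply h
      rw [← h1, ← h2]
      have : ∀ a b c : ZMod 2, a + c = a + b + (b + c) := by decide
      exact this _ _ _
    rw [hY r j h2, mul_zero]
  · rw [hX i r h1, zero_mul]

theorem mbr_mem {p q : ZMod 2} {X Y : Matrix ι ι ℂ} (hX : X ∈ mpart π p) (hY : Y ∈ mpart π q) :
    mbr π X Y ∈ mpart π (p + q) := by
  rw [mbr_apply hX hY]
  refine sub_mem (mul_mem_mpart hX hY) (Submodule.smul_mem _ _ ?_)
  rw [add_comm]
  exact mul_mem_mpart hY hX

theorem mcomp_add (X : Matrix ι ι ℂ) : mcomp π 0 X + mcomp π 1 X = X := by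
  ext i j
  change (if π i + π j = 0 then X i j else 0) + (if π i + π j = 1 then X i j else 0) = X i j
  rcases zmod2_cases (π i + π j) with h | h <;> simp [h]

theorem mbr_jacobi {p q r : ZMod 2} {X Y Z : Matrix ι ι ℂ} (hX : X ∈ mpart π p)
    (hY : Y ∈ mpart π q) (hZ : Z ∈ mpart π r) :
    mbr π X (mbr π Y Z) = mbr π (mbr π X Y) Z + sgn p q • mbr π Y (mbr π X Z) := by
  rw [mbr_apply hX (mbr_mem hY hZ), mbr_apply (mbr_mem hX hY) hZ, mbr_apply hY (mbr_mem hX hZ),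
    mbr_apply hX hY, mbr_apply hY hZ, mbr_apply hX hZ, sgn_add_left, sgn_comm p (q + r),
    sgn_comm q (p + r), sgn_add_left, sgn_add_left, sgn_comm q p, sgn_comm r p, sgn_comm r q]
  have h1 := sgn_mul_self p q
  simp only [mul_sub, sub_mul, smul_sub, mul_smul_comm, smul_mul_assoc, smul_smul, mul_assoc]
  have h2 : ∀ a : ℂ, sgn p q * (sgn p q * a) = a := fun a => by rw [← mul_assoc, h1, one_mul]
  simp only [h2]
  module

theorem mform_even {p q : ZMod 2} {X Y : Matrix ι ι ℂ} (hX : X ∈ mpart π p)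
    (hY : Y ∈ mpart π q) (hpq : p ≠ q) : mform π X Y = 0 := by
  change -∑ i, _ = _
  rw [neg_eq_zero]
  refine Finset.sum_eq_zero fun i _ => ?_
  rw [mul_mem_mpart hX hY i i, mul_zero]
  have : ∀ a b c : ZMod 2, a ≠ b → c + c ≠ a + b := by decide
  exact this _ _ _ hpq

theorem mform_supersymm {p q : ZMod 2} {X Y : Matrix ι ι ℂ} (hX : X ∈ mpart π p)
    (hY : Y ∈ mpart π q) : mform π X Y = sgn p q * mform π Y X := by
  by_cases hpq : p = q
  · subst hpq
    change -∑ i, _ = sgn p p * -∑ i, _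
    rw [mul_neg, Finset.mul_sum]
    congr 1
    simp only [Matrix.mul_apply, Finset.mul_sum]
    rw [Finset.sum_comm]
    refine Finset.sum_congr rfl fun j _ => Finset.sum_congr rfl fun i _ => ?_
    by_cases h : π i + π j = p
    · have h1 : sgn (π i) (π i) = sgn p p * sgn (π j) (π j) := by
        have hi : π i = p + π j := by
          have : ∀ a b c : ZMod 2, a + b = c → a = c + b := by decide
          exact this _ _ _ h
        rw [hi, sgn_add_left, sgn_comm p, sgn_comm (π j) (p + π j), sgn_add_left, sgn_add_left,
          sgn_comm (π j) p]
        linear_combination sgn p p * sgn (π j) (π j) * sgn_mul_self p (π j)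
      rw [h1]
      ring
    · rw [hX i j h]
      ring
  · rw [mform_even hX hY hpq, mform_even hY hX (Ne.symm hpq), mul_zero]

theorem mform_mul (X Y Z : Matrix ι ι ℂ) : mform π (X * Y) Z = mform π X (Y * Z) := by
  change -∑ i, _ = -∑ i, _
  rw [mul_assoc]

theorem mform_invariant {p q r : ZMod 2} {X Y Z : Matrix ι ι ℂ} (hX : X ∈ mpart π p)
    (hY : Y ∈ mpart π q) (hZ : Z ∈ mpart π r) :
    mform π (mbr π X Y) Z = mform π X (mbr π Y Z) := by
  rw [mbr_apply hX hY, mbr_apply hY hZ, map_sub, LinearMap.sub_apply, map_smul,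
    LinearMap.smul_apply, map_sub, map_smul, mform_mul, mform_mul, ← mform_mul X Z Y,
    mform_supersymm hY (mul_mem_mpart hX hZ), sgn_comm q (p + r), sgn_add_left, sgn_comm r q]
  simp only [smul_eq_mul]
  linear_combination (-sgn q r * mform π (X * Z) Y) * sgn_mul_self p q

/-- The matrices `X` with `b(X v, w) + (-1)^{|X||v|} b(v, X w) = 0` for all homogeneous `v`, `w`,
where `b(v, w) = vᵀ B w`. The `(i, j)` entry of `B X` comes from the component of `X` of parity
`|i| + |j|` if `B` is even. -/
def mosp (π : ι → ZMod 2) (B : Matrix ι ι ℂ) : Submodule ℂ (Matrix ι ι ℂ) where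
  carrier := {X | ∀ i j, (X.transpose * B) i j + sgn (π i + π j) (π i) * (B * X) i j = 0}
  add_mem' {X Y} hX hY i j := by
    rw [Matrix.transpose_add, add_mul, mul_add, Matrix.add_apply, Matrix.add_apply]
    linear_combination hX i j + hY i j
  zero_mem' i j := by simp
  smul_mem' c X hX i j := by
    rw [Matrix.transpose_smul, smul_mul_assoc, mul_smul_comm, Matrix.smul_apply, Matrix.smul_apply,
      smul_eq_mul, smul_eq_mul]
    linear_combination c * hX i j

theorem mcomp_mosp {B : Matrix ι ι ℂ} (hB : B ∈ mpart π 0) {X : Matrix ι ι ℂ}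
    (hX : X ∈ mosp π B) (p : ZMod 2) : mcomp π p X ∈ mosp π B := by
  have hB' : ∀ i j, π i ≠ π j → B i j = 0 := fun i j h => hB i j (by
    have : ∀ a b : ZMod 2, a ≠ b → a + b ≠ 0 := by decide
    exact this _ _ h)
  intro i j
  have h1 : ((mcomp π p X).transpose * B) i j =
      if π i + π j = p then (X.transpose * B) i j else 0 := by
    have e : ∀ r, (mcomp π p X).transpose i r * B r j =
        if π i + π j = p then X.transpose i r * B r j else 0 := by
      intro r
      change (if π r + π i = p then X r i else 0) * B r j = _
      by_cases hr : π r = π j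
      · rw [hr, add_comm (π j)]
        split_ifs
        · rfl
        · exact zero_mul _
      · simp only [hB' r j hr, mul_zero, ite_self]
    rw [Matrix.mul_apply, Matrix.mul_apply, Finset.sum_congr rfl fun r _ => e r]
    split_ifs
    · rfl
    · exact Finset.sum_const_zero
  have h2 : (B * mcomp π p X) i j = if π i + π j = p then (B * X) i j else 0 := by
    have e : ∀ r, B i r * mcomp π p X r j =
        if π i + π j = p then B i r * X r j else 0 := by
      intro r
      change B i r * (if π r + π j = p then X r j else 0) = _
      by_cases hr : π i = π r
      · rw [hr]
        split_ifs
        · rfl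
        · exact mul_zero _
      · simp only [hB' i r hr, zero_mul, ite_self]
    rw [Matrix.mul_apply, Matrix.mul_apply, Finset.sum_congr rfl fun r _ => e r]
    split_ifs
    · rfl
    · exact Finset.sum_const_zero
  rw [h1, h2]
  split_ifs
  · exact hX i j
  · ring

theorem mosp_iff {B : Matrix ι ι ℂ} (hB : B ∈ mpart π 0) {p : ZMod 2} {X : Matrix ι ι ℂ}
    (hX : X ∈ mpart π p) : X ∈ mosp π B ↔
      X.transpose * B = -(Matrix.diagonal (fun i => sgn p (π i)) * (B * X)) := by
  have hm : ∀ i j, sgn (π i + π j) (π i) * (B * X) i j = sgn p (π i) * (B * X) i j := by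
    intro i j
    by_cases h : π i + π j = p
    · rw [h]
    · rw [mul_mem_mpart hB hX i j (by rwa [zero_add]), mul_zero, mul_zero]
  constructor
  · intro h
    ext i j
    have := h i j
    rw [hm] at this
    rw [Matrix.neg_apply, Matrix.diagonal_mul]
    exact eq_neg_of_add_eq_zero_left this
  · intro h i j
    rw [hm, h, Matrix.neg_apply, Matrix.diagonal_mul]
    exact neg_add_cancel _

theorem transpose_mul_diagonal {p q : ZMod 2} {Y : Matrix ι ι ℂ} (hY : Y ∈ mpart π q) :
    Y.transpose * Matrix.diagonal (fun i => sgn p (π i)) =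
      sgn p q • (Matrix.diagonal (fun i => sgn p (π i)) * Y.transpose) := by
  ext i r
  rw [Matrix.mul_diagonal, Matrix.smul_apply, Matrix.diagonal_mul, Matrix.transpose_apply]
  by_cases h : π r + π i = q
  · have hr : π r = q + π i := by
      have : ∀ a b c : ZMod 2, a + b = c → a = c + b := by decide
      exact this _ _ _ h
    rw [hr, sgn_comm p (q + π i), sgn_add_left, sgn_comm q p, sgn_comm (π i) p, smul_eq_mul]
    ring
  · rw [hY r i h]
    simp

theorem mbr_mosp {B : Matrix ι ι ℂ} (hB : B ∈ mpart π 0) {p q : ZMod 2} {X Y : Matrix ι ι ℂ}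
    (hX : X ∈ mpart π p) (hY : Y ∈ mpart π q) (hX' : X ∈ mosp π B) (hY' : Y ∈ mosp π B) :
    mbr π X Y ∈ mosp π B := by
  rw [mosp_iff hB (mbr_mem hX hY), mbr_apply hX hY]
  have eX := (mosp_iff hB hX).1 hX'
  have eY := (mosp_iff hB hY).1 hY'
  have hd : Matrix.diagonal (fun i => sgn (p + q) (π i)) =
      Matrix.diagonal (fun i => sgn p (π i)) * Matrix.diagonal (fun i => sgn q (π i)) := by
    rw [Matrix.diagonal_mul_diagonal]
    congr 1
    funext i
    exact sgn_add_left _ _ _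
  have hdc : Matrix.diagonal (fun i => sgn q (π i)) * Matrix.diagonal (fun i => sgn p (π i)) =
      Matrix.diagonal (fun i => sgn p (π i)) * Matrix.diagonal (fun i => sgn q (π i)) := by
    rw [Matrix.diagonal_mul_diagonal, Matrix.diagonal_mul_diagonal]
    congr 1
    funext i
    exact mul_comm _ _
  have e1 : (X * Y).transpose * B = sgn p q •
      (Matrix.diagonal (fun i => sgn (p + q) (π i)) * (B * (Y * X))) := by
    rw [Matrix.transpose_mul, mul_assoc, eX, mul_neg, ← mul_assoc, transpose_mul_diagonal hY,
      smul_mul_assoc, mul_assoc, ← mul_assoc Y.transpose, eY, hd]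
    simp only [neg_mul, mul_neg, smul_neg, neg_neg, mul_assoc]
  have e2 : (Y * X).transpose * B = sgn p q •
      (Matrix.diagonal (fun i => sgn (p + q) (π i)) * (B * (X * Y))) := by
    rw [Matrix.transpose_mul, mul_assoc, eY, mul_neg, ← mul_assoc, transpose_mul_diagonal hX,
      smul_mul_assoc, mul_assoc, ← mul_assoc X.transpose, eX, hd, ← hdc, sgn_comm q p]
    simp only [neg_mul, mul_neg, smul_neg, neg_neg, mul_assoc]
  rw [Matrix.transpose_sub, Matrix.transpose_smul, sub_mul, smul_mul_assoc, e1, e2, smul_smul,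
    sgn_mul_self, one_smul, mul_sub, mul_sub, mul_smul_comm, mul_smul_comm]
  abel

/-- The Lie superalgebra of matrices preserving the even bilinear form with matrix `B`. -/
def ospOf (π : ι → ZMod 2) (B : Matrix ι ι ℂ) (hB : B ∈ mpart π 0) :
    LieSuperalgebra (mosp π B) where
  part p := (mpart π p).comap (mosp π B).subtype
  bracket := LinearMap.mk₂ ℂ
    (fun X Y => ⟨mbr π X.1 Y.1, by
      have h : ∀ p q, mbr π (mcomp π p X.1) (mcomp π q Y.1) ∈ mosp π B := fun p q =>
        mbr_mosp hB (mcomp_mem p _) (mcomp_mem q _) (mcomp_mosp hB X.2 p) (mcomp_mosp hB Y.2 q)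
      have e : mbr π X.1 Y.1 = mbr π (mcomp π 0 X.1 + mcomp π 1 X.1)
          (mcomp π 0 Y.1 + mcomp π 1 Y.1) := by rw [mcomp_add, mcomp_add]
      rw [e]
      simp only [map_add, LinearMap.add_apply]
      exact add_mem (add_mem (h 0 0) (h 1 0)) (add_mem (h 0 1) (h 1 1))⟩)
    (fun X X' Y => Subtype.ext (by
      simp only [Submodule.coe_add, map_add, LinearMap.add_apply]))
    (fun c X Y => Subtype.ext (by
      simp only [Submodule.coe_smul, map_smul, LinearMap.smul_apply]))
    (fun X Y Y' => Subtype.ext (by simp only [Submodule.coe_add, map_add]))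
    (fun c X Y => Subtype.ext (by simp only [Submodule.coe_smul, map_smul]))
  isCompl_part := by
    constructor
    · rw [Submodule.disjoint_def]
      intro X h0 h1
      refine Subtype.ext ?_
      ext i j
      by_cases h : π i + π j = 0
      · exact h1 i j (by rw [h]; decide)
      · exact h0 i j h
    · rw [codisjoint_iff]
      refine top_unique fun X _ => Submodule.mem_sup.2
        ⟨⟨mcomp π 0 X.1, mcomp_mosp hB X.2 0⟩, mcomp_mem 0 X.1,
          ⟨mcomp π 1 X.1, mcomp_mosp hB X.2 1⟩, mcomp_mem 1 X.1, Subtype.ext (mcomp_add X.1)⟩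
  bracket_mem p q X Y hX hY := mbr_mem (π := π) hX hY
  skew p q X Y hX hY := Subtype.ext (by
    change mbr π X.1 Y.1 = -(sgn p q • mbr π Y.1 X.1)
    have hX' : X.1 ∈ mpart π p := hX
    have hY' : Y.1 ∈ mpart π q := hY
    rw [mbr_apply hX' hY', mbr_apply hY' hX', sgn_comm q p, smul_sub, smul_smul, sgn_mul_self,
      one_smul]
    abel)
  jacobi p q r X Y Z hX hY hZ := Subtype.ext (mbr_jacobi hX hY hZ)

/-- The form `(X|Y) = -Str(X Y)` on the Lie superalgebra of matrices preserving `B`. -/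
def ospOfForm (π : ι → ZMod 2) (B : Matrix ι ι ℂ) (hB : B ∈ mpart π 0) :
    (ospOf π B hB).InvariantForm where
  form := (mform π).domRestrict₁₂ (mosp π B) (mosp π B)
  even _ _ _ _ hX hY h := mform_even (π := π) hX hY h
  supersymm _ _ _ _ hX hY := mform_supersymm (π := π) hX hY
  invariant _ _ _ _ _ _ hX hY hZ := mform_invariant (π := π) hX hY hZ

end Matrices

/-- The index set of a homogeneous basis of `ℂ^{1|2n}`. -/
abbrev OspIndex (n : ℕ) : Type := Unit ⊕ (Fin n ⊕ Fin n)

/-- The first basis vector of `ℂ^{1|2n}` is even, the others are odd. -/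
def ospParity (n : ℕ) : OspIndex n → ZMod 2 := Sum.elim (fun _ => 0) (fun _ => 1)

/-- The nondegenerate even supersymmetric form on `ℂ^{1|2n}`: symmetric on the even part,
symplectic on the odd part. -/
def ospMatrix (n : ℕ) : Matrix (OspIndex n) (OspIndex n) ℂ :=
  Matrix.fromBlocks 1 0 0 (Matrix.J (Fin n) ℂ)

theorem ospMatrix_even (n : ℕ) : ospMatrix n ∈ mpart (ospParity n) 0 := by
  rintro (i | i) (j | j) h
  · exact absurd (show (0 : ZMod 2) + 0 = 0 by decide) h
  · rfl
  · rfl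
  · exact absurd (show (1 : ZMod 2) + 1 = 0 by decide) h

/-- The Lie superalgebra `osp(1|2n)`. -/
def osp (n : ℕ) : LieSuperalgebra (mosp (ospParity n) (ospMatrix n)) :=
  ospOf (ospParity n) (ospMatrix n) (ospMatrix_even n)

/-- The invariant form `(X|Y) = -Str(X Y)` of `osp(1|2n)`. On the even part `sp(2n)` it is the trace
form `tr(X Y)` of the natural representation, the normalized invariant form (long roots have square
length `2`). -/
def ospForm (n : ℕ) : (osp n).InvariantForm :=
  ospOfForm (ospParity n) (ospMatrix n) (ospMatrix_even n)

/-- The simple affine vertex superalgebra `L_{osp(1|2n)}(k, 0)` of level `k`. -/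
def Losp (n : ℕ) (k : ℂ) : VertexSuperalgebra (SimpleQuot (ospForm n) k) :=
  simpleAffine (ospForm n) k

end VSA

end

/-! The argument needs no root system. Call an even isotropic `e` extremal if `[[x, e], e] = -2
(x|e) e` for every `x`; long root vectors are of this kind. This relation and invariance of the form
suffice to compute `x(m) e(-1)^(N+1) 1` in the vacuum module for `m > 0`: it is `0` unless `m = 1`,
and then it is `(x|e) (N+1) (k-N) e(-1)^N 1` (`IsExtremal.pos_powVac`). At `N = k` everything
vanishes, so `e(-1)^(k+1) 1` is singular of positive weight. Such a vector generates a submodule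
inside the positive weight part (`mem_maxSub_of_singular`), so it dies in the simple quotient
(`IsExtremal.pow_vacL`). This is the only place where integrality of the level enters.

Now divide the simple quotient by the span `deepPart` of all `x(-n) v` with `n ≥ 2`, which lies in
`C_2` (`deepPart_le_C2`). The quotient is generated from the vacuum by the operators `x(-1)`,
because all deeper modes act by zero. These operators supercommute there, since `[x(-1), y(-1)] =
[x, y](-2)` without central term. For odd `x` this forces `x(-1)^2 = 0`; for extremal `x` the power
`x(-1)^(k+1)` kills the vacuum. If finitely many odd and extremal elements span the Lie
superalgebra, the quotient is therefore spanned by monomials with bounded exponents and is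
finite-dimensional (`exists_finiteDimensional_stable`, `simpleAffine_isC2Cofinite`).

It remains to find such a spanning set for `osp(1|2n)`. The odd part is allowed in full. The even
part `sp(2n)` is the symmetric square of the odd space `ℂ^{2n}`, where `v^2` corresponds to the rank
one map `w ↦ b(v, w) v`. Each of these is extremal (`isExtremal_ospSquare`), and by polarization
squares span the symmetric square (`span_odd_extremal_osp`). -/

noncomputable section

namespace VSA

/-! ### Operators commuting up to scalars. -/

/-- A vector annihilated by a power of each of finitely many operators which commute up to scalars
lies in a finite-dimensional subspace stable under these operators. -/
theorem exists_finiteDimensional_stable {M : Type*} [AddCommGroup M] [Module ℂ M] (v : M) (N : ℕ)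
    (s : Set (Module.End ℂ M)) (hcomm : ∀ S ∈ s, ∀ T ∈ s, ∃ c : ℂ, S * T = c • (T * S))
    (hnil : ∀ T ∈ s, (T ^ N) v = 0) (hs : s.Finite) :
    ∃ U : Submodule ℂ M, FiniteDimensional ℂ U ∧ v ∈ U ∧ ∀ T ∈ s, ∀ u ∈ U, T u ∈ U := by
  have hpow : ∀ S T : Module.End ℂ M, (∃ c : ℂ, S * T = c • (T * S)) → ∀ a : ℕ,
      ∃ c : ℂ, S * T ^ a = c • (T ^ a * S) := by
    rintro S T ⟨c, hc⟩ a
    refine ⟨c ^ a, ?_⟩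
    induction a with
    | zero => simp
    | succ a ih =>
      rw [pow_succ, ← mul_assoc, ih, smul_mul_assoc, mul_assoc, hc, mul_smul_comm, smul_smul,
        ← mul_assoc, pow_succ]
  have hpow' : ∀ S T : Module.End ℂ M, (∃ c : ℂ, S * T = c • (T * S)) → ∀ b : ℕ,
      ∃ c : ℂ, S ^ b * T = c • (T * S ^ b) := by
    rintro S T ⟨c, hc⟩ b
    refine ⟨c ^ b, ?_⟩
    induction b with
    | zero => simp
    | succ b ih =>
      rw [pow_succ', mul_assoc, ih, mul_smul_comm, ← mul_assoc, hc, smul_mul_assoc, smul_smul,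
        mul_assoc, pow_succ]
  -- Operators are adjoined one at a time. Stability is only claimed for those already adjoined, but
  -- the vanishing of `N`-th powers is carried for all of `s`: it bounds the powers of the next
  -- operator.
  suffices h : ∀ t ⊆ s, t.Finite → ∃ U : Submodule ℂ M, FiniteDimensional ℂ U ∧ v ∈ U ∧
      (∀ T ∈ t, ∀ u ∈ U, T u ∈ U) ∧ ∀ T ∈ s, ∀ u ∈ U, (T ^ N) u = 0 by
    obtain ⟨U, h1, h2, h3, -⟩ := h s subset_rfl hs
    exact ⟨U, h1, h2, h3⟩
  intro t hts ht
  induction t, ht using Set.Finite.induction_on with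
  | empty =>
    refine ⟨ℂ ∙ v, inferInstance, Submodule.mem_span_singleton_self v, fun T hT => hT.elim,
      fun T hT u hu => ?_⟩
    obtain ⟨c, rfl⟩ := Submodule.mem_span_singleton.1 hu
    rw [map_smul, hnil T hT, smul_zero]
  | @insert S t _ _ ih =>
    obtain ⟨U, h1, h2, h3, h4⟩ := ih ((Set.subset_insert _ _).trans hts)
    have hS : S ∈ s := hts (Set.mem_insert _ _)
    -- The sum of the `S^a U` for `a ≤ N` already contains every `S^a U`, because `S^N` kills `U`.
    -- So it is finite-dimensional and closed under `S`.
    let U' : Submodule ℂ M := ⨆ a : Fin (N + 1), U.map (S ^ (a : ℕ))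
    have hmem : ∀ a : ℕ, ∀ u ∈ U, (S ^ a) u ∈ U' := by
      intro a u hu
      by_cases ha : a < N + 1
      · exact Submodule.mem_iSup_of_mem (p := fun a : Fin (N + 1) => U.map (S ^ (a : ℕ))) ⟨a, ha⟩
          (Submodule.mem_map_of_mem hu)
      · rw [show a = (a - N) + N by omega, pow_add, Module.End.mul_apply, h4 S hS u hu, map_zero]
        exact zero_mem _
    have hind : ∀ P : Submodule ℂ M, (∀ a : ℕ, ∀ u ∈ U, (S ^ a) u ∈ P) → U' ≤ P := by
      intro P hP
      refine iSup_le fun a => Submodule.map_le_iff_le_comap.2 fun u hu => hP a u hu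
    refine ⟨U', inferInstance, by simpa using hmem 0 v h2, fun T hT => ?_, fun T hT => ?_⟩
    · refine hind (U'.comap T) fun a u hu => ?_
      rw [Submodule.mem_comap, ← Module.End.mul_apply]
      rcases Set.mem_insert_iff.1 hT with rfl | hT'
      · rw [← pow_succ']
        exact hmem _ u hu
      · obtain ⟨c, hc⟩ := hpow T S (hcomm T (hts hT) S hS) a
        rw [hc]
        exact Submodule.smul_mem _ _ (hmem a _ (h3 T hT' u hu))
    -- Nilpotency survives the enlargement: `T^N` moves past `S^a` at the cost of a scalar and then
    -- kills `u`.
    · refine hind (LinearMap.ker (T ^ N)) fun a u hu => ?_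
      obtain ⟨c, hc⟩ := hpow (T ^ N) S (hpow' T S (hcomm T hT S hS) N) a
      rw [LinearMap.mem_ker, ← Module.End.mul_apply, hc, LinearMap.smul_apply,
        Module.End.mul_apply, h4 T hT u hu, map_zero, smul_zero]

/-- Turns a sign rule into vanishing: it gives both `[e, e] = 0` for even `e` and the nilpotency of
the odd `x(-1)` modulo `deepPart`. -/
theorem eq_zero_of_eq_neg_one_smul {M : Type*} [AddCommGroup M] [Module ℂ M] {x : M}
    (h : x = (-1 : ℂ) • x) : x = 0 := by
  have h2 : (2 : ℂ) • x = 0 := by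
    rw [two_smul]
    nth_rewrite 1 [h]
    module
  exact (smul_eq_zero.1 h2).resolve_left two_ne_zero

/-! ### Powers of an extremal element applied to the vacuum. -/

section Affine

variable {g : Type} [AddCommGroup g] [Module ℂ g] {S : LieSuperalgebra g} (κ : S.InvariantForm)
  (k : ℂ)

/-- Against an even `e` both homogeneous components of `x` commute with sign `1`, so `x` may be
arbitrary. This avoids parity splittings in the computations below. -/
theorem md_mul_even {e : g} (he : e ∈ S.part 0) (x : g) (m n : ℤ) :
    md κ x m * md κ e n = md κ e n * md κ x m + md κ (S.bracket x e) (m + n) +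
      (if m + n = 0 then (m : ℂ) * κ.form x e else 0) • cK κ := by
  obtain ⟨a, ha, b, hb, rfl⟩ := exists_part S x
  have h0 := md_mul κ 0 0 a e ha he m n
  have h1 := md_mul κ 1 0 b e hb he m n
  rw [sgn_comm, sgn_zero_left, one_smul] at h0 h1
  simp only [md_add, map_add, LinearMap.add_apply, add_mul, mul_add, h0, h1]
  split_ifs <;> module

theorem md_smul_even {e : g} (he : e ∈ S.part 0) (x : g) (m n : ℤ) (v : VacMod κ k) :
    md κ x m • md κ e n • v = md κ e n • md κ x m • v + md κ (S.bracket x e) (m + n) • v +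
      (if m + n = 0 then (m : ℂ) * κ.form x e else 0) • k • v := by
  rw [smul_smul, md_mul_even κ he, add_smul, add_smul, mul_smul, smul_assoc, cK_smul]

/-- The vector `e(-1)^N 1` of `V^k(g)`. -/
def powVac (e : g) (N : ℕ) : VacMod κ k := md κ e (-1) ^ N • vacV κ k

theorem powVac_succ (e : g) (N : ℕ) :
    powVac κ k e (N + 1) = md κ e (-1) • powVac κ k e N := by
  rw [powVac, pow_succ', mul_smul, powVac]

/-- An even isotropic element `e` with `[[x, e], e] = -2 (x|e) e` for all `x`, such as a long root
vector. -/
structure IsExtremal (κ : S.InvariantForm) (e : g) : Prop where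
  even : e ∈ S.part 0
  isotropic : κ.form e e = 0
  bracket_bracket : ∀ x, S.bracket (S.bracket x e) e = (-2 * κ.form x e) • e

namespace IsExtremal

variable {κ} {e : g} (he : IsExtremal κ e)
include he

theorem bracket_self : S.bracket e e = 0 := by
  have h := S.skew 0 0 e e he.even he.even
  rw [sgn_zero_left, ← neg_one_smul ℂ, one_smul] at h
  exact eq_zero_of_eq_neg_one_smul h

/-- By invariance the value equals `(x|[e, e])`, and `[e, e] = 0`. It removes the central term when
`[x, e](m)` is moved past `e(-1)`. -/
theorem form_bracket (x : g) : κ.form (S.bracket x e) e = 0 := by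
  obtain ⟨a, ha, b, hb, rfl⟩ := exists_part S x
  rw [map_add, LinearMap.add_apply, map_add, LinearMap.add_apply,
    κ.invariant 0 0 0 a e e ha he.even he.even, κ.invariant 1 0 0 b e e hb he.even he.even,
    he.bracket_self, map_zero, map_zero, add_zero]

/-- All modes of `e` commute, since `[e, e] = 0` and `(e|e) = 0`; hence `e(m)` reaches the vacuum
unchanged. -/
theorem self_powVac (m : ℤ) (hm : 0 ≤ m) (N : ℕ) : md κ e m • powVac κ k e N = 0 := by
  induction N with
  | zero => rw [powVac, pow_zero, one_smul, md_vac κ k e m hm]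
  | succ N ih =>
    rw [powVac_succ, md_smul_even κ k he.even, ih, he.bracket_self, he.isotropic]
    rw [← zero_smul ℂ (0 : g), md_smul]
    simp

/-- As in `sl_2`, each of the `N` factors `e(-1)` is an eigenvector for bracketing with `[x, e](0)`,
contributing `-2 (x|e)`. For `m > 0` the commutator is a multiple of `e(m - 1)`, a nonnegative mode,
which kills the rest. -/
theorem bracket_powVac (x : g) (m : ℤ) (hm : 0 ≤ m) (N : ℕ) :
    md κ (S.bracket x e) m • powVac κ k e N =
      (if m = 0 then -2 * κ.form x e * N else 0) • powVac κ k e N := by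
  induction N with
  | zero =>
    rw [powVac, pow_zero, one_smul, md_vac κ k _ m hm]
    simp
  | succ N ih =>
    rw [powVac_succ, md_smul_even κ k he.even, ih, he.bracket_bracket, he.form_bracket, md_smul,
      smul_assoc]
    by_cases h : m = 0
    · subst h
      rw [if_pos rfl, if_pos rfl, smul_comm (md κ e (-1)), zero_add]
      push_cast
      generalize md κ e (-1) • powVac κ k e N = z
      simp only [zero_smul]
      module
    · rw [if_neg h, if_neg h, he.self_powVac k (m + -1) (by omega)]
      simp

/-- Moving `x(1)` past one `e(-1)` yields the eigenvalue of `[x, e](0)` and the central term `(x|e)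
k`. Summed over the factors they give the familiar `sl_2` coefficient, which vanishes at `N = k`.
For `m > 1` neither contribution occurs. -/
theorem pos_powVac (x : g) (m : ℤ) (hm : 0 < m) (N : ℕ) :
    md κ x m • powVac κ k e (N + 1) =
      (if m = 1 then κ.form x e * (N + 1) * (k - N) else 0) • powVac κ k e N := by
  induction N with
  | zero =>
    rw [powVac_succ, md_smul_even κ k he.even, he.bracket_powVac k x _ (by omega), powVac, pow_zero,
      one_smul, md_vac κ k _ m hm.le]
    by_cases h : m = 1
    · subst h
      simp [smul_smul, mul_comm]
    · simp [h, show m + -1 ≠ 0 by omega]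
  | succ N ih =>
    rw [powVac_succ, md_smul_even κ k he.even, he.bracket_powVac k x _ (by omega), ih,
      smul_comm (md κ e (-1)), ← powVac_succ]
    by_cases h : m = 1
    · subst h
      -- The coefficients add up by `(N+1)(k-N) - 2(N+1) + k = (N+2)(k-N-1)`.
      simp only [if_true, show (1 : ℤ) + -1 = 0 by norm_num]
      push_cast
      module
    · simp [h, show m + -1 ≠ 0 by omega]

end IsExtremal

/-! ### Singular vectors in the maximal submodule. -/

variable {κ k} in
/-- A vector of `posPart` annihilated by all positive modes lies in the maximal submodule. -/
theorem mem_maxSub_of_singular {w : VacMod κ k} (hw : w ∈ posPart κ k)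
    (h : ∀ (x : g) (n : ℤ), 0 < n → md κ x n • w = 0) : w ∈ maxSub κ k := by
  -- The subspace generated from `w` by modes of nonpositive index. It turns out to be a full
  -- submodule. Minimality serves as the induction principle: `T ≤ Q` once `Q` contains `w` and is
  -- closed under these modes.
  let T : Submodule ℂ (VacMod κ k) := sInf {T | w ∈ T ∧
    ∀ (x : g) (n : ℤ) (v : VacMod κ k), n ≤ 0 → v ∈ T → md κ x n • v ∈ T}
  have hwT : w ∈ T := Submodule.mem_sInf.2 fun T hT => hT.1
  have hneg : ∀ (x : g) (n : ℤ) (v : VacMod κ k), n ≤ 0 → v ∈ T → md κ x n • v ∈ T :=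
    fun x n v hn hv => Submodule.mem_sInf.2 fun T hT => hT.2 x n v hn (Submodule.mem_sInf.1 hv T hT)
  have hpos : T ≤ posPart κ k := by
    refine sInf_le ⟨hw, fun x n v hn hv => ?_⟩
    rcases hn.lt_or_eq with hn | rfl
    · exact Submodule.subset_span ⟨x, n, v, hn, rfl⟩
    -- Zero modes preserve positive weight: moving `x(0)` past `y(n)` with `n < 0` leaves `[x,
    -- y](n)`, which is again a negative mode, and no central term.
    · induction hv using Submodule.span_induction with
      | mem v hv =>
        obtain ⟨y, n, v, hn, rfl⟩ := hv
        obtain ⟨a, ha, b, hb, rfl⟩ := exists_part S x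
        obtain ⟨c, hc, d, hd, rfl⟩ := exists_part S y
        have hom : ∀ p, ∀ a ∈ S.part p, ∀ q, ∀ b ∈ S.part q,
            md κ a 0 • md κ b n • v ∈ posPart κ k := by
          intro p a ha q b hb
          rw [smul_smul, md_mul κ p q a b ha hb, if_neg (by omega), zero_smul, add_zero, add_smul,
            smul_assoc, mul_smul]
          exact add_mem (Submodule.smul_mem _ _ (Submodule.subset_span ⟨b, n, _, hn, rfl⟩))
            (Submodule.subset_span ⟨_, 0 + n, v, by omega, rfl⟩)
        simp only [md_add, add_smul, smul_add]
        exact add_mem (add_mem (hom 0 a ha 0 c hc) (hom 1 b hb 0 c hc))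
          (add_mem (hom 0 a ha 1 d hd) (hom 1 b hb 1 d hd))
      | zero => rw [smul_zero]; exact zero_mem _
      | add a b _ _ ha hb => rw [smul_add]; exact add_mem ha hb
      | smul c a _ ha => rw [smul_comm]; exact Submodule.smul_mem _ _ ha
  -- The vectors of `T` that positive modes send back into `T`. By hypothesis `w` is one. Closure
  -- under nonpositive modes follows from the commutation relation; the mode `[x, y](n + m)` that
  -- arises is handled by the definition of `P` or by `hneg`, according to its index.
  let P : Submodule ℂ (VacMod κ k) :=
    { carrier := {v | v ∈ T ∧ ∀ (x : g) (n : ℤ), 0 < n → md κ x n • v ∈ T}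
      add_mem' := fun ha hb => ⟨add_mem ha.1 hb.1, fun x n hn => by
        rw [smul_add]; exact add_mem (ha.2 x n hn) (hb.2 x n hn)⟩
      zero_mem' := ⟨zero_mem _, fun x n _ => by rw [smul_zero]; exact zero_mem _⟩
      smul_mem' := fun c v hv => ⟨Submodule.smul_mem _ _ hv.1, fun x n hn => by
        rw [smul_comm]; exact Submodule.smul_mem _ _ (hv.2 x n hn)⟩ }
  have hP : T ≤ P := by
    refine sInf_le ⟨⟨hwT, fun x n hn => ?_⟩, fun y m v hm hvP => ⟨hneg y m v hm hvP.1,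
      fun x n hn => ?_⟩⟩
    · rw [h x n hn]
      exact zero_mem _
    · have hom : ∀ p, ∀ a ∈ S.part p, ∀ q, ∀ b ∈ S.part q, md κ a n • md κ b m • v ∈ T := by
        intro p a ha q b hb
        rw [smul_smul, md_mul κ p q a b ha hb, add_smul, add_smul, smul_assoc, mul_smul,
          smul_assoc, cK_smul]
        refine add_mem (add_mem (Submodule.smul_mem _ _ (hneg b m _ hm (hvP.2 a n hn))) ?_)
          (Submodule.smul_mem _ _ (Submodule.smul_mem _ _ hvP.1))
        by_cases h : 0 < n + m
        · exact hvP.2 _ _ h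
        · exact hneg _ _ _ (by omega) hvP.1
      obtain ⟨a, ha, b, hb, rfl⟩ := exists_part S x
      obtain ⟨c, hc, d, hd, rfl⟩ := exists_part S y
      simp only [md_add, add_smul, smul_add]
      exact add_mem (add_mem (hom 0 a ha 0 c hc) (hom 1 b hb 0 c hc))
        (add_mem (hom 0 a ha 1 d hd) (hom 1 b hb 1 d hd))
  have hall : ∀ u : AffU κ, ∀ v ∈ T, u • v ∈ T := by
    intro u
    induction u using affU_induction with
    | h0 c => intro v hv; rw [algebraMap_smul]; exact Submodule.smul_mem _ _ hv
    | h1 x n =>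
      intro v hv
      by_cases hn : 0 < n
      · exact (hP hv).2 x n hn
      · exact hneg x n v (by omega) hv
    | h2 => intro v hv; rw [cK_smul]; exact Submodule.smul_mem _ _ hv
    | ha a b iha ihb => intro v hv; rw [add_smul]; exact add_mem (iha v hv) (ihb v hv)
    | hm a b iha ihb => intro v hv; rw [mul_smul]; exact iha _ (ihb v hv)
  exact fun u => hpos (hall u w hwT)

/-- At level `k`, the vector `e(-1)^(k+1) 1` vanishes in `L_g(k, 0)`. -/
theorem IsExtremal.pow_vacL {κ : S.InvariantForm} {e : g} (he : IsExtremal κ e) (k : ℕ) :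
    md κ e (-1) ^ (k + 1) • vacL κ (k : ℂ) = 0 := by
  have h : powVac κ (k : ℂ) e (k + 1) ∈ maxSub κ (k : ℂ) := by
    refine mem_maxSub_of_singular ?_ fun x n hn => ?_
    · rw [powVac_succ]
      exact Submodule.subset_span ⟨e, -1, _, by omega, rfl⟩
    -- The exponent is `k + 1`, so the coefficient contains the factor `k - k`.
    · rw [he.pos_powVac k x n hn]
      simp
  rw [vacL, ← map_smul]
  exact (Submodule.Quotient.mk_eq_zero _).2 h

/-! ### The quotient by deep modes and its finite dimension. -/

/-- The span of the vectors `x(-n) v` with `n ≥ 2`. -/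
def deepPart : Submodule ℂ (SimpleQuot κ k) :=
  Submodule.span ℂ {w | ∃ (x : g) (n : ℤ) (v : SimpleQuot κ k), n ≤ -2 ∧ w = md κ x n • v}

/-- The mode `x(n)` is the `n`-th mode of the state `x(-1) 1`, so it is enough that `u_{-2-n} v`
lies in `C_2` for all `n ≥ 0`. The translation operator lowers the index: `(D u)_m = -m u_{m-1}`,
and `m ≤ -2` is nonzero and can be divided out. -/
theorem deepPart_le_C2 : deepPart κ k ≤ (simpleAffine κ k).C2 := by
  have h : ∀ (n : ℕ) (u v : SimpleQuot κ k),
      (simpleAffine κ k).Y u (-2 - n) v ∈ (simpleAffine κ k).C2 := by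
    intro n
    induction n with
    | zero => exact fun u v => Submodule.subset_span ⟨u, v, by simp⟩
    | succ n ih =>
      intro u v
      have h1 := ih ((simpleAffine κ k).D u) v
      rw [(simpleAffine κ k).D_deriv, LinearMap.smul_apply] at h1
      have h0 : (-((-2 - (n : ℤ) : ℤ) : ℂ)) ≠ 0 := by
        rw [neg_ne_zero]
        exact_mod_cast (by omega : (-2 - (n : ℤ)) ≠ 0)
      have h2 := (Submodule.smul_mem_iff _ h0).1 h1
      rwa [show (-2 - ((n + 1 : ℕ) : ℤ)) = -2 - n - 1 by push_cast; ring]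
  refine Submodule.span_le.2 ?_
  rintro _ ⟨x, n, v, hn, rfl⟩
  have h1 := h (-2 - n).toNat (md κ x (-1) • vacL κ k) v
  rwa [simpleAffine_Y, modeL_apply, show -2 - ((-2 - n).toNat : ℤ) = n by omega] at h1

/-- Moving `x(-1)` past `y(n)` with `n ≤ -2` creates only `[x, y](n - 1)`, which is deeper still;
the indices cannot sum to zero, so there is no central term. -/
theorem deepPart_stable (x : g) : deepPart κ k ≤ (deepPart κ k).comap (modeL κ k x (-1)) := by
  refine Submodule.span_le.2 ?_
  rintro _ ⟨y, n, v, hn, rfl⟩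
  change md κ x (-1) • md κ y n • v ∈ deepPart κ k
  obtain ⟨a, ha, b, hb, rfl⟩ := exists_part S x
  obtain ⟨c, hc, d, hd, rfl⟩ := exists_part S y
  have hom : ∀ p, ∀ a ∈ S.part p, ∀ q, ∀ b ∈ S.part q,
      md κ a (-1) • md κ b n • v ∈ deepPart κ k := by
    intro p a ha q b hb
    rw [smul_smul, md_mul κ p q a b ha hb, if_neg (by omega), zero_smul, add_zero, add_smul,
      smul_assoc, mul_smul]
    exact add_mem (Submodule.smul_mem _ _ (Submodule.subset_span ⟨b, n, _, hn, rfl⟩))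
      (Submodule.subset_span ⟨_, -1 + n, v, by omega, rfl⟩)
  simp only [md_add, add_smul, smul_add]
  exact add_mem (add_mem (hom 0 a ha 0 c hc) (hom 1 b hb 0 c hc))
    (add_mem (hom 0 a ha 1 d hd) (hom 1 b hb 1 d hd))

/-- The action of `x(-1)` modulo `deepPart`. -/
def deepOp (x : g) : Module.End ℂ (SimpleQuot κ k ⧸ deepPart κ k) :=
  (deepPart κ k).mapQ (deepPart κ k) (modeL κ k x (-1)) (deepPart_stable κ k x)

theorem deepOp_mk (x : g) (v : SimpleQuot κ k) :
    deepOp κ k x ((deepPart κ k).mkQ v) = (deepPart κ k).mkQ (md κ x (-1) • v) := rfl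

theorem deepOp_pow_mk (x : g) (N : ℕ) (v : SimpleQuot κ k) :
    (deepOp κ k x ^ N) ((deepPart κ k).mkQ v) = (deepPart κ k).mkQ (md κ x (-1) ^ N • v) := by
  induction N with
  | zero => simp
  | succ N ih => rw [pow_succ', Module.End.mul_apply, ih, deepOp_mk, smul_smul, ← pow_succ']

/-- The correction term is `[x, y](-2)`, which is zero modulo `deepPart`, and the central term is
absent because `-1 + -1 ≠ 0`. -/
theorem deepOp_comm {p q : ZMod 2} {x y : g} (hx : x ∈ S.part p) (hy : y ∈ S.part q) :
    deepOp κ k x * deepOp κ k y = sgn p q • (deepOp κ k y * deepOp κ k x) := by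
  refine LinearMap.ext fun v => ?_
  obtain ⟨v, rfl⟩ := (deepPart κ k).mkQ_surjective v
  rw [LinearMap.smul_apply, Module.End.mul_apply, Module.End.mul_apply, deepOp_mk, deepOp_mk,
    deepOp_mk, deepOp_mk, smul_smul, md_mul κ p q x y hx hy, if_neg (by omega), zero_smul, add_zero,
    add_smul, smul_assoc, mul_smul, map_add, map_smul, add_eq_left]
  exact (Submodule.Quotient.mk_eq_zero _).2 (Submodule.subset_span ⟨_, _, v, by omega, rfl⟩)

variable {κ k} in
theorem simpleQuot_neg_gen (T : Submodule ℂ (SimpleQuot κ k)) (h0 : vacL κ k ∈ T)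
    (h1 : ∀ (x : g) (n : ℤ) (v : SimpleQuot κ k), n < 0 → v ∈ T → md κ x n • v ∈ T) : T = ⊤ := by
  -- `mkL` is linear over the enveloping algebra, while `T` is only a complex subspace; pulling `T`
  -- back requires the complex-linear version.
  let π : VacMod κ k →ₗ[ℂ] SimpleQuot κ k :=
    { toFun := mkL κ k
      map_add' := map_add _
      map_smul' := fun c v => by
        rw [← algebraMap_smul (AffU κ) c v, map_smul, algebraMap_smul, RingHom.id_apply] }
  have h : T.comap π = ⊤ := neg_gen κ k _ h0 fun x n v hn hv => by
    change mkL κ k (md κ x n • v) ∈ T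
    rw [map_smul]
    exact h1 x n _ hn hv
  refine top_unique fun v _ => ?_
  obtain ⟨a, rfl⟩ := mkL_surjective κ k v
  have : a ∈ T.comap π := h ▸ Submodule.mem_top
  exact this

/-- `L_g(k, 0)` is `C_2`-cofinite if `k` is a natural number and `g` is finite-dimensional
and spanned by odd and extremal elements. -/
theorem simpleAffine_isC2Cofinite [FiniteDimensional ℂ g] (k : ℕ)
    (h : Submodule.span ℂ {x | x ∈ S.part 1 ∨ IsExtremal κ x} = ⊤) :
    (simpleAffine κ (k : ℂ)).IsC2Cofinite := by
  -- Finite dimension of `g` makes finitely many odd and extremal elements suffice as a spanning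
  -- set.
  obtain ⟨F, hF, hspan⟩ := Submodule.fg_span_iff_fg_span_finset_subset _ |>.1
    (IsNoetherian.noetherian (Submodule.span ℂ {x | x ∈ S.part 1 ∨ IsExtremal κ x}))
  rw [h] at hspan
  have hpar : ∀ x ∈ F, ∃ p, x ∈ S.part p := fun x hx =>
    (hF hx).elim (fun h => ⟨1, h⟩) fun h => ⟨0, h.even⟩
  -- The common exponent `k + 2` covers both kinds of generators: at least `2` for the odd ones,
  -- whose square is zero as an operator, and at least `k + 1` for the extremal ones, whose power is
  -- only known to kill the vacuum.
  obtain ⟨U, hU, hvac, hst⟩ := exists_finiteDimensional_stable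
    ((deepPart κ (k : ℂ)).mkQ (vacL κ (k : ℂ))) (k + 2) (deepOp κ (k : ℂ) '' (F : Set g))
    (by
      rintro _ ⟨x, hx, rfl⟩ _ ⟨y, hy, rfl⟩
      obtain ⟨p, hp⟩ := hpar x hx
      obtain ⟨q, hq⟩ := hpar y hy
      exact ⟨_, deepOp_comm κ k hp hq⟩)
    (by
      rintro _ ⟨x, hx, rfl⟩
      rcases hF hx with hx | hx
      · have h : deepOp κ (k : ℂ) x * deepOp κ (k : ℂ) x = 0 := by
          have h := deepOp_comm κ (k : ℂ) hx hx
          rw [sgn, if_pos ⟨rfl, rfl⟩] at h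
          exact eq_zero_of_eq_neg_one_smul h
        rw [pow_add, pow_two, h, mul_zero, LinearMap.zero_apply]
      · rw [deepOp_pow_mk, pow_succ', mul_smul, hx.pow_vacL k, smul_zero, map_zero])
    (F.finite_toSet.image _)
  -- `U` is stable under the operators from `F`, and `deepOp` depends linearly on `x`, so stability
  -- extends to the span of `F`.
  have hop : ∀ x : g, ∀ u ∈ U, deepOp κ (k : ℂ) x u ∈ U := by
    intro x u hu
    obtain ⟨v, rfl⟩ := (deepPart κ (k : ℂ)).mkQ_surjective u
    have hx : x ∈ Submodule.span ℂ (F : Set g) := hspan ▸ Submodule.mem_top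
    induction hx using Submodule.span_induction with
    | mem x hx => exact hst _ ⟨x, hx, rfl⟩ _ hu
    | zero =>
      rw [deepOp_mk, ← zero_smul ℂ (0 : g), md_smul, zero_smul, zero_smul, map_zero]
      exact zero_mem _
    | add x y _ _ hx hy =>
      rw [deepOp_mk, md_add, add_smul, map_add]
      exact add_mem hx hy
    | smul c x _ hx =>
      rw [deepOp_mk, md_smul, smul_assoc, map_smul]
      exact Submodule.smul_mem _ _ hx
  have htop : U.comap (deepPart κ (k : ℂ)).mkQ = ⊤ := by
    -- Negative modes suffice to generate from the vacuum: index `-1` preserves `U`, and every index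
    -- `≤ -2` acts by zero modulo `deepPart`.
    refine simpleQuot_neg_gen _ hvac fun x n v hn hv => ?_
    by_cases h : n = -1
    · subst h
      exact hop x _ hv
    · rw [Submodule.mem_comap]
      have : (deepPart κ (k : ℂ)).mkQ (md κ x n • v) = 0 :=
        (Submodule.Quotient.mk_eq_zero _).2 (Submodule.subset_span ⟨x, n, v, by omega, rfl⟩)
      rw [this]
      exact zero_mem _
  have hUtop : U = ⊤ := by
    refine top_unique fun u _ => ?_
    obtain ⟨v, rfl⟩ := (deepPart κ (k : ℂ)).mkQ_surjective u
    exact (htop ▸ Submodule.mem_top : v ∈ U.comap (deepPart κ (k : ℂ)).mkQ)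
  subst hUtop
  have hfd : FiniteDimensional ℂ (SimpleQuot κ (k : ℂ) ⧸ deepPart κ (k : ℂ)) :=
    Module.finite_def.2 (Module.Finite.iff_fg.1 hU)
  exact Module.Finite.of_surjective (Submodule.factor (deepPart_le_C2 κ (k : ℂ)))
    (Submodule.factor_surjective _)

end Affine

/-! ### Rank one even elements of `osp(1|2n)`. -/

theorem mbr_even {ι : Type} [Fintype ι] [DecidableEq ι] {π : ι → ZMod 2} {E : Matrix ι ι ℂ}
    (hE : E ∈ mpart π 0) (X : Matrix ι ι ℂ) : mbr π X E = X * E - E * X := by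
  have h : ∀ p, mbr π (mcomp π p X) E = mcomp π p X * E - E * mcomp π p X := fun p => by
    rw [mbr_apply (mcomp_mem p X) hE, sgn_comm, sgn_zero_left, one_smul]
  rw [← mcomp_add (π := π) X, map_add, LinearMap.add_apply, h, h]
  noncomm_ring

section Osp

open Matrix

variable {n : ℕ}

theorem ospMatrix_mul_transpose : ospMatrix n * (ospMatrix n)ᵀ = 1 := by
  simp [ospMatrix, Matrix.fromBlocks_transpose, Matrix.fromBlocks_multiply, Matrix.J]

/-- The square of the Gram matrix is the parity operator; this is how the symplectic sign enters
`osp_even_mul_transpose_symm`. -/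
theorem ospMatrix_mul_self :
    ospMatrix n * ospMatrix n = Matrix.fromBlocks (1 : Matrix Unit Unit ℂ) 0 0 (-1) := by
  simp [ospMatrix, Matrix.fromBlocks_multiply, Matrix.J_squared]

theorem ospMatrix_transpose_mulVec {v : OspIndex n → ℂ} (hv : v (Sum.inl ()) = 0) :
    (ospMatrix n)ᵀ *ᵥ v = -(ospMatrix n *ᵥ v) := by
  obtain ⟨a, b, rfl⟩ : ∃ a b, v = Sum.elim a b := ⟨_, _, (Sum.elim_comp_inl_inr v).symm⟩
  obtain rfl : a = 0 := funext fun _ => hv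
  rw [ospMatrix, Matrix.fromBlocks_transpose, Matrix.fromBlocks_mulVec, Matrix.fromBlocks_mulVec,
    Matrix.J_transpose]
  ext (i | i) <;> simp [Matrix.neg_mulVec]

/-- The endomorphism `w ↦ b(v, w) v` of `ℂ^{1|2n}`. -/
def ospSquare (v : OspIndex n → ℂ) : Matrix (OspIndex n) (OspIndex n) ℂ :=
  vecMulVec v v * ospMatrix n

theorem ospSquare_eq (v : OspIndex n → ℂ) :
    ospSquare v = vecMulVec v (v ᵥ* ospMatrix n) := Matrix.vecMulVec_mul _ _ _

theorem vecMul_ospMatrix_inl {v : OspIndex n → ℂ} (hv : v (Sum.inl ()) = 0) :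
    (v ᵥ* ospMatrix n) (Sum.inl ()) = 0 := by
  simp [Matrix.vecMul, dotProduct, ospMatrix, hv]

/-- The form is skew on the odd space, so `b(v, v)` equals its own negative. -/
theorem vecMul_ospMatrix_dotProduct {v : OspIndex n → ℂ} (hv : v (Sum.inl ()) = 0) :
    v ᵥ* ospMatrix n ⬝ᵥ v = 0 := by
  have h := congrArg (v ⬝ᵥ ·) (ospMatrix_transpose_mulVec hv)
  simp only [Matrix.mulVec_transpose, dotProduct_neg] at h
  rw [dotProduct_comm v (v ᵥ* _), dotProduct_mulVec] at h
  exact self_eq_neg.1 h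

theorem ospSquare_even {v : OspIndex n → ℂ} (hv : v (Sum.inl ()) = 0) :
    ospSquare v ∈ mpart (ospParity n) 0 := by
  rw [ospSquare_eq]
  rintro (i | i) (j | j) h
  · simp [vecMulVec_apply, hv]
  · simp [vecMulVec_apply, hv]
  · simp [vecMulVec_apply, vecMul_ospMatrix_inl hv]
  · exact absurd (show (1 : ZMod 2) + 1 = 0 by decide) h

/-- With `B` the matrix of the form, `(v vᵀ B)ᵀ B = (Bᵀ v) vᵀ B`, and `Bᵀ v = -B v` for odd `v`. -/
theorem ospSquare_mem {v : OspIndex n → ℂ} (hv : v (Sum.inl ()) = 0) :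
    ospSquare v ∈ mosp (ospParity n) (ospMatrix n) := by
  rw [mosp_iff (ospMatrix_even n) (ospSquare_even hv)]
  have h1 : Matrix.diagonal (fun i => sgn 0 (ospParity n i)) = 1 := by
    simp only [sgn_zero_left, Matrix.diagonal_one]
  rw [h1, one_mul, ospSquare, Matrix.transpose_mul, Matrix.transpose_vecMulVec, ← mul_assoc,
    Matrix.mul_vecMulVec, Matrix.mul_vecMulVec, ospMatrix_transpose_mulVec hv,
    Matrix.neg_vecMulVec, neg_mul]

/-- Sandwiching `X` between two copies of the rank one matrix `v φ`, where `φ = vᵀ B`, produces the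
scalar `φ(X v)`. The same scalar is the value of the invariant form in `mform_ospSquare`, and this
coincidence is what makes the element extremal. -/
theorem ospSquare_mul_mul (v : OspIndex n → ℂ) (X : Matrix (OspIndex n) (OspIndex n) ℂ) :
    ospSquare v * X * ospSquare v = (v ᵥ* ospMatrix n ⬝ᵥ X *ᵥ v) • ospSquare v := by
  rw [ospSquare_eq, mul_assoc, Matrix.mul_vecMulVec, Matrix.vecMulVec_mul_vecMulVec,
    Matrix.vecMulVec_smul]

/-- The diagonal entry at the even index vanishes because `φ = vᵀ B` does there. At odd indices the
sign of the supertrace cancels the sign of the form, leaving the ordinary trace of `(X v) φ`. -/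
theorem mform_ospSquare {v : OspIndex n → ℂ} (hv : v (Sum.inl ()) = 0)
    (X : Matrix (OspIndex n) (OspIndex n) ℂ) :
    mform (ospParity n) X (ospSquare v) = v ᵥ* ospMatrix n ⬝ᵥ X *ᵥ v := by
  change -∑ i, _ = _
  rw [ospSquare_eq, Matrix.mul_vecMulVec, dotProduct, ← Finset.sum_neg_distrib]
  refine Finset.sum_congr rfl ?_
  rintro (i | i) -
  · simp [vecMulVec_apply, vecMul_ospMatrix_inl hv]
  · simp [vecMulVec_apply, ospParity, sgn, mul_comm]

/-- Write `E` for the rank one matrix. Since `b(v, v) = 0`, `E^2 = 0`, which gives isotropy and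
reduces the double commutator `X E^2 - 2 E X E + E^2 X` to `-2 E X E`. -/
theorem isExtremal_ospSquare {v : OspIndex n → ℂ} (hv : v (Sum.inl ()) = 0) :
    IsExtremal (ospForm n) ⟨ospSquare v, ospSquare_mem hv⟩ := by
  have hsq : ospSquare v * ospSquare v = 0 := by
    have h := ospSquare_mul_mul v 1
    rwa [mul_one, Matrix.one_mulVec, vecMul_ospMatrix_dotProduct hv, zero_smul] at h
  refine ⟨ospSquare_even hv, ?_, fun X => Subtype.ext ?_⟩
  · change mform (ospParity n) (ospSquare v) (ospSquare v) = 0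
    rw [mform]
    simp [hsq]
  · change mbr (ospParity n) (mbr (ospParity n) X.1 (ospSquare v)) (ospSquare v) =
      (-2 * mform (ospParity n) X.1 (ospSquare v)) • ospSquare v
    rw [mbr_even (ospSquare_even hv), mbr_even (ospSquare_even hv), mform_ospSquare hv, mul_smul,
      ← ospSquare_mul_mul, sub_mul, mul_sub, mul_assoc X.1, ← mul_assoc _ _ X.1, hsq, mul_zero,
      zero_mul, ← mul_assoc]
    module

/-! ### Spanning `sp(2n)` by squares. -/

/-- On the one-dimensional even space an even element acts through `o(1) = 0`: invariance says that
twice the corner entry is zero. The rest of the row vanishes by parity. -/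
theorem osp_even_inl {X : Matrix (OspIndex n) (OspIndex n) ℂ} (hX : X ∈ mpart (ospParity n) 0)
    (hX' : X ∈ mosp (ospParity n) (ospMatrix n)) (j : OspIndex n) : X (Sum.inl ()) j = 0 := by
  rcases j with j | j
  · have h := hX' (Sum.inl ()) (Sum.inl ())
    simp [Matrix.mul_apply, ospMatrix, ospParity, sgn] at h
    simpa using h
  · exact hX _ _ (show (0 : ZMod 2) + 1 ≠ 0 by decide)

/-- This identifies `sp(2n)` with symmetric matrices: `Z = X Bᵀ` recovers `X = Z B`, because `B` is
orthogonal. Symmetry combines `Xᵀ B = -B X` with `B (B X) = -X`; the latter holds because `B^2` is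
`-1` on the odd rows and the even row of `X` is zero. -/
theorem osp_even_mul_transpose_symm {X : Matrix (OspIndex n) (OspIndex n) ℂ}
    (hX : X ∈ mpart (ospParity n) 0) (hX' : X ∈ mosp (ospParity n) (ospMatrix n)) :
    (X * (ospMatrix n)ᵀ)ᵀ = X * (ospMatrix n)ᵀ := by
  have h1 : Matrix.diagonal (fun i => sgn 0 (ospParity n i)) = 1 := by
    simp only [sgn_zero_left, Matrix.diagonal_one]
  have h := (mosp_iff (ospMatrix_even n) hX).1 hX'
  rw [h1, one_mul] at h
  have h2 : ospMatrix n * (ospMatrix n * X) = -X := by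
    rw [← mul_assoc, ospMatrix_mul_self]
    ext (i | i) j
    · simp [Matrix.mul_apply, osp_even_inl hX hX' j]
    · simp [Matrix.mul_apply, Matrix.one_apply]
  have h3 : Xᵀ = -(ospMatrix n * X * (ospMatrix n)ᵀ) := by
    rw [← neg_mul, ← h, mul_assoc, ospMatrix_mul_transpose, mul_one]
  rw [Matrix.transpose_mul, Matrix.transpose_transpose, h3, mul_neg, ← mul_assoc, h2, neg_mul,
    neg_neg]

theorem span_odd_extremal_osp :
    Submodule.span ℂ {x | x ∈ (osp n).part 1 ∨ IsExtremal (ospForm n) x} = ⊤ := by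
  set P := Submodule.span ℂ {x | x ∈ (osp n).part 1 ∨ IsExtremal (ospForm n) x}
  have hsq : ∀ v : OspIndex n → ℂ, v (Sum.inl ()) = 0 →
      ospSquare v ∈ P.map (mosp (ospParity n) (ospMatrix n)).subtype := fun v hv =>
    ⟨_, Submodule.subset_span (Or.inr (isExtremal_ospSquare hv)), rfl⟩
  -- Polarization: the symmetric product of `v` and `w` is the square of `v + w` minus the squares
  -- of `v` and `w`.
  have hpol : ∀ v w : OspIndex n → ℂ, v (Sum.inl ()) = 0 → w (Sum.inl ()) = 0 →
      (vecMulVec v w + vecMulVec w v) * ospMatrix n ∈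
        P.map (mosp (ospParity n) (ospMatrix n)).subtype := by
    intro v w hv hw
    have h : (vecMulVec v w + vecMulVec w v) * ospMatrix n =
        ospSquare (v + w) - ospSquare v - ospSquare w := by
      simp only [ospSquare, Matrix.add_vecMulVec, Matrix.vecMulVec_add, add_mul]
      abel
    rw [h]
    exact sub_mem (sub_mem (hsq _ (by simp [hv, hw])) (hsq v hv)) (hsq w hw)
  have heven : ∀ x ∈ (osp n).part 0, x ∈ P := by
    rintro ⟨X, hX'⟩ hX
    replace hX : X ∈ mpart (ospParity n) 0 := hX
    have hsymm := osp_even_mul_transpose_symm hX hX'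
    set Z := X * (ospMatrix n)ᵀ with hZ
    have hZ0 : ∀ j, Z (Sum.inl ()) j = 0 := fun j => by
      simp [hZ, Matrix.mul_apply, osp_even_inl hX hX']
    have hXZ : X = Z * ospMatrix n := by
      rw [hZ, mul_assoc, mul_eq_one_comm.1 ospMatrix_mul_transpose, mul_one]
    -- The symmetric matrix `Z` is expanded in matrix units once directly and once transposed.
    -- Adding the two expansions gives symmetric products of basis vectors, at the price of a factor
    -- `2` that is divided out at the end.
    have hdec : (2 : ℂ) • X = ∑ i, ∑ j, Z i j • ((vecMulVec (Pi.single i 1) (Pi.single j 1) +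
        vecMulVec (Pi.single j 1) (Pi.single i 1)) * ospMatrix n) := by
      have hZ1 : Z = ∑ i, ∑ j, Z i j • vecMulVec (Pi.single i 1) (Pi.single j 1) := by
        simpa [← Matrix.single_eq_single_vecMulVec_single, Matrix.smul_single] using
          Matrix.matrix_eq_sum_single Z
      have hZ2 : Z = ∑ i, ∑ j, Z i j • vecMulVec (Pi.single j 1) (Pi.single i 1) := by
        nth_rewrite 1 [hZ1]
        rw [Finset.sum_comm]
        refine Finset.sum_congr rfl fun i _ => Finset.sum_congr rfl fun j _ => ?_
        rw [← hsymm, Matrix.transpose_apply, hsymm]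
      simp only [add_mul, smul_add, Finset.sum_add_distrib]
      simp only [← smul_mul_assoc, ← Finset.sum_mul]
      rw [← hZ1, ← hZ2, ← hXZ, two_smul]
    have h2 : (2 : ℂ) • X ∈ P.map (mosp (ospParity n) (ospMatrix n)).subtype := by
      rw [hdec]
      refine sum_mem fun i _ => sum_mem fun j _ => ?_
      -- The row and, by symmetry, the column of `Z` at the even index vanish, so only odd basis
      -- vectors contribute, and `hpol` applies to these.
      rcases i with i | i
      · rw [hZ0, zero_smul]
        exact zero_mem _
      rcases j with j | j
      · rw [← hsymm, Matrix.transpose_apply, hZ0, zero_smul]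
        exact zero_mem _
      · exact Submodule.smul_mem _ _ (hpol _ _ (by simp) (by simp))
    obtain ⟨⟨Y, hY⟩, hYP, hYX⟩ := (Submodule.smul_mem_iff _ two_ne_zero).1 h2
    obtain rfl : Y = X := hYX
    exact hYP
  refine top_unique fun x _ => ?_
  obtain ⟨a, ha, b, hb, rfl⟩ := exists_part (osp n) x
  exact add_mem (heven a ha) (Submodule.subset_span (Or.inl hb))

end Osp

end VSA

end

theorem mainTheorem5 (n : ℕ) (hn : 1 ≤ n) (k : ℕ) (hk : 1 ≤ k) :
    (VSA.Losp n (k : ℂ)).IsC2Cofinite :=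
  VSA.simpleAffine_isC2Cofinite (VSA.ospForm n) k VSA.span_odd_extremal_osp
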